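/- **Setting.** Let $n\ge 1$, ${\bf b}\in\mathbb R^n\setminus\{0\}$ a constant vector, and $\Omega\subset\mathbb R^n$ a bounded polytopal domain with inflow boundary $\Gamma_-$ (the closure of the set of points of $\partial\Omega$ at which the outward unit normal ${\bf n}$ exists and ${\bf n}\cdot{\bf b}<0$). Let $H({\bf b};\Omega)=\{w\in L_2(\Omega):\partial_{\bf b}w:={\bf b}\cdot\nabla w\in L_2(\Omega)\}$ (weak derivative), and let $H_{0,\Gamma_-}({\bf b};\Omega)$ be the closure in $H({\bf b};\Omega)$ of the smooth functions on $\overline\Omega$ that vanish on $\Gamma_-$. Fix degrees $m_u,m_f\ge 0$, $m_w\ge 1$. Let $\mathbb T$ be the family of all partitions of $\overline\Omega$ into essentially disjoint closed $n$-simplices that are obtained from an initial partition $\mathcal T_\bot$ by repeatedly splitting individual simplices according to a refinement rule, which splits a simplex into two or more essentially disjoint subsimplices. Let $c\in\mathcal P_0(\mathcal T_\bot)$, i.e. $c$ is constant on each $K\in\mathcal T_\bot$. The simplices occurring in $\mathbb T$ are uniformly shape regular: $\operatorname{diam}(K)/\sup\{\operatorname{diam} B: B\subset K \text{ a ball}\}\le\varrho$.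 Moreover, $r$-fold uniform refinement of a simplex $K$ occurring in $\mathbb T$ produces simplices of diameter at most $s(r)\operatorname{diam}(K)$, where $s(r)\to0$ as $r\to\infty$, and, if $n>1$, it produces a conforming (face-to-face) partition of $K$. For $\mathcal T\in\mathbb T$ let $\mathbb F^\delta_{\mathcal T}=\prod_{K\in\mathcal T}\mathcal P_{m_f}(K)$ and $\breve{\mathbb U}^\delta_{\mathcal T}=\prod_{K\in\mathcal T}\mathcal P_{m_u}(K)\times\big(H_{0,\Gamma_-}({\bf b};\Omega)\cap\prod_{K\in\mathcal T}\mathcal P_{m_w}(K)\big)$. For $S\subseteq\Omega$ put $\eta_S^2(u,w;f)=\|u-w\|_{L_2(S)}^2+\|\partial_{\bf b}w+cu-f\|_{L_2(S)}^2$, and $\eta_{\mathcal M}^2=\sum_{K\in\mathcal M}\eta_K^2$ for $\mathcal M\subseteq\mathcal T$. Let $(\bar u_{\mathcal T},\bar w_{\mathcal T})$ be the minimizer of $\eta_\Omega^2(\cdot,\cdot;f)$ over $\breve{\mathbb U}^\delta_{\mathcal T}$. For $\mathcal M\subseteq\mathcal T$ and $r\in\mathbb N$ let $\tilde{\mathcal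 T}(\mathcal T,\mathcal M,r)\in\mathbb T$ be obtained from $\mathcal T$ by $r$ refinements of each $K\in\mathcal M$ and, if $n>1$, also of each $K\in\mathcal T$ that meets $\bigcup_{K''\in\mathcal M,\,t\ge0}(K''+t{\bf b})$. **Conjecture** (used for $n>1$ only; with $\vartheta\in(0,1]$, $\beta\in(0,\frac14)$, constants $\xi<\big(\tfrac{\sqrt2}{\vartheta}\sqrt{(2\|c\|_{L_\infty(\Omega)}+1)^2+1}\big)^{-1}$ and $C$, and $r_0\in\mathbb N$). Let $\mathcal T\in\mathbb T$, $f\in\mathbb F^\delta_{\mathcal T}$, $g=\partial_{\bf b}\bar w_{\mathcal T}+c\bar u_{\mathcal T}-f$, $e=\bar u_{\mathcal T}-\bar w_{\mathcal T}$, and let $\mathcal M\subseteq\mathcal T$ satisfy $\eta_{\mathcal M}(\bar u_{\mathcal T},\bar w_{\mathcal T};f)\ge\vartheta\,\eta_\Omega(\bar u_{\mathcal T},\bar w_{\mathcal T};f)$. Let $\mathcal M_{\rm II}$ be the set of those $K\in\mathcal M$ with $\|e+cg\|^2_{L_2(K)}<\beta(\|g\|_{L_2(K)}^2+\|e\|_{L_2(K)}^2)$,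 and suppose that $\eta_{\mathcal M_{\rm II}}(\bar u_{\mathcal T},\bar w_{\mathcal T};f)\ge\eta_{\mathcal M\setminus\mathcal M_{\rm II}}(\bar u_{\mathcal T},\bar w_{\mathcal T};f)$. Let $F$ be the function that on each $K\in\mathcal M_{\rm II}$ equals at ${\bf x}$ the average of $g$ over the segment $\{{\bf x}+t{\bf b}:t\in\mathbb R\}\cap K$, and that vanishes elsewhere. Then there is a $\tilde w$ with $(0,\tilde w)\in\breve{\mathbb U}^\delta_{\tilde{\mathcal T}}$, $\tilde{\mathcal T}=\tilde{\mathcal T}(\mathcal T,\mathcal M,r_0)$, that vanishes outside the union of the cells of $\mathcal T$ that are refined in $\tilde{\mathcal T}$, such that $\|\partial_{\bf b}\tilde w+c\tilde w-F\|_{L_2(\Omega)}\le\xi\|F\|_{L_2(\Omega)}$ and $\|\tilde w\|_{L_2(\Omega)}\le C\|F\|_{L_2(\Omega)}$. **Theorem.** Let $\vartheta\in(0,1]$. There is a $\sigma_0>0$ such that, if $\sup_{K\in\mathcal T\in\mathbb T}\operatorname{diam}(K)\le\sigma_0$ and if $n=1$, or $n>1$ and the Conjecture holds for $\mathbb T$,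 there exist $r\in\mathbb N$ and $\nu\in(0,1)$ with the following property: whenever $\mathcal T\in\mathbb T$, $f\in\mathbb F^\delta_{\mathcal T}$ and $\mathcal M\subseteq\mathcal T$ satisfy $$\eta_{\mathcal M}(\bar u_{\mathcal T},\bar w_{\mathcal T};f)\ge\vartheta\,\eta_\Omega(\bar u_{\mathcal T},\bar w_{\mathcal T};f),$$ then for $\tilde{\mathcal T}=\tilde{\mathcal T}(\mathcal T,\mathcal M,r)$ it holds that $$\eta_\Omega(\bar u_{\tilde{\mathcal T}},\bar w_{\tilde{\mathcal T}};f)\le\nu\,\eta_\Omega(\bar u_{\mathcal T},\bar w_{\mathcal T};f).$$ Here $\sigma_0$, $r$ and $\nu$ depend only on $n$, $\Omega$, ${\bf b}$, $c$, $m_u,m_w,m_f$, $\varrho$, the function $s$, $\vartheta$ and, if $n>1$, on the constants $\beta,\xi,C,r_0$ of the Conjecture; in particular they do not depend on $\mathcal T$, $f$ and $\mathcal M$, nor otherwise on $\mathbb T$. -/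

import Mathlib

open MeasureTheory Filter Topology
open scoped ContDiff

universe u

noncomputable section

/-- A rule for refining `n`-simplices in `ℝⁿ`.  Cells carry labels in `ι` (so the rule may use
vertex orderings, tags or the history of a cell), the label `i` names the simplex `simplex i`, and
the rule splits it into the at least two essentially disjoint simplices labelled by
`children i`. -/
structure RefinementRule (n : ℕ) (ι : Type u) where
  simplex : ι → Affine.Simplex ℝ (EuclideanSpace ℝ (Fin n)) n
  children : ι → Finset ι
  two_le_card_children : ∀ i, 2 ≤ (children i).card
  iUnion_children : ∀ i, (⋃ j ∈ children i, convexHull ℝ (Set.range (simplex j).points)) =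
    convexHull ℝ (Set.range (simplex i).points)
  disjoint_children : ∀ i, ∀ j ∈ children i, ∀ k ∈ children i, j ≠ k →
    Disjoint (interior (convexHull ℝ (Set.range (simplex j).points)))
      (interior (convexHull ℝ (Set.range (simplex k).points)))

/-- `diam K / sup {diam B : B a ball in K}`. -/
def shapeParameter {n : ℕ} (K : Set (EuclideanSpace ℝ (Fin n))) : ℝ :=
  Metric.diam K / sSup {d : ℝ | ∃ (x : EuclideanSpace ℝ (Fin n)) (ρ : ℝ), 0 < ρ ∧
    Metric.closedBall x ρ ⊆ K ∧ d = Metric.diam (Metric.closedBall x ρ)}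

namespace RefinementRule

variable {n : ℕ} {ι : Type u} (R : RefinementRule n ι)

/-- The closed simplex with label `i`. -/
def cell (i : ι) : Set (EuclideanSpace ℝ (Fin n)) :=
  convexHull ℝ (Set.range (R.simplex i).points)

/-- `T` is a partition of the closure of `Ω` into essentially disjoint closed simplices. -/
def IsPartition (Ω : Set (EuclideanSpace ℝ (Fin n))) (T : Finset ι) : Prop :=
  Ω = interior (⋃ K ∈ T, R.cell K) ∧
    ∀ K ∈ T, ∀ L ∈ T, K ≠ L → Disjoint (interior (R.cell K)) (interior (R.cell L))

open scoped Classical in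
/-- The family of all partitions that arise from `T₀` by repeatedly splitting individual cells. -/
inductive IsMesh (T₀ : Finset ι) : Finset ι → Prop
  | initial : IsMesh T₀ T₀
  | refine (T : Finset ι) (K : ι) (hT : IsMesh T₀ T) (hK : K ∈ T) :
      IsMesh T₀ (T.erase K ∪ R.children K)

open scoped Classical in
/-- The cells that arise from the cell `i` by `r` uniform refinements. -/
def descendants : ℕ → ι → Finset ι
  | 0, i => {i}
  | r + 1, i => (R.children i).biUnion (descendants r)

/-- All simplices of all partitions in the family have shape parameter at most `ϱ`. -/
def ShapeRegular (T₀ : Finset ι) (ϱ : ℝ) : Prop :=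
  ∀ T, R.IsMesh T₀ T → ∀ K ∈ T, shapeParameter (R.cell K) ≤ ϱ

/-- All simplices of all partitions in the family have diameter at most `σ`. -/
def MeshSizeLE (T₀ : Finset ι) (σ : ℝ) : Prop :=
  ∀ T, R.IsMesh T₀ T → ∀ K ∈ T, Metric.diam (R.cell K) ≤ σ

/-- `r` refinements of a cell reduce diameters at least by the factor `s r`. -/
def ShrinksBy (T₀ : Finset ι) (s : ℕ → ℝ) : Prop :=
  ∀ T, R.IsMesh T₀ T → ∀ K ∈ T, ∀ r, ∀ L ∈ R.descendants r K,
    Metric.diam (R.cell L) ≤ s r * Metric.diam (R.cell K)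

/-- The uniform refinements of a single cell are conforming (face-to-face): two simplices in
them meet in the convex hull of their common vertices. -/
def UniformlyConforming (T₀ : Finset ι) : Prop :=
  ∀ T, R.IsMesh T₀ T → ∀ K ∈ T, ∀ r, ∀ L ∈ R.descendants r K, ∀ L' ∈ R.descendants r K,
    R.cell L ∩ R.cell L' = convexHull ℝ
      (Set.range (R.simplex L).points ∩ Set.range (R.simplex L').points)

open scoped Classical in
/-- The cells of `T` to be refined when those in `M` are marked: the marked cells and, for `n > 1`,
also all cells that meet a ray in direction `b` emanating from a marked cell. -/
def cellsToRefine (b : EuclideanSpace ℝ (Fin n)) (T M : Finset ι) : Finset ι :=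
  T.filter fun K => K ∈ M ∨
    (1 < n ∧ ∃ L ∈ M, ∃ t : ℝ, 0 ≤ t ∧ ∃ x ∈ R.cell L, x + t • b ∈ R.cell K)

open scoped Classical in
/-- The refinement of `T` obtained by `r` refinements of each cell in `cellsToRefine`. -/
def refinement (b : EuclideanSpace ℝ (Fin n)) (T M : Finset ι) (r : ℕ) : Finset ι :=
  T.biUnion fun K => if K ∈ R.cellsToRefine b T M then R.descendants r K else {K}

/-- Membership in `∏_{K ∈ T} 𝒫_m(K)`; values on the (null) cell boundaries are irrelevant. -/
def PiecewisePolynomial (T : Finset ι) (m : ℕ) (v : EuclideanSpace ℝ (Fin n) → ℝ) : Prop :=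
  ∀ K ∈ T, ∃ p : MvPolynomial (Fin n) ℝ, p.totalDegree ≤ m ∧
    ∀ x ∈ interior (R.cell K), v x = MvPolynomial.eval (fun i => x i) p

end RefinementRule

section Transport

variable {n : ℕ} (Ω : Set (EuclideanSpace ℝ (Fin n))) (b : EuclideanSpace ℝ (Fin n))

/-- `ν` is the outward unit normal of the polytopal set `Ω` at its boundary point `x`. -/
def IsOutwardNormal (x ν : EuclideanSpace ℝ (Fin n)) : Prop :=
  ‖ν‖ = 1 ∧ ∃ δ > 0, ∀ y ∈ Metric.ball x δ, (y ∈ Ω ↔ inner ℝ (y - x) ν < 0)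

/-- The inflow boundary `Γ₋`. -/
def inflowBoundary : Set (EuclideanSpace ℝ (Fin n)) :=
  closure {x | x ∈ frontier Ω ∧ ∃ ν, IsOutwardNormal Ω x ν ∧ inner ℝ ν b < 0}

/-- `w ∈ H(b;Ω)` with weak directional derivative `b · ∇w = d`. -/
def HasWeakDirDeriv (w d : EuclideanSpace ℝ (Fin n) → ℝ) : Prop :=
  MemLp w 2 (volume.restrict Ω) ∧ MemLp d 2 (volume.restrict Ω) ∧
    ∀ φ : EuclideanSpace ℝ (Fin n) → ℝ, ContDiff ℝ ∞ φ → HasCompactSupport φ →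
      tsupport φ ⊆ Ω → ∫ x in Ω, w x * fderiv ℝ φ x b = - ∫ x in Ω, d x * φ x

open scoped Classical in
/-- The weak derivative `∂_b w = b · ∇w` of `w ∈ H(b;Ω)` (unique almost everywhere on `Ω`). -/
def weakDirDeriv (w : EuclideanSpace ℝ (Fin n) → ℝ) : EuclideanSpace ℝ (Fin n) → ℝ :=
  if h : ∃ d, HasWeakDirDeriv Ω b w d then h.choose else 0

/-- `H_{0,Γ₋}(b;Ω)`, the closure in `H(b;Ω)` of the smooth functions vanishing on `Γ₋`. -/
def MemHZeroInflow (w : EuclideanSpace ℝ (Fin n) → ℝ) : Prop :=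
  ∃ d, HasWeakDirDeriv Ω b w d ∧ ∀ ε > 0, ∃ φ : EuclideanSpace ℝ (Fin n) → ℝ,
    ContDiff ℝ ∞ φ ∧ (∀ x ∈ inflowBoundary Ω b, φ x = 0) ∧
    (∫ x in Ω, (w x - φ x) ^ 2) + (∫ x in Ω, (d x - fderiv ℝ φ x b) ^ 2) < ε

variable (c : EuclideanSpace ℝ (Fin n) → ℝ)

/-- The residual `g = ∂_b w + c u - f`. -/
def transportResidual (u w f : EuclideanSpace ℝ (Fin n) → ℝ) : EuclideanSpace ℝ (Fin n) → ℝ :=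
  fun x => weakDirDeriv Ω b w x + c x * u x - f x

/-- `η²_S(u,w;f) = ‖u - w‖²_{L₂(S)} + ‖∂_b w + c u - f‖²_{L₂(S)}` for `S ⊆ closure Ω`. -/
def etaSq (u w f : EuclideanSpace ℝ (Fin n) → ℝ) (S : Set (EuclideanSpace ℝ (Fin n))) : ℝ :=
  (∫ x in S, (u x - w x) ^ 2) + ∫ x in S, (transportResidual Ω b c u w f x) ^ 2

/-- The average of `g` over the intersection of `K` with the line through `x` in direction `b`. -/
def lineAverage (K : Set (EuclideanSpace ℝ (Fin n))) (g : EuclideanSpace ℝ (Fin n) → ℝ)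
    (x : EuclideanSpace ℝ (Fin n)) : ℝ :=
  ⨍ t in {t : ℝ | x + t • b ∈ K}, g (x + t • b)

end Transport

namespace RefinementRule

variable {n : ℕ} {ι : Type u} (R : RefinementRule n ι)
  (Ω : Set (EuclideanSpace ℝ (Fin n))) (b : EuclideanSpace ℝ (Fin n))
  (c : EuclideanSpace ℝ (Fin n) → ℝ)

/-- The trial space `∏ 𝒫_{mu}(K) × (H_{0,Γ₋}(b;Ω) ∩ ∏ 𝒫_{mw}(K))`. -/
def MemTrial (mu mw : ℕ) (T : Finset ι) (u w : EuclideanSpace ℝ (Fin n) → ℝ) : Prop :=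
  R.PiecewisePolynomial T mu u ∧ R.PiecewisePolynomial T mw w ∧ MemHZeroInflow Ω b w

/-- `(u, w)` minimizes `η²_Ω(·,·;f)` over the trial space. -/
def IsLeastSquaresSol (mu mw : ℕ) (T : Finset ι) (f u w : EuclideanSpace ℝ (Fin n) → ℝ) : Prop :=
  R.MemTrial Ω b mu mw T u w ∧ ∀ u' w', R.MemTrial Ω b mu mw T u' w' →
    etaSq Ω b c u w f Ω ≤ etaSq Ω b c u' w' f Ω

/-- `η_M(u,w;f)` for a collection `M` of cells. -/
def etaCells (M : Finset ι) (u w f : EuclideanSpace ℝ (Fin n) → ℝ) : ℝ :=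
  √(∑ K ∈ M, etaSq Ω b c u w f (R.cell K))

open scoped Classical in
/-- The cells `K ∈ M` with `‖e + c g‖²_{L₂(K)} < β (‖g‖²_{L₂(K)} + ‖e‖²_{L₂(K)})`, where
`e = u - w` and `g = ∂_b w + c u - f`. -/
def typeTwo (β : ℝ) (M : Finset ι) (u w f : EuclideanSpace ℝ (Fin n) → ℝ) : Finset ι :=
  M.filter fun K =>
    ∫ x in R.cell K, ((u x - w x) + c x * transportResidual Ω b c u w f x) ^ 2 <
      β * etaSq Ω b c u w f (R.cell K)

open scoped Classical in
/-- The function `F` that on each cell `K ∈ M` of the second type is the streamline average over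
`K` of the residual `g`, and that vanishes elsewhere. -/
def averagedResidual (β : ℝ) (M : Finset ι) (u w f : EuclideanSpace ℝ (Fin n) → ℝ) :
    EuclideanSpace ℝ (Fin n) → ℝ :=
  fun x => ∑ K ∈ R.typeTwo Ω b c β M u w f, (interior (R.cell K)).indicator
    (lineAverage b (R.cell K) (transportResidual Ω b c u w f)) x

open scoped Classical in
/-- The conjecture, with constants `β`, `ξ`, `C` and refinement depth `r₀`, for the family of
partitions generated from `T₀`.  Whenever `M` satisfies the bulk criterion with parameter `ϑ` for
the least squares solution and its cells of the second type dominate, there is a `w̃` in the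
second component of the trial space on the refined partition that vanishes outside the refined
cells and satisfies `‖∂_b w̃ + c w̃ - F‖ ≤ ξ ‖F‖` and `‖w̃‖ ≤ C ‖F‖` in `L₂(Ω)`. -/
def StreamlineConjecture (mu mw mf : ℕ) (T₀ : Finset ι) (ϑ β ξ C : ℝ) (r₀ : ℕ) : Prop :=
  ∀ T, R.IsMesh T₀ T → ∀ f, R.PiecewisePolynomial T mf f →
  ∀ u w, R.IsLeastSquaresSol Ω b c mu mw T f u w →
  ∀ M ⊆ T, ϑ * √(etaSq Ω b c u w f Ω) ≤ R.etaCells Ω b c M u w f →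
    R.etaCells Ω b c (M \ R.typeTwo Ω b c β M u w f) u w f ≤
      R.etaCells Ω b c (R.typeTwo Ω b c β M u w f) u w f →
    ∃ v, R.MemTrial Ω b mu mw (R.refinement b T M r₀) 0 v ∧
      (∀ K ∈ T, K ∉ R.cellsToRefine b T M → ∀ x ∈ interior (R.cell K), v x = 0) ∧
      √(∫ x in Ω, (weakDirDeriv Ω b v x + c x * v x -
          R.averagedResidual Ω b c β M u w f x) ^ 2) ≤
        ξ * √(∫ x in Ω, (R.averagedResidual Ω b c β M u w f x) ^ 2) ∧
      √(∫ x in Ω, (v x) ^ 2) ≤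
        C * √(∫ x in Ω, (R.averagedResidual Ω b c β M u w f x) ^ 2)

end RefinementRule

end

/-! The functional `η²` is the squared distance between `(u - w, ∂_b w + c u)` and `(0, f)`, hence a
least squares functional for a linear map. Let `e = u - w`, `g = ∂_b w + c u - f` be the residual of
the coarse minimizer. If the refined trial space contains a direction `(v, z)` whose image `(v - z,
∂_b z + c v)` has norm at most `N` and inner product at least `κ ‖(e, g)‖ N` with the residual, then
minimizing along that line alone reduces `η` by the factor `√(1 - κ²)`. This is `HasDescent` and
`HasDescent.sqrt_etaSq_le`; the whole task is to find such a direction with `κ` uniform.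

On each cell `e` and `g` are polynomials of bounded degree, so after scaling all norms on a cell are
equivalent (`exists_ballNorm_bound`), and sufficiently many refinements approximate a desired test
function to any prescribed relative accuracy, even by piecewise constants or continuous piecewise
linears. Three directions occur.

(1) If the marked cells with `‖e + c g‖² ≥ β (‖e‖² + ‖g‖²)` dominate, take `z = 0` and let `v`
sample `e + c g` on these cells: the inner product is `∫ (e + c g) v`
(`exists_hasDescent_of_type_one`).

(2) Otherwise the cells of the second type dominate, and there `g` controls `e`
(`etaSq_le_of_mem_typeTwo`). If the scaled derivative `h ∂_b g` is not small on them, take `v = 0`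
and let `z` interpolate `-h² χ ∂_b g` with a cut-off `χ`. Integration by parts makes `∫ g ∂_b z`
large, while `∫ e z` carries an additional factor `h` and is negligible on fine meshes
(`exists_bubble`, `exists_hasDescent_of_bubble`). This is one source of `σ₀`.

(3) If `h ∂_b g` is small, `g` is close to its streamline average `F` (`exists_lineAverage_bound`).
For `n > 1` the conjecture supplies `z` with `∂_b z + c z ≈ F`. With `v` a sampling of `z`, the
image of `(v, z)` is close to `(0, F)`, and the bound on `ξ` is exactly what leaves a positive inner
product (`exists_hasDescent_of_transport`).

For `n = 1` case (3) cannot occur on fine meshes. Galerkin orthogonality against functions that rise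
linearly across one interval and stay constant downstream bounds the integral of `g` over that
interval by `e` and by the integrals of `g` further downstream; a discrete Gronwall argument makes
all cell means of `g` of order `h` (`exists_sum_sq_setIntegral_residual_le`). With small derivative
as well, `g` itself would be small, contradicting the dominance of the second type.
`exists_hasDescent` combines the cases. All constants are fixed before the refinement rule, the
mesh, `f` and the marked set are introduced. -/

noncomputable section

namespace RefinementRule

/-! ### Simplices, tilings and refinements -/

section Geometry

variable {n : ℕ} {ι : Type u} (R : RefinementRule n ι)

theorem convex_cell (i : ι) : Convex ℝ (R.cell i) := convex_convexHull ℝ _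

theorem isCompact_cell (i : ι) : IsCompact (R.cell i) :=
  (Set.finite_range _).isCompact_convexHull ℝ

theorem isClosed_cell (i : ι) : IsClosed (R.cell i) := (R.isCompact_cell i).isClosed

theorem measurableSet_cell (i : ι) : MeasurableSet (R.cell i) :=
  (R.isClosed_cell i).measurableSet

theorem isBounded_cell (i : ι) : Bornology.IsBounded (R.cell i) :=
  (R.isCompact_cell i).isBounded

theorem points_mem_cell (i : ι) (k : Fin (n + 1)) : (R.simplex i).points k ∈ R.cell i :=
  subset_convexHull ℝ _ (Set.mem_range_self k)

theorem affineSpan_points (i : ι) : affineSpan ℝ (Set.range (R.simplex i).points) = ⊤ := by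
  rw [(R.simplex i).independent.affineSpan_eq_top_iff_card_eq_finrank_add_one]
  simp

theorem interior_cell_nonempty (i : ι) : (interior (R.cell i)).Nonempty :=
  interior_convexHull_nonempty_iff_affineSpan_eq_top.2 (R.affineSpan_points i)

theorem volume_frontier_cell (i : ι) : volume (frontier (R.cell i)) = 0 :=
  (R.convex_cell i).addHaar_frontier volume

theorem interior_cell_ae_eq (i : ι) :
    (interior (R.cell i) : Set (EuclideanSpace ℝ (Fin n))) =ᵐ[volume] R.cell i :=
  interior_ae_eq_of_null_frontier (R.volume_frontier_cell i)

theorem restrict_cell (i : ι) :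
    (volume.restrict (R.cell i) : Measure (EuclideanSpace ℝ (Fin n))) =
      volume.restrict (interior (R.cell i)) :=
  Measure.restrict_congr_set (R.interior_cell_ae_eq i).symm

theorem ae_mem_interior_cell (i : ι) :
    ∀ᵐ x ∂(volume.restrict (R.cell i)), x ∈ interior (R.cell i) := by
  rw [R.restrict_cell]
  exact ae_restrict_mem isOpen_interior.measurableSet

theorem volume_cell_lt_top (i : ι) : volume (R.cell i) < ⊤ :=
  (R.isCompact_cell i).measure_lt_top

theorem diam_cell_pos (hn : 1 ≤ n) (i : ι) : 0 < Metric.diam (R.cell i) := by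
  have h01 : (R.simplex i).points 0 ≠ (R.simplex i).points (Fin.last n) := by
    intro h
    have := (R.simplex i).independent.injective h
    have h2 := congrArg Fin.val this
    simp at h2
    omega
  exact (dist_pos.2 h01).trans_le
    (Metric.dist_le_diam_of_mem (R.isBounded_cell i) (R.points_mem_cell i _)
      (R.points_mem_cell i _))

/-- Some inscribed ball has diameter above half the supremum, hence radius above a quarter of it.
The maximum with `1` keeps the radius meaningful for every real `ϱ`. -/
theorem exists_closedBall_subset_cell {ϱ : ℝ} (i : ι) (h : shapeParameter (R.cell i) ≤ ϱ) :
    ∃ x, Metric.closedBall x (Metric.diam (R.cell i) / (4 * max ϱ 1)) ⊆ R.cell i := by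
  set S : Set ℝ := {d : ℝ | ∃ (x : EuclideanSpace ℝ (Fin n)) (ρ : ℝ), 0 < ρ ∧
    Metric.closedBall x ρ ⊆ R.cell i ∧ d = Metric.diam (Metric.closedBall x ρ)} with hS
  have hmax : 0 < max ϱ 1 := lt_max_of_lt_right one_pos
  obtain ⟨x₀, hx₀⟩ := R.interior_cell_nonempty i
  obtain ⟨r, hr, hball⟩ := Metric.nhds_basis_closedBall.mem_iff.1 (mem_interior_iff_mem_nhds.1 hx₀)
  rcases (Metric.diam_nonneg (s := R.cell i)).eq_or_lt with h0 | h0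
  · refine ⟨x₀, ?_⟩
    rw [← h0, zero_div, Metric.closedBall_zero, Set.singleton_subset_iff]
    exact interior_subset hx₀
  have hbdd : BddAbove S := by
    refine ⟨Metric.diam (R.cell i), ?_⟩
    rintro d ⟨x, ρ, -, hsub, rfl⟩
    exact Metric.diam_mono hsub (R.isBounded_cell i)
  have hmem : Metric.diam (Metric.closedBall x₀ r) ∈ S := ⟨x₀, r, hr, hball, rfl⟩
  have hsup0 : 0 ≤ sSup S := (Metric.diam_nonneg).trans (le_csSup hbdd hmem)
  have hle : Metric.diam (R.cell i) ≤ max ϱ 1 * sSup S := by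
    -- If the supremum were `0`, division by zero would make the shape parameter `0` and the
    -- hypothesis void; a ball in the nonempty interior excludes this.
    rcases hsup0.eq_or_lt with h1 | h1
    · exfalso
      have hn : n ≠ 0 := by
        rintro rfl
        have : Subsingleton (EuclideanSpace ℝ (Fin 0)) := inferInstance
        have := Metric.diam_subsingleton (s := R.cell i) (Set.subsingleton_of_subsingleton)
        linarith
      have hn' : Nonempty (Fin n) := ⟨⟨0, Nat.pos_of_ne_zero hn⟩⟩
      have : (2 : ℝ) * r = Metric.diam (Metric.closedBall x₀ r) :=
        (Metric.diam_closedBall_eq _ hr.le).symm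
      have h3 := le_csSup hbdd hmem
      rw [← h1] at h3
      linarith
    · have h2 : Metric.diam (R.cell i) / sSup S ≤ max ϱ 1 := le_trans h (le_max_left _ _)
      rwa [div_le_iff₀ h1] at h2
  have hsup : 0 < sSup S := by
    by_contra hcon
    have : sSup S = 0 := le_antisymm (not_lt.1 hcon) hsup0
    rw [this, mul_zero] at hle
    linarith
  obtain ⟨d, ⟨x, ρ, hρ, hsub, rfl⟩, hd⟩ := exists_lt_of_lt_csSup ⟨_, hmem⟩ (half_lt_self hsup)
  refine ⟨x, (Metric.closedBall_subset_closedBall ?_).trans hsub⟩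
  have h2 : Metric.diam (Metric.closedBall x ρ) ≤ 2 * ρ := Metric.diam_closedBall hρ.le
  rw [div_le_iff₀ (by positivity)]
  nlinarith

/-- The cells with labels in `T` have disjoint interiors and cover exactly `A`. -/
def Tiles (T : Finset ι) (A : Set (EuclideanSpace ℝ (Fin n))) : Prop :=
  (⋃ K ∈ T, R.cell K) = A ∧
    ∀ K ∈ T, ∀ L ∈ T, K ≠ L → Disjoint (interior (R.cell K)) (interior (R.cell L))

variable {R} {T : Finset ι} {A : Set (EuclideanSpace ℝ (Fin n))}

theorem Tiles.cell_subset (h : R.Tiles T A) {K : ι} (hK : K ∈ T) : R.cell K ⊆ A := by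
  rw [← h.1]; exact Set.subset_biUnion_of_mem (u := fun K => R.cell K) hK

theorem Tiles.interior_cell_subset (h : R.Tiles T A) {K : ι} (hK : K ∈ T) :
    interior (R.cell K) ⊆ interior A :=
  interior_mono (h.cell_subset hK)

theorem Tiles.eq_of_mem (h : R.Tiles T A) {K L : ι} (hK : K ∈ T) (hL : L ∈ T)
    {x : EuclideanSpace ℝ (Fin n)} (hx : x ∈ interior (R.cell K)) (hx' : x ∈ interior (R.cell L)) :
    K = L := by
  by_contra hne
  exact Set.disjoint_left.1 (h.2 K hK L hL hne) hx hx'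

theorem Tiles.isCompact (h : R.Tiles T A) : IsCompact A := by
  rw [← h.1]
  exact T.finite_toSet.isCompact_biUnion fun K _ => R.isCompact_cell K

open scoped Classical in
theorem Tiles.biUnion (h : R.Tiles T A) {D : ι → Finset ι}
    (hD : ∀ K ∈ T, R.Tiles (D K) (R.cell K)) : R.Tiles (T.biUnion D) A := by
  constructor
  · rw [← h.1, Finset.set_biUnion_biUnion]
    exact Set.iUnion₂_congr fun K hK => (hD K hK).1
  · intro L hL L' hL' hne
    obtain ⟨K, hK, hLK⟩ := Finset.mem_biUnion.1 hL
    obtain ⟨K', hK', hLK'⟩ := Finset.mem_biUnion.1 hL'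
    by_cases hKK : K = K'
    · subst hKK
      exact (hD K hK).2 L hLK L' hLK' hne
    · exact (h.2 K hK K' hK' hKK).mono ((hD K hK).interior_cell_subset hLK)
        ((hD K' hK').interior_cell_subset hLK')

theorem tiles_singleton (K : ι) : R.Tiles {K} (R.cell K) := by
  refine ⟨by simp, ?_⟩
  intro K hK L hL hne
  simp only [Finset.mem_singleton] at hK hL
  exact absurd (hK.trans hL.symm) hne

theorem tiles_children (K : ι) : R.Tiles (R.children K) (R.cell K) :=
  ⟨R.iUnion_children K, R.disjoint_children K⟩

theorem tiles_descendants (r : ℕ) (K : ι) : R.Tiles (R.descendants r K) (R.cell K) := by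
  induction r generalizing K with
  | zero => exact tiles_singleton K
  | succ r ih => exact (tiles_children K).biUnion fun L _ => ih L

open scoped Classical in
theorem descendants_add (a k : ℕ) (K : ι) :
    R.descendants (a + k) K = (R.descendants a K).biUnion (R.descendants k) := by
  induction a generalizing K with
  | zero => simp [descendants]
  | succ a ih =>
    rw [Nat.succ_add]
    simp only [descendants]
    rw [Finset.biUnion_biUnion]
    exact Finset.biUnion_congr rfl fun L _ => ih L

theorem Tiles.refinement (h : R.Tiles T A) (b : EuclideanSpace ℝ (Fin n)) (M : Finset ι) (r : ℕ) :
    R.Tiles (R.refinement b T M r) A := by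
  classical
  refine h.biUnion fun K _ => ?_
  split_ifs
  · exact tiles_descendants r K
  · exact tiles_singleton K

theorem mem_refinement {b : EuclideanSpace ℝ (Fin n)} {M : Finset ι} {r : ℕ} {L : ι} :
    L ∈ R.refinement b T M r ↔ ∃ K ∈ T, (K ∈ R.cellsToRefine b T M ∧ L ∈ R.descendants r K) ∨
      (K ∉ R.cellsToRefine b T M ∧ L = K) := by
  classical
  rw [RefinementRule.refinement, Finset.mem_biUnion]
  refine exists_congr fun K => and_congr_right fun _ => ?_
  split_ifs with hK <;> simp [hK]

theorem Tiles.isMesh {T₀ : Finset ι} (h : R.Tiles T₀ A) (hT : R.IsMesh T₀ T) : R.Tiles T A := by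
  classical
  induction hT with
  | initial => exact h
  | refine T K _ hK ih =>
    -- Splitting one cell is written as a union over all cells in which every other cell is replaced
    -- by itself, so that `Tiles.biUnion` applies.
    have heq : T.erase K ∪ R.children K =
        T.biUnion fun L => if L = K then R.children K else {L} := by
      ext L
      simp only [Finset.mem_union, Finset.mem_erase, Finset.mem_biUnion]
      constructor
      · rintro (⟨hne, hL⟩ | hL)
        · exact ⟨L, hL, by simp [hne]⟩
        · exact ⟨K, hK, by simpa using hL⟩
      · rintro ⟨L', hL', hmem⟩
        split_ifs at hmem with hLK
        · exact Or.inr hmem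
        · rw [Finset.mem_singleton] at hmem
          subst hmem
          exact Or.inl ⟨hLK, hL'⟩
    rw [heq]
    refine ih.biUnion fun L _ => ?_
    split_ifs with hLK
    · rw [hLK]; exact tiles_children K
    · exact tiles_singleton L

theorem exists_isMesh_of_mem_descendants {T₀ : Finset ι} (r : ℕ) {K L : ι}
    (hK : ∃ T, R.IsMesh T₀ T ∧ K ∈ T) (hL : L ∈ R.descendants r K) :
    ∃ T, R.IsMesh T₀ T ∧ L ∈ T := by
  classical
  induction r generalizing K with
  | zero => rw [descendants, Finset.mem_singleton] at hL; exact hL ▸ hK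
  | succ r ih =>
    rw [descendants, Finset.mem_biUnion] at hL
    obtain ⟨K', hK', hL⟩ := hL
    obtain ⟨T, hT, hKT⟩ := hK
    exact ih ⟨_, hT.refine T K hKT, Finset.mem_union_right _ hK'⟩ hL

theorem exists_mem_of_isMesh {T₀ : Finset ι} (hT : R.IsMesh T₀ T) {K : ι} (hK : K ∈ T) :
    ∃ K₀ ∈ T₀, R.cell K ⊆ R.cell K₀ := by
  classical
  induction hT generalizing K with
  | initial => exact ⟨K, hK, subset_rfl⟩
  | refine T L _ hL ih =>
    rcases Finset.mem_union.1 hK with h | h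
    · exact ih (Finset.mem_of_mem_erase h)
    · obtain ⟨K₀, hK₀, hsub⟩ := ih hL
      exact ⟨K₀, hK₀, ((tiles_children L).cell_subset h).trans hsub⟩

theorem IsPartition.tiles {Ω : Set (EuclideanSpace ℝ (Fin n))} (h : R.IsPartition Ω T) :
    R.Tiles T (⋃ K ∈ T, R.cell K) := ⟨rfl, h.2⟩

/-- The closed set `A` is the same for all refinements. Later results are therefore phrased for
`interior A`, and `Ω` returns only at the very end. -/
theorem IsPartition.exists_tiles {Ω : Set (EuclideanSpace ℝ (Fin n))} (h : R.IsPartition Ω T) :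
    ∃ A, Ω = interior A ∧ R.Tiles T A := ⟨_, h.1, h.tiles⟩

theorem Tiles.ae_eq (h : R.Tiles T A) :
    ((⋃ K ∈ T, interior (R.cell K)) : Set (EuclideanSpace ℝ (Fin n))) =ᵐ[volume] A := by
  have h1 : ((⋃ K ∈ T, interior (R.cell K)) : Set (EuclideanSpace ℝ (Fin n))) =ᵐ[volume]
      (⋃ K ∈ T, R.cell K : Set (EuclideanSpace ℝ (Fin n))) :=
    Filter.EventuallyEq.countable_bUnion T.countable_toSet fun K _ => R.interior_cell_ae_eq K
  rwa [h.1] at h1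

theorem Tiles.interior_ae_eq (h : R.Tiles T A) :
    ((⋃ K ∈ T, interior (R.cell K)) : Set (EuclideanSpace ℝ (Fin n))) =ᵐ[volume] interior A := by
  refine Filter.EventuallyLE.antisymm (LE.le.eventuallyLE ?_)
    ((LE.le.eventuallyLE interior_subset).trans h.ae_eq.symm.le)
  exact Set.iUnion₂_subset fun K hK => h.interior_cell_subset hK

theorem Tiles.ae_exists (h : R.Tiles T A) :
    ∀ᵐ x ∂(volume.restrict (interior A)), ∃ K ∈ T, x ∈ interior (R.cell K) := by
  rw [← Measure.restrict_congr_set h.interior_ae_eq]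
  have hm : MeasurableSet (⋃ K ∈ T, interior (R.cell K)) :=
    (isOpen_biUnion fun K _ => isOpen_interior).measurableSet
  filter_upwards [ae_restrict_mem hm] with x hx
  simpa using hx

theorem Tiles.restrict_cell_le (h : R.Tiles T A) {K : ι} (hK : K ∈ T) :
    volume.restrict (R.cell K) ≤ volume.restrict (interior A) := by
  rw [R.restrict_cell]
  exact Measure.restrict_mono_set _ (h.interior_cell_subset hK)

theorem Tiles.setIntegral (h : R.Tiles T A) {f : EuclideanSpace ℝ (Fin n) → ℝ}
    (hf : IntegrableOn f (interior A)) :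
    ∫ x in interior A, f x = ∑ K ∈ T, ∫ x in R.cell K, f x := by
  rw [← setIntegral_congr_set h.interior_ae_eq, integral_biUnion_finset]
  · exact Finset.sum_congr rfl fun K _ => by rw [R.restrict_cell]
  · exact fun K _ => isOpen_interior.measurableSet
  · exact fun K hK L hL hne => h.2 K hK L hL hne
  · exact fun K hK => hf.mono_set (h.interior_cell_subset hK)

end Geometry

end RefinementRule


/-! ### Weak directional derivatives and the inflow condition -/

section WeakDerivative

variable {n : ℕ} {Ω : Set (EuclideanSpace ℝ (Fin n))} {b : EuclideanSpace ℝ (Fin n)}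

theorem memLp_restrict_of_continuous (hΩ : Bornology.IsBounded Ω) (p : ENNReal)
    {φ : EuclideanSpace ℝ (Fin n) → ℝ} (hφ : Continuous φ) :
    MemLp φ p (volume.restrict Ω) := by
  have hc : IsCompact (closure Ω) := hΩ.isCompact_closure
  have : IsFiniteMeasure (volume.restrict (closure Ω)) :=
    ⟨by simpa using hc.measure_lt_top⟩
  obtain ⟨C, hC⟩ := hc.exists_bound_of_continuousOn hφ.continuousOn
  have h : MemLp φ p (volume.restrict (closure Ω)) := by
    refine MemLp.of_bound hφ.aestronglyMeasurable C ?_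
    filter_upwards [ae_restrict_mem isClosed_closure.measurableSet] with x hx using hC x hx
  exact h.mono_measure (Measure.restrict_mono_set _ subset_closure)

theorem memLp_fderiv_apply (p : ENNReal) (hΩ : Bornology.IsBounded Ω)
    {φ : EuclideanSpace ℝ (Fin n) → ℝ} (hφ : ContDiff ℝ ∞ φ) :
    MemLp (fun x => fderiv ℝ φ x b) p (volume.restrict Ω) :=
  memLp_restrict_of_continuous hΩ p
    ((hφ.continuous_fderiv (by simp)).clm_apply continuous_const)

theorem HasWeakDirDeriv.add (hΩ : Bornology.IsBounded Ω)
    {w d w' d' : EuclideanSpace ℝ (Fin n) → ℝ} (h : HasWeakDirDeriv Ω b w d)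
    (h' : HasWeakDirDeriv Ω b w' d') :
    HasWeakDirDeriv Ω b (fun x => w x + w' x) (fun x => d x + d' x) := by
  refine ⟨h.1.add h'.1, h.2.1.add h'.2.1, fun φ hφ hc hs => ?_⟩
  have hφ2 := memLp_restrict_of_continuous hΩ 2 hφ.continuous
  have hd2 := memLp_fderiv_apply (b := b) 2 hΩ hφ
  simp only [add_mul]
  have i1 : IntegrableOn (fun x => w x * fderiv ℝ φ x b) Ω := h.1.integrable_mul hd2
  have i2 : IntegrableOn (fun x => w' x * fderiv ℝ φ x b) Ω := h'.1.integrable_mul hd2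
  have i3 : IntegrableOn (fun x => d x * φ x) Ω := h.2.1.integrable_mul hφ2
  have i4 : IntegrableOn (fun x => d' x * φ x) Ω := h'.2.1.integrable_mul hφ2
  rw [integral_add i1 i2, integral_add i3 i4, h.2.2 φ hφ hc hs, h'.2.2 φ hφ hc hs, neg_add]

theorem HasWeakDirDeriv.const_mul (t : ℝ) {w d : EuclideanSpace ℝ (Fin n) → ℝ}
    (h : HasWeakDirDeriv Ω b w d) :
    HasWeakDirDeriv Ω b (fun x => t * w x) (fun x => t * d x) := by
  refine ⟨h.1.const_mul t, h.2.1.const_mul t, fun φ hφ hc hs => ?_⟩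
  simp only [mul_assoc]
  rw [integral_const_mul, integral_const_mul, h.2.2 φ hφ hc hs, mul_neg]

/-- Test functions supported in `U` are test functions on `Ω`, and both integrals agree with those
over the whole space. No measurability is needed. -/
theorem HasWeakDirDeriv.mono {U : Set (EuclideanSpace ℝ (Fin n))} (hU : U ⊆ Ω)
    {w d : EuclideanSpace ℝ (Fin n) → ℝ} (h : HasWeakDirDeriv Ω b w d) :
    HasWeakDirDeriv U b w d := by
  have hle := Measure.restrict_mono_set (volume : Measure (EuclideanSpace ℝ (Fin n))) hU
  refine ⟨h.1.mono_measure hle, h.2.1.mono_measure hle, fun φ hφ hc hs => ?_⟩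
  have h0 : ∀ x, x ∉ tsupport φ → φ x = 0 := fun x hx => image_eq_zero_of_notMem_tsupport hx
  have h1 : ∀ x, x ∉ tsupport φ → fderiv ℝ φ x b = 0 := fun x hx => by
    rw [image_eq_zero_of_notMem_tsupport fun hx' => hx (tsupport_fderiv_subset ℝ hx')]; simp
  have := h.2.2 φ hφ hc (hs.trans hU)
  rw [setIntegral_eq_integral_of_forall_compl_eq_zero fun x hx => by
      rw [h1 x fun hx' => hx (hU (hs hx')), mul_zero],
    setIntegral_eq_integral_of_forall_compl_eq_zero fun x hx => by
      rw [h0 x fun hx' => hx (hU (hs hx')), mul_zero]] at this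
  rw [setIntegral_eq_integral_of_forall_compl_eq_zero fun x hx => by
      rw [h1 x fun hx' => hx (hs hx'), mul_zero],
    setIntegral_eq_integral_of_forall_compl_eq_zero fun x hx => by
      rw [h0 x fun hx' => hx (hs hx'), mul_zero]]
  exact this

theorem HasWeakDirDeriv.congr {w w' d d' : EuclideanSpace ℝ (Fin n) → ℝ}
    (h : HasWeakDirDeriv Ω b w d) (hw : w =ᵐ[volume.restrict Ω] w')
    (hd : d =ᵐ[volume.restrict Ω] d') : HasWeakDirDeriv Ω b w' d' := by
  refine ⟨h.1.ae_eq hw, h.2.1.ae_eq hd, fun φ hφ hc hs => ?_⟩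
  have e1 : ∫ x in Ω, w x * fderiv ℝ φ x b = ∫ x in Ω, w' x * fderiv ℝ φ x b :=
    integral_congr_ae (hw.mono fun x hx => by simp only [hx])
  have e2 : ∫ x in Ω, d x * φ x = ∫ x in Ω, d' x * φ x :=
    integral_congr_ae (hd.mono fun x hx => by simp only [hx])
  rw [← e1, ← e2, h.2.2 φ hφ hc hs]

/-- Makes the choice inside `weakDirDeriv` harmless: it may be replaced almost everywhere by
whatever derivative is at hand. -/
theorem HasWeakDirDeriv.ae_unique (hΩ : Bornology.IsBounded Ω) (ho : IsOpen Ω)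
    {w d d' : EuclideanSpace ℝ (Fin n) → ℝ} (h : HasWeakDirDeriv Ω b w d)
    (h' : HasWeakDirDeriv Ω b w d') : d =ᵐ[volume.restrict Ω] d' := by
  have hfin : IsFiniteMeasure (volume.restrict Ω) :=
    ⟨by simpa using hΩ.measure_lt_top⟩
  have hint : IntegrableOn (fun x => d x - d' x) Ω :=
    (h.2.1.sub h'.2.1).integrable (by norm_num)
  have key := ho.ae_eq_zero_of_integral_contDiff_smul_eq_zero (μ := volume)
    hint.locallyIntegrableOn (fun φ hφ hc hs => by
      have hφ2 := memLp_restrict_of_continuous hΩ 2 hφ.continuous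
      have i3 : IntegrableOn (fun x => d x * φ x) Ω := h.2.1.integrable_mul hφ2
      have i4 : IntegrableOn (fun x => d' x * φ x) Ω := h'.2.1.integrable_mul hφ2
      rw [← setIntegral_eq_integral_of_forall_compl_eq_zero (s := Ω) fun x hx => by
        rw [image_eq_zero_of_notMem_tsupport fun hx' => hx (hs hx'), zero_smul]]
      have : ∀ x, φ x • (d x - d' x) = d x * φ x - d' x * φ x := fun x => by
        rw [smul_eq_mul]; ring
      simp only [this]
      rw [integral_sub i3 i4]
      have e1 := h.2.2 φ hφ hc hs
      have e2 := h'.2.2 φ hφ hc hs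
      linarith)
  rw [Filter.EventuallyEq, ae_restrict_iff' ho.measurableSet]
  filter_upwards [key] with x hx hxΩ
  linarith [hx hxΩ]

theorem HasWeakDirDeriv.weakDirDeriv {w d : EuclideanSpace ℝ (Fin n) → ℝ}
    (h : HasWeakDirDeriv Ω b w d) : HasWeakDirDeriv Ω b w (weakDirDeriv Ω b w) := by
  have hex : ∃ d, HasWeakDirDeriv Ω b w d := ⟨d, h⟩
  rw [_root_.weakDirDeriv, dif_pos hex]
  exact hex.choose_spec

theorem HasWeakDirDeriv.weakDirDeriv_ae_eq (hΩ : Bornology.IsBounded Ω) (ho : IsOpen Ω)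
    {w d : EuclideanSpace ℝ (Fin n) → ℝ} (h : HasWeakDirDeriv Ω b w d) :
    _root_.weakDirDeriv Ω b w =ᵐ[volume.restrict Ω] d :=
  h.weakDirDeriv.ae_unique hΩ ho h

variable (Ω b) in
/-- The pair `(w, d)` is a limit in `L₂(Ω)²` of pairs `(φ, b · ∇φ)` with smooth `φ` that vanish on
the inflow boundary. -/
def IsInflowLimit (w d : EuclideanSpace ℝ (Fin n) → ℝ) : Prop :=
  ∀ ε > 0, ∃ φ : EuclideanSpace ℝ (Fin n) → ℝ,
    ContDiff ℝ ∞ φ ∧ (∀ x ∈ inflowBoundary Ω b, φ x = 0) ∧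
    (∫ x in Ω, (w x - φ x) ^ 2) + (∫ x in Ω, (d x - fderiv ℝ φ x b) ^ 2) < ε

theorem integral_sq_add_le {α : Type*} [MeasurableSpace α] {μ : Measure α} {f g : α → ℝ}
    (hf : MemLp f 2 μ) (hg : MemLp g 2 μ) :
    ∫ x, (f x + g x) ^ 2 ∂μ ≤ 2 * ∫ x, f x ^ 2 ∂μ + 2 * ∫ x, g x ^ 2 ∂μ := by
  rw [← integral_const_mul, ← integral_const_mul,
    ← integral_add (hf.integrable_sq.const_mul 2) (hg.integrable_sq.const_mul 2)]
  refine integral_mono (hf.add hg).integrable_sq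
    ((hf.integrable_sq.const_mul 2).add (hg.integrable_sq.const_mul 2)) fun x => ?_
  simp only
  nlinarith [sq_nonneg (f x - g x)]

/-- Closedness of the set of limits. It permits a two-stage approximation: truncation near the
inflow boundary, then mollification. -/
theorem IsInflowLimit.of_approx (hΩ : Bornology.IsBounded Ω)
    {w d : EuclideanSpace ℝ (Fin n) → ℝ} (hw : MemLp w 2 (volume.restrict Ω))
    (hd : MemLp d 2 (volume.restrict Ω))
    (h : ∀ ε > 0, ∃ w' d' : EuclideanSpace ℝ (Fin n) → ℝ, MemLp w' 2 (volume.restrict Ω) ∧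
      MemLp d' 2 (volume.restrict Ω) ∧ IsInflowLimit Ω b w' d' ∧
      (∫ x in Ω, (w x - w' x) ^ 2) + (∫ x in Ω, (d x - d' x) ^ 2) < ε) :
    IsInflowLimit Ω b w d := by
  intro ε hε
  obtain ⟨w', d', hw', hd', hlim, hlt⟩ := h (ε / 4) (by positivity)
  obtain ⟨φ, hφ, hφ0, hφlt⟩ := hlim (ε / 4) (by positivity)
  refine ⟨φ, hφ, hφ0, ?_⟩
  have h1 := integral_sq_add_le (hw.sub hw')
    (hw'.sub (memLp_restrict_of_continuous hΩ 2 hφ.continuous))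
  have h2 := integral_sq_add_le (hd.sub hd') (hd'.sub (memLp_fderiv_apply (b := b) 2 hΩ hφ))
  simp only [Pi.sub_apply, sub_add_sub_cancel] at h1 h2
  linarith

theorem IsInflowLimit.add (hΩ : Bornology.IsBounded Ω)
    {w d w' d' : EuclideanSpace ℝ (Fin n) → ℝ} (hw : HasWeakDirDeriv Ω b w d)
    (hw' : HasWeakDirDeriv Ω b w' d') (h : IsInflowLimit Ω b w d) (h' : IsInflowLimit Ω b w' d') :
    IsInflowLimit Ω b (fun x => w x + w' x) (fun x => d x + d' x) := by
  intro ε hε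
  obtain ⟨φ, hφ, hφ0, hφlt⟩ := h (ε / 4) (by positivity)
  obtain ⟨φ', hφ', hφ0', hφlt'⟩ := h' (ε / 4) (by positivity)
  refine ⟨fun x => φ x + φ' x, hφ.add hφ', fun x hx => by simp only [hφ0 x hx, hφ0' x hx, add_zero], ?_⟩
  have h1 := integral_sq_add_le
    (hw.1.sub (memLp_restrict_of_continuous hΩ 2 hφ.continuous))
    (hw'.1.sub (memLp_restrict_of_continuous hΩ 2 hφ'.continuous))
  have h2 := integral_sq_add_le (hw.2.1.sub (memLp_fderiv_apply (b := b) 2 hΩ hφ))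
    (hw'.2.1.sub (memLp_fderiv_apply (b := b) 2 hΩ hφ'))
  have e1 : ∀ x, fderiv ℝ (fun x => φ x + φ' x) x b = fderiv ℝ φ x b + fderiv ℝ φ' x b := by
    intro x
    rw [fderiv_fun_add (hφ.differentiable (by simp) x) (hφ'.differentiable (by simp) x)]
    rfl
  simp only [Pi.sub_apply, sub_add_sub_comm] at h1 h2
  simp only [e1]
  linarith

theorem IsInflowLimit.const_mul (t : ℝ) {w d : EuclideanSpace ℝ (Fin n) → ℝ}
    (h : IsInflowLimit Ω b w d) : IsInflowLimit Ω b (fun x => t * w x) (fun x => t * d x) := by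
  intro ε hε
  obtain ⟨φ, hφ, hφ0, hφlt⟩ := h (ε / (t ^ 2 + 1)) (by positivity)
  refine ⟨fun x => t * φ x, contDiff_const.mul hφ, fun x hx => by simp only [hφ0 x hx, mul_zero], ?_⟩
  have e1 : ∀ x, fderiv ℝ (fun x => t * φ x) x b = t * fderiv ℝ φ x b := by
    intro x
    rw [fderiv_const_mul (hφ.differentiable (by simp) x)]
    rfl
  simp only [e1, ← mul_sub, mul_pow]
  rw [integral_const_mul, integral_const_mul, ← mul_add]
  rw [lt_div_iff₀ (by positivity)] at hφlt
  have h0 : 0 ≤ (∫ x in Ω, (w x - φ x) ^ 2) + (∫ x in Ω, (d x - fderiv ℝ φ x b) ^ 2) :=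
    add_nonneg (integral_nonneg fun x => sq_nonneg _) (integral_nonneg fun x => sq_nonneg _)
  nlinarith

theorem MemHZeroInflow.hasWeakDirDeriv {w : EuclideanSpace ℝ (Fin n) → ℝ}
    (h : MemHZeroInflow Ω b w) : HasWeakDirDeriv Ω b w (weakDirDeriv Ω b w) := by
  obtain ⟨d, hd, -⟩ := h
  exact hd.weakDirDeriv

theorem MemHZeroInflow.add_const_mul (hΩ : Bornology.IsBounded Ω) (t : ℝ)
    {w z : EuclideanSpace ℝ (Fin n) → ℝ} (h : MemHZeroInflow Ω b w) (h' : MemHZeroInflow Ω b z) :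
    MemHZeroInflow Ω b (fun x => w x + t * z x) := by
  obtain ⟨d, hd, hl⟩ := h
  obtain ⟨d', hd', hl'⟩ := h'
  exact ⟨_, hd.add hΩ (hd'.const_mul t), IsInflowLimit.add hΩ hd (hd'.const_mul t) hl
    (IsInflowLimit.const_mul t hl')⟩

theorem memHZeroInflow_zero : MemHZeroInflow Ω b 0 := by
  refine ⟨0, ⟨MemLp.zero, MemLp.zero, fun φ _ _ _ => by simp⟩, fun ε hε =>
    ⟨0, contDiff_const, fun x _ => rfl, ?_⟩⟩
  have : fderiv ℝ (0 : EuclideanSpace ℝ (Fin n) → ℝ) = 0 := by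
    ext x; simp
  simp [this, hε]

/-- All test functions built below are Lipschitz, so by Rademacher the pointwise line derivative
serves as their weak derivative. -/
theorem LipschitzWith.hasWeakDirDeriv (hΩ : Bornology.IsBounded Ω) {C : NNReal}
    {z : EuclideanSpace ℝ (Fin n) → ℝ} (hz : LipschitzWith C z) :
    HasWeakDirDeriv Ω b z (fun x => lineDeriv ℝ z x b) := by
  have hfin : IsFiniteMeasure (volume.restrict Ω) :=
    ⟨by simpa using hΩ.measure_lt_top⟩
  refine ⟨memLp_restrict_of_continuous hΩ 2 hz.continuous, ?_, fun φ hφ hc hs => ?_⟩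
  · exact MemLp.of_bound (aestronglyMeasurable_lineDeriv hz.continuous _) (C * ‖b‖)
      (ae_of_all _ fun x => norm_lineDeriv_le_of_lipschitz ℝ hz)
  obtain ⟨D, hD⟩ := ContDiff.lipschitzWith_of_hasCompactSupport hc hφ (by simp)
  have h0 : ∀ x, x ∉ tsupport φ → φ x = 0 := fun x hx => image_eq_zero_of_notMem_tsupport hx
  have h1 : ∀ x, x ∉ tsupport φ → fderiv ℝ φ x b = 0 := fun x hx => by
    rw [image_eq_zero_of_notMem_tsupport fun hx' => hx (tsupport_fderiv_subset ℝ hx')]; simp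
  have key := hz.integral_lineDeriv_mul_eq (μ := volume) hD hc b
  rw [setIntegral_eq_integral_of_forall_compl_eq_zero fun x hx => by
      rw [h1 x fun hx' => hx (hs hx'), mul_zero],
    setIntegral_eq_integral_of_forall_compl_eq_zero fun x hx => by
      rw [h0 x fun hx' => hx (hs hx'), mul_zero], key, ← integral_neg]
  refine integral_congr_ae (ae_of_all _ fun x => ?_)
  simp only
  rw [(hφ.differentiable (by simp) x).lineDeriv_eq_fderiv, map_neg]
  ring

/-- Differentiation under the integral with the increment placed on `z`: the Lipschitz constant
gives the dominating function, and `z` has a line derivative at almost every point. -/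
theorem fderiv_normed_convolution_apply {C : NNReal} {z : EuclideanSpace ℝ (Fin n) → ℝ}
    (hz : LipschitzWith C z) (χ : ContDiffBump (0 : EuclideanSpace ℝ (Fin n)))
    (x : EuclideanSpace ℝ (Fin n)) :
    fderiv ℝ (convolution (χ.normed volume) z (ContinuousLinearMap.lsmul ℝ ℝ) volume) x b =
      convolution (χ.normed volume) (fun x => lineDeriv ℝ z x b)
        (ContinuousLinearMap.lsmul ℝ ℝ) volume x := by
  have hsm : ContDiff ℝ ∞
      (convolution (χ.normed volume) z (ContinuousLinearMap.lsmul ℝ ℝ) volume) :=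
    χ.hasCompactSupport_normed.contDiff_convolution_left _ χ.contDiff_normed
      hz.continuous.locallyIntegrable
  rw [← (hsm.differentiable (by simp) x).lineDeriv_eq_fderiv]
  have hρc : Continuous (χ.normed volume) := χ.continuous_normed
  have key := (hasDerivAt_integral_of_dominated_loc_of_lip (μ := volume) (x₀ := (0 : ℝ))
    (F := fun s t => χ.normed volume t • z (x + s • b - t))
    (F' := fun t => χ.normed volume t • lineDeriv ℝ z (x - t) b)
    (bound := fun t => χ.normed volume t * (C * ‖b‖)) (s := Set.univ) univ_mem ?_ ?_ ?_ ?_ ?_ ?_).2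
  · exact key.deriv
  · exact Eventually.of_forall fun s => (hρc.smul (hz.continuous.comp
      (continuous_const.sub continuous_id))).aestronglyMeasurable
  · refine Continuous.integrable_of_hasCompactSupport (hρc.smul (hz.continuous.comp
      (continuous_const.sub continuous_id))) ?_
    exact χ.hasCompactSupport_normed.smul_right
  · refine hρc.aestronglyMeasurable.smul ?_
    exact (measurable_lineDeriv hz.continuous).comp (measurable_const.sub measurable_id)
      |>.aestronglyMeasurable
  · refine ae_of_all _ fun t => LipschitzOnWith.of_dist_le_mul fun s _ s' _ => ?_
    have hnn := χ.nonneg_normed (μ := volume) t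
    rw [dist_eq_norm, ← smul_sub, norm_smul, Real.norm_of_nonneg hnn, Real.coe_nnabs,
      abs_of_nonneg (by positivity), mul_assoc]
    refine mul_le_mul_of_nonneg_left ?_ hnn
    refine (hz.norm_sub_le _ _).trans ?_
    have : x + s • b - t - (x + s' • b - t) = (s - s') • b := by rw [sub_smul]; abel
    rw [this, norm_smul, Real.dist_eq, Real.norm_eq_abs]
    linarith
  · exact χ.integrable_normed.mul_const _
  · have hae := (quasiMeasurePreserving_sub_left (volume : Measure (EuclideanSpace ℝ (Fin n))) x).ae
      (hz.ae_lineDifferentiableAt (μ := volume) b)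
    filter_upwards [hae] with t ht
    have h2 := ht.hasLineDerivAt
    have h3 : HasDerivAt (fun s : ℝ => z (x - t + s • b)) (lineDeriv ℝ z (x - t) b) 0 := h2
    have h4 := h3.const_mul (χ.normed volume t)
    refine h4.congr_of_eventuallyEq (Eventually.of_forall fun s => ?_)
    simp only [smul_eq_mul]
    congr 2
    abel

/-- Mollification at radii at most `δ` preserves the zero values on the inflow boundary. The
mollified functions converge uniformly, their derivatives boundedly and almost everywhere. -/
theorem LipschitzWith.isInflowLimit (hΩ : Bornology.IsBounded Ω) {C : NNReal}
    {z : EuclideanSpace ℝ (Fin n) → ℝ} (hz : LipschitzWith C z) {δ : ℝ} (hδ : 0 < δ)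
    (h0 : ∀ x ∈ inflowBoundary Ω b, ∀ y ∈ Metric.ball x δ, z y = 0) :
    IsInflowLimit Ω b z (fun x => lineDeriv ℝ z x b) := by
  have hfin : IsFiniteMeasure (volume.restrict Ω) :=
    ⟨by simpa using hΩ.measure_lt_top⟩
  set ρ : ℕ → ℝ := fun k => min δ 1 / (k + 1) with hρ
  have hmin : 0 < min δ 1 := lt_min hδ one_pos
  have hρ0 : ∀ k, 0 < ρ k := fun k => by positivity
  have hρ1 : ∀ k, ρ k ≤ min δ 1 := fun k => div_le_self hmin.le (by simp)
  let χ : ℕ → ContDiffBump (0 : EuclideanSpace ℝ (Fin n)) := fun k =>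
    { rIn := ρ k / 2, rOut := ρ k, rIn_pos := half_pos (hρ0 k), rIn_lt_rOut := half_lt_self (hρ0 k) }
  have hχ : Tendsto (fun k => (χ k).rOut) atTop (𝓝 0) := by
    have := (tendsto_one_div_add_atTop_nhds_zero_nat (𝕜 := ℝ)).const_mul (min δ 1)
    simp only [mul_zero] at this
    exact this.congr fun k => by simp only [χ, ρ]; ring
  set d := fun x => lineDeriv ℝ z x b with hd
  have hdb : ∀ x, ‖d x‖ ≤ C * ‖b‖ := fun x => norm_lineDeriv_le_of_lipschitz ℝ hz
  have hdm : Measurable d := measurable_lineDeriv hz.continuous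
  have hdloc : LocallyIntegrable d volume :=
    (hz.memLp_lineDeriv (μ := volume) b).locallyIntegrable le_top
  set φ : ℕ → EuclideanSpace ℝ (Fin n) → ℝ := fun k =>
    convolution ((χ k).normed volume) z (ContinuousLinearMap.lsmul ℝ ℝ) volume with hφ
  have hφsm : ∀ k, ContDiff ℝ ∞ (φ k) := fun k =>
    (χ k).hasCompactSupport_normed.contDiff_convolution_left _ (χ k).contDiff_normed
      hz.continuous.locallyIntegrable
  have hφ0 : ∀ k, ∀ x ∈ inflowBoundary Ω b, φ k x = 0 := by
    intro k x hx
    have hz0 := h0 x hx x (Metric.mem_ball_self hδ)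
    rw [← hz0]
    refine ContDiffBump.normed_convolution_eq_right fun y hy => ?_
    rw [hz0]
    refine h0 x hx y (Metric.ball_subset_ball ?_ hy)
    exact (hρ1 k).trans (min_le_left _ _)
  have hdist : ∀ k x, dist (φ k x) (z x) ≤ C * ρ k := by
    intro k x
    refine ContDiffBump.dist_normed_convolution_le hz.continuous.aestronglyMeasurable fun y hy => ?_
    refine (hz.dist_le_mul y x).trans ?_
    gcongr
    exact (Metric.mem_ball.1 hy).le
  have hfd : ∀ k x, fderiv ℝ (φ k) x b =
      convolution ((χ k).normed volume) d (ContinuousLinearMap.lsmul ℝ ℝ) volume x :=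
    fun k x => fderiv_normed_convolution_apply hz (χ k) x
  have hfb : ∀ k x, ‖fderiv ℝ (φ k) x b‖ ≤ C * ‖b‖ := by
    intro k x
    rw [hfd]
    have : C * ‖b‖ = ∫ t, (χ k).normed volume t * (C * ‖b‖) := by
      rw [integral_mul_const, ContDiffBump.integral_normed, one_mul]
    rw [this]
    refine norm_integral_le_of_norm_le ((χ k).integrable_normed.mul_const _)
      (ae_of_all _ fun t => ?_)
    rw [ContinuousLinearMap.lsmul_apply, norm_smul,
      Real.norm_of_nonneg ((χ k).nonneg_normed t)]
    exact mul_le_mul_of_nonneg_left (hdb _) ((χ k).nonneg_normed t)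
  -- Lebesgue differentiation; it needs mollifiers with a bounded ratio `rOut / rIn`, which equals
  -- `2` here.
  have hae : ∀ᵐ x ∂(volume.restrict Ω), Tendsto (fun k => fderiv ℝ (φ k) x b) atTop (𝓝 (d x)) := by
    refine ae_restrict_of_ae ?_
    have := ContDiffBump.ae_convolution_tendsto_right_of_locallyIntegrable (φ := χ) (K := 2) hχ
      (Eventually.of_forall fun k => by simp only [χ]; linarith) hdloc
    filter_upwards [this] with x hx
    exact hx.congr fun k => (hfd k x).symm
  have lim1 : Tendsto (fun k => ∫ x in Ω, (z x - φ k x) ^ 2) atTop (𝓝 (∫ x in Ω, (0 : ℝ))) := by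
    refine tendsto_integral_of_dominated_convergence (fun _ => (C : ℝ) ^ 2) (fun k =>
      ((hz.continuous.sub (hφsm k).continuous).pow 2).aestronglyMeasurable) (integrable_const _)
      (fun k => ae_of_all _ fun x => ?_) (ae_of_all _ fun x => ?_)
    · rw [norm_pow]
      refine pow_le_pow_left₀ (norm_nonneg _) ?_ 2
      have h1 := hdist k x
      rw [dist_comm, dist_eq_norm] at h1
      refine h1.trans ?_
      exact mul_le_of_le_one_right C.2 ((hρ1 k).trans (min_le_right _ _))
    · have h1 : Tendsto (fun k => φ k x) atTop (𝓝 (z x)) := by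
        rw [tendsto_iff_dist_tendsto_zero]
        refine squeeze_zero (fun _ => dist_nonneg) (fun k => hdist k x) ?_
        simpa using hχ.const_mul (C : ℝ)
      simpa using ((tendsto_const_nhds (x := z x)).sub h1).pow 2
  have lim2 : Tendsto (fun k => ∫ x in Ω, (d x - fderiv ℝ (φ k) x b) ^ 2) atTop
      (𝓝 (∫ x in Ω, (0 : ℝ))) := by
    refine tendsto_integral_of_dominated_convergence (fun _ => (2 * (C * ‖b‖)) ^ 2) (fun k => ?_)
      (integrable_const _) (fun k => ae_of_all _ fun x => ?_) ?_
    · refine (hdm.aestronglyMeasurable.sub ?_).pow 2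
      exact ((hφsm k).continuous_fderiv (by simp)).clm_apply continuous_const
        |>.aestronglyMeasurable
    · rw [norm_pow]
      refine pow_le_pow_left₀ (norm_nonneg _) ((_root_.norm_sub_le _ _).trans ?_) 2
      linarith [hdb x, hfb k x]
    · filter_upwards [hae] with x hx
      simpa using ((tendsto_const_nhds (x := d x)).sub hx).pow 2
  intro ε hε
  have hsum := lim1.add lim2
  simp only [integral_zero, add_zero] at hsum
  obtain ⟨k, hk⟩ := (hsum.eventually (gt_mem_nhds hε)).exists
  exact ⟨φ k, hφsm k, hφ0 k, hk⟩

/-- Here `z` vanishes only on the inflow boundary itself. The truncations `max (z - e k) 0` vanish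
in a neighbourhood of it, since `z` is Lipschitz, and they converge to `z` together with their
derivatives. -/
theorem LipschitzWith.memHZeroInflow_of_nonneg (hΩ : Bornology.IsBounded Ω) {C : NNReal}
    {z : EuclideanSpace ℝ (Fin n) → ℝ} (hz : LipschitzWith C z) (hnn : ∀ x, 0 ≤ z x)
    (h0 : ∀ x ∈ inflowBoundary Ω b, z x = 0) : MemHZeroInflow Ω b z := by
  have hfin : IsFiniteMeasure (volume.restrict Ω) :=
    ⟨by simpa using hΩ.measure_lt_top⟩
  refine ⟨_, hz.hasWeakDirDeriv hΩ, ?_⟩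
  refine IsInflowLimit.of_approx hΩ (hz.hasWeakDirDeriv (b := b) hΩ).1
    (hz.hasWeakDirDeriv hΩ).2.1 fun ε hε => ?_
  set e : ℕ → ℝ := fun k => 1 / ((k : ℝ) + 1) with he
  have he0 : ∀ k, 0 < e k := fun k => by positivity
  have he1 : ∀ k, e k ≤ 1 := fun k => by
    rw [he]; simp only; rw [div_le_one (by positivity)]; simp
  have hlim : Tendsto e atTop (𝓝 0) := tendsto_one_div_add_atTop_nhds_zero_nat
  set y : ℕ → EuclideanSpace ℝ (Fin n) → ℝ := fun k x => max (z x - e k) 0 with hy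
  have hyL : ∀ k, LipschitzWith C (y k) := fun k => by
    refine LipschitzWith.of_dist_le_mul fun x x' => ?_
    refine le_trans ?_ (hz.dist_le_mul x x')
    rw [Real.dist_eq, Real.dist_eq]
    refine (abs_max_sub_max_le_abs _ _ _).trans ?_
    rw [sub_sub_sub_cancel_right]
  have hyd : ∀ k x, dist (y k x) (z x) ≤ e k := by
    intro k x
    rw [Real.dist_eq, abs_le]
    simp only [hy]
    rcases max_cases (z x - e k) 0 with ⟨h, h'⟩ | ⟨h, h'⟩ <;> rw [h] <;>
      constructor <;> linarith [he0 k, hnn x]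
  -- A zero is a minimum of the nonnegative `z`, so the derivative along the line vanishes there;
  -- where it does not exist its default value is `0` as well. Hence the derivatives converge at
  -- every point.
  have hd0 : ∀ x, z x = 0 → lineDeriv ℝ z x b = 0 := by
    intro x hx
    refine IsLocalMin.deriv_eq_zero (Eventually.of_forall fun t => ?_)
    simp [hx, hnn]
  have hyd0 : ∀ k x, z x < e k → lineDeriv ℝ (y k) x b = 0 := by
    intro k x hx
    have hyx : y k x = 0 := max_eq_right (by linarith)
    refine IsLocalMin.deriv_eq_zero (Eventually.of_forall fun t => ?_)
    simp only [zero_smul, add_zero, hyx]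
    exact le_max_right _ _
  have hyd1 : ∀ k x, e k < z x → lineDeriv ℝ (y k) x b = lineDeriv ℝ z x b := by
    intro k x hx
    have hc : Continuous fun t : ℝ => z (x + t • b) :=
      hz.continuous.comp (continuous_const.add (continuous_id.smul continuous_const))
    have hev : (fun t : ℝ => y k (x + t • b)) =ᶠ[𝓝 0] fun t => z (x + t • b) - e k := by
      have : ∀ᶠ t in 𝓝 (0 : ℝ), e k < z (x + t • b) :=
        hc.continuousAt.eventually (lt_mem_nhds (by simpa using hx))
      filter_upwards [this] with t ht
      exact max_eq_left (by linarith)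
    rw [lineDeriv, hev.deriv_eq, deriv_sub_const, lineDeriv]
  have lim1 : Tendsto (fun k => ∫ x in Ω, (z x - y k x) ^ 2) atTop (𝓝 (∫ x in Ω, (0 : ℝ))) := by
    refine tendsto_integral_of_dominated_convergence (fun _ => (1 : ℝ) ^ 2) (fun k =>
      ((hz.continuous.sub (hyL k).continuous).pow 2).aestronglyMeasurable) (integrable_const _)
      (fun k => ae_of_all _ fun x => ?_) (ae_of_all _ fun x => ?_)
    · rw [norm_pow]
      refine pow_le_pow_left₀ (norm_nonneg _) ?_ 2
      have h1 := hyd k x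
      rw [dist_comm, dist_eq_norm] at h1
      exact h1.trans (he1 k)
    · have h1 : Tendsto (fun k => y k x) atTop (𝓝 (z x)) := by
        rw [tendsto_iff_dist_tendsto_zero]
        exact squeeze_zero (fun _ => dist_nonneg) (fun k => hyd k x) hlim
      simpa using ((tendsto_const_nhds (x := z x)).sub h1).pow 2
  have lim2 : Tendsto (fun k => ∫ x in Ω, (lineDeriv ℝ z x b - lineDeriv ℝ (y k) x b) ^ 2) atTop
      (𝓝 (∫ x in Ω, (0 : ℝ))) := by
    refine tendsto_integral_of_dominated_convergence (fun _ => (2 * (C * ‖b‖)) ^ 2) (fun k => ?_)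
      (integrable_const _) (fun k => ae_of_all _ fun x => ?_) (ae_of_all _ fun x => ?_)
    · exact ((measurable_lineDeriv hz.continuous).sub
        (measurable_lineDeriv (hyL k).continuous)).pow_const 2 |>.aestronglyMeasurable
    · rw [norm_pow]
      refine pow_le_pow_left₀ (norm_nonneg _) ((_root_.norm_sub_le _ _).trans ?_) 2
      linarith [norm_lineDeriv_le_of_lipschitz ℝ hz (x₀ := x) (v := b),
        norm_lineDeriv_le_of_lipschitz ℝ (hyL k) (x₀ := x) (v := b)]
    · refine tendsto_const_nhds.congr' ?_
      rcases (hnn x).eq_or_lt with hx | hx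
      · refine Eventually.of_forall fun k => ?_
        simp only [hd0 x hx.symm, hyd0 k x (by rw [← hx]; exact he0 k)]
        simp
      · filter_upwards [hlim.eventually (gt_mem_nhds hx)] with k hk
        simp only [hyd1 k x hk]
        simp
  have hsum := lim1.add lim2
  simp only [integral_zero, add_zero] at hsum
  obtain ⟨k, hk⟩ := (hsum.eventually (gt_mem_nhds hε)).exists
  refine ⟨y k, fun x => lineDeriv ℝ (y k) x b, ((hyL k).hasWeakDirDeriv (b := b) hΩ).1,
    ((hyL k).hasWeakDirDeriv (b := b) hΩ).2.1, ?_, hk⟩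
  refine (hyL k).isInflowLimit hΩ (δ := e k / (C + 1)) (by have := he0 k; positivity)
    fun x hx x' hx' => max_eq_right ?_
  have h1 := hz.dist_le_mul x' x
  rw [Real.dist_eq, h0 x hx, sub_zero, abs_of_nonneg (hnn _)] at h1
  rw [Metric.mem_ball, lt_div_iff₀ (by positivity)] at hx'
  nlinarith [dist_nonneg (x := x') (y := x)]

end WeakDerivative


/-! ### Polynomials of bounded degree: norm equivalence and scaling -/

section PolynomialFunctions

/-- The functions on `ℝⁿ` that are given by a polynomial of total degree at most `m`. -/
def polyFun (n m : ℕ) : Submodule ℝ (EuclideanSpace ℝ (Fin n) → ℝ) :=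
  (MvPolynomial.restrictTotalDegree (Fin n) ℝ m).map
    (LinearMap.pi fun x : EuclideanSpace ℝ (Fin n) =>
      (MvPolynomial.aeval (R := ℝ) fun i => x i).toLinearMap)

variable {n m : ℕ}

theorem mem_polyFun {f : EuclideanSpace ℝ (Fin n) → ℝ} :
    f ∈ polyFun n m ↔ ∃ p : MvPolynomial (Fin n) ℝ, p.totalDegree ≤ m ∧
      ∀ x, f x = MvPolynomial.eval (fun i => x i) p := by
  rw [polyFun, Submodule.mem_map]
  refine exists_congr fun p => and_congr (MvPolynomial.mem_restrictTotalDegree _ _ _) ?_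
  rw [eq_comm, funext_iff]
  rfl

instance : Module.Finite ℝ (polyFun n m) := by
  unfold polyFun; infer_instance

theorem polyFun_mono {m m' : ℕ} (h : m ≤ m') : polyFun n m ≤ polyFun n m' := by
  intro f hf
  obtain ⟨p, hp, hpf⟩ := mem_polyFun.1 hf
  exact mem_polyFun.2 ⟨p, hp.trans h, hpf⟩

theorem const_mem_polyFun (a : ℝ) : (fun _ => a) ∈ polyFun n m :=
  mem_polyFun.2 ⟨MvPolynomial.C a, by simp, fun x => by simp⟩

theorem linear_mem_polyFun (hm : 1 ≤ m) (l : EuclideanSpace ℝ (Fin n) →ₗ[ℝ] ℝ) :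
    (fun x => l x) ∈ polyFun n m := by
  refine mem_polyFun.2 ⟨∑ i, MvPolynomial.C (l (EuclideanSpace.basisFun (Fin n) ℝ i)) *
    MvPolynomial.X i, ?_, fun x => ?_⟩
  · refine (MvPolynomial.totalDegree_finsetSum_le fun i _ => ?_).trans hm
    refine (MvPolynomial.totalDegree_mul _ _).trans ?_
    simp
  · conv_lhs => rw [← (EuclideanSpace.basisFun (Fin n) ℝ).sum_repr x]
    simp [mul_comm]

theorem totalDegree_bind₁_le {σ τ : Type*} (f : σ → MvPolynomial τ ℝ)
    (hf : ∀ i, (f i).totalDegree ≤ 1) (p : MvPolynomial σ ℝ) :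
    (MvPolynomial.bind₁ f p).totalDegree ≤ p.totalDegree := by
  rw [MvPolynomial.bind₁, MvPolynomial.aeval_def, MvPolynomial.eval₂_eq]
  refine MvPolynomial.totalDegree_finsetSum_le fun d hd => ?_
  refine (MvPolynomial.totalDegree_mul _ _).trans ?_
  rw [MvPolynomial.algebraMap_eq, MvPolynomial.totalDegree_C, zero_add]
  refine (MvPolynomial.totalDegree_finsetProd _ _).trans
    (le_trans ?_ (MvPolynomial.le_totalDegree hd))
  refine Finset.sum_le_sum fun i _ => (MvPolynomial.totalDegree_pow _ _).trans ?_
  exact (Nat.mul_le_mul_left _ (hf i)).trans_eq (mul_one _)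

theorem comp_affine_mem_polyFun {f : EuclideanSpace ℝ (Fin n) → ℝ} (hf : f ∈ polyFun n m)
    (x₀ : EuclideanSpace ℝ (Fin n)) (h : ℝ) : (fun y => f (x₀ + h • y)) ∈ polyFun n m := by
  obtain ⟨p, hp, hpf⟩ := mem_polyFun.1 hf
  refine mem_polyFun.2 ⟨MvPolynomial.bind₁
    (fun i => MvPolynomial.C (x₀ i) + MvPolynomial.C h * MvPolynomial.X i) p,
    (totalDegree_bind₁_le _ (fun i => ?_) p).trans hp, fun y => ?_⟩
  · refine (MvPolynomial.totalDegree_add _ _).trans (max_le (by simp) ?_)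
    exact (MvPolynomial.totalDegree_mul _ _).trans (by simp)
  · rw [hpf]
    conv_rhs => rw [MvPolynomial.eval, MvPolynomial.eval₂Hom_bind₁]
    rw [MvPolynomial.eval]
    congr 2
    ext i
    simp

theorem analyticOnNhd_of_mem_polyFun {f : EuclideanSpace ℝ (Fin n) → ℝ} (hf : f ∈ polyFun n m) :
    AnalyticOnNhd ℝ f Set.univ := by
  obtain ⟨p, -, hpf⟩ := mem_polyFun.1 hf
  rw [show f = fun x : EuclideanSpace ℝ (Fin n) => MvPolynomial.eval (fun i => x i) p from
    funext hpf]
  have := AnalyticOnNhd.aeval_mvPolynomial (𝕜 := ℝ) (A := ℝ)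
    (f := fun (x : EuclideanSpace ℝ (Fin n)) i => x i) (s := Set.univ)
    (fun i x _ => (EuclideanSpace.proj i : EuclideanSpace ℝ (Fin n) →L[ℝ] ℝ).analyticAt x) p
  exact this

theorem contDiff_of_mem_polyFun {f : EuclideanSpace ℝ (Fin n) → ℝ} (hf : f ∈ polyFun n m) :
    ContDiff ℝ ∞ f := (analyticOnNhd_of_mem_polyFun hf).contDiff

theorem continuous_of_mem_polyFun {f : EuclideanSpace ℝ (Fin n) → ℝ} (hf : f ∈ polyFun n m) :
    Continuous f := (contDiff_of_mem_polyFun hf).continuous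

/-- Difference quotients are polynomials of the same degree, and a finite-dimensional subspace is
closed under pointwise limits. -/
theorem fderiv_apply_mem_polyFun {f : EuclideanSpace ℝ (Fin n) → ℝ} (hf : f ∈ polyFun n m)
    (b : EuclideanSpace ℝ (Fin n)) : (fun x => fderiv ℝ f x b) ∈ polyFun n m := by
  have hcl : IsClosed (polyFun n m : Set (EuclideanSpace ℝ (Fin n) → ℝ)) :=
    Submodule.closed_of_finiteDimensional _
  set e : ℕ → ℝ := fun k => 1 / ((k : ℝ) + 1) with he
  have he0 : ∀ k, 0 < e k := fun k => by positivity
  have hlim : Tendsto e atTop (𝓝[≠] 0) :=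
    tendsto_nhdsWithin_iff.2 ⟨tendsto_one_div_add_atTop_nhds_zero_nat,
      Eventually.of_forall fun k => (he0 k).ne'⟩
  refine hcl.mem_of_tendsto (f := fun k => (e k)⁻¹ • ((fun x => f (e k • b + (1 : ℝ) • x)) - f))
    (b := atTop) ?_ (Eventually.of_forall fun k =>
      Submodule.smul_mem _ _ (Submodule.sub_mem _ (comp_affine_mem_polyFun hf _ _) hf))
  rw [tendsto_pi_nhds]
  intro x
  have hd : HasLineDerivAt ℝ f (fderiv ℝ f x b) x b :=
    ((contDiff_of_mem_polyFun hf).differentiable (by simp) x).hasFDerivAt.hasLineDerivAt b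
  refine (hd.tendsto_slope_zero.comp hlim).congr fun k => ?_
  simp [add_comm]

theorem norm_toLp_two {α : Type*} [MeasurableSpace α] {μ : Measure α} {f : α → ℝ}
    (hf : MemLp f 2 μ) : ‖hf.toLp f‖ = √(∫ x, f x ^ 2 ∂μ) := by
  rw [Lp.norm_toLp, hf.eLpNorm_eq_integral_rpow_norm (by norm_num) (by norm_num),
    ENNReal.toReal_ofReal (by positivity), Real.sqrt_eq_rpow]
  norm_num

/-- The map from coefficients to `L₂` of a ball is linear on a finite-dimensional space, so
injectivity yields a lower bound. It is injective because a polynomial that vanishes almost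
everywhere on the ball vanishes on it by continuity and everywhere by analyticity. -/
theorem exists_coeff_bound {d : ℕ} {f : Fin d → EuclideanSpace ℝ (Fin n) → ℝ}
    (hf : ∀ i, f i ∈ polyFun n m) (hli : LinearIndependent ℝ f) {ρ : ℝ} (hρ : 0 < ρ) :
    ∃ C : ℝ, 0 < C ∧ ∀ a : Fin d → ℝ, ∀ i,
      |a i| ≤ C * √(∫ x in Metric.ball 0 ρ, (∑ i, a i * f i x) ^ 2) := by
  have hL : ∀ i, MemLp (f i) 2 (volume.restrict (Metric.ball 0 ρ)) := fun i =>
    memLp_restrict_of_continuous Metric.isBounded_ball 2 (continuous_of_mem_polyFun (hf i))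
  set J := Fintype.linearCombination ℝ (fun i => (hL i).toLp (f i)) with hJ
  have hJa : ∀ a, ∃ h : MemLp (fun x => ∑ i, a i * f i x) 2
      (volume.restrict (Metric.ball (0 : EuclideanSpace ℝ (Fin n)) ρ)), J a = h.toLp _ := by
    intro a
    have h : MemLp (fun x => ∑ i, a i * f i x) 2 (volume.restrict (Metric.ball 0 ρ)) :=
      memLp_finsetSum _ fun i _ => (hL i).const_mul (a i)
    refine ⟨h, ?_⟩
    rw [hJ, Fintype.linearCombination_apply]
    refine Lp.ext ?_
    have h1 := Lp.coeFn_fun_finsetSum Finset.univ (fun i => a i • (hL i).toLp (f i))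
    have h2 : ∀ i, ∀ᵐ x ∂(volume.restrict (Metric.ball 0 ρ)),
        (a i • (hL i).toLp (f i) : Lp ℝ 2 _) x = a i * f i x := fun i => by
      filter_upwards [Lp.coeFn_smul (a i) ((hL i).toLp (f i)), (hL i).coeFn_toLp] with x hx hx'
      rw [hx, Pi.smul_apply, hx', smul_eq_mul]
    filter_upwards [h1, h.coeFn_toLp, ae_all_iff.2 h2] with x hx hx' hx''
    rw [hx, hx']
    exact Finset.sum_congr rfl fun i _ => hx'' i
  have hker : LinearMap.ker J = ⊥ := by
    rw [LinearMap.ker_eq_bot']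
    intro a ha
    obtain ⟨h, hh⟩ := hJa a
    rw [ha] at hh
    have h0 : (fun x => ∑ i, a i * f i x) =ᵐ[volume.restrict (Metric.ball 0 ρ)] 0 :=
      h.coeFn_toLp.symm.trans ((Lp.ext_iff.1 hh).symm.trans (Lp.coeFn_zero _ _ _))
    have hmem : (∑ i, a i • f i) ∈ polyFun n m :=
      Submodule.sum_mem _ fun i _ => Submodule.smul_mem _ _ (hf i)
    have heq : (∑ i, a i • f i) = fun x => ∑ i, a i * f i x := by
      ext x; simp
    have hon := Measure.eqOn_open_of_ae_eq h0 Metric.isOpen_ball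
      (by rw [← heq]; exact (continuous_of_mem_polyFun hmem).continuousOn) continuousOn_const
    have hev : (∑ i, a i • f i) =ᶠ[𝓝 0] 0 := by
      rw [heq]
      filter_upwards [Metric.ball_mem_nhds 0 hρ] with x hx using hon hx
    have hz := AnalyticOnNhd.eq_of_eventuallyEq (analyticOnNhd_of_mem_polyFun hmem)
      (g := 0) (fun x _ => analyticAt_const) hev
    funext i
    exact Fintype.linearIndependent_iff.1 hli a hz i
  obtain ⟨C, hC, hanti⟩ := LinearMap.exists_antilipschitzWith J hker
  refine ⟨C, hC, fun a i => ?_⟩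
  have h1 := hanti.le_mul_dist a 0
  rw [map_zero, dist_zero_right, dist_zero_right] at h1
  obtain ⟨h, hh⟩ := hJa a
  rw [hh, norm_toLp_two] at h1
  exact (norm_le_pi_norm a i).trans h1

theorem exists_unit_bound (n m : ℕ) {ρ : ℝ} (hρ : 0 < ρ) :
    ∃ C : ℝ, 0 < C ∧ ∀ q ∈ polyFun n m,
      (∀ y ∈ Metric.closedBall 0 1, |q y| ≤ C * √(∫ x in Metric.ball 0 ρ, q x ^ 2)) ∧
      ∀ y ∈ Metric.closedBall 0 1, ∀ y' ∈ Metric.closedBall 0 1,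
        |q y - q y'| ≤ C * √(∫ x in Metric.ball 0 ρ, q x ^ 2) * ‖y - y'‖ := by
  set B := Module.finBasis ℝ (polyFun n m) with hB
  set f : Fin (Module.finrank ℝ (polyFun n m)) → EuclideanSpace ℝ (Fin n) → ℝ :=
    fun i => B i with hfdef
  have hf : ∀ i, f i ∈ polyFun n m := fun i => (B i).2
  have hli : LinearIndependent ℝ f :=
    B.linearIndependent.map' (polyFun n m).subtype (Submodule.ker_subtype _)
  obtain ⟨C, hC, hbound⟩ := exists_coeff_bound hf hli hρ
  have hK : IsCompact (Metric.closedBall (0 : EuclideanSpace ℝ (Fin n)) 1) :=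
    isCompact_closedBall _ _
  have h1 : ∀ i, ∃ M, ∀ y ∈ Metric.closedBall (0 : EuclideanSpace ℝ (Fin n)) 1, ‖f i y‖ ≤ M :=
    fun i => hK.exists_bound_of_continuousOn (continuous_of_mem_polyFun (hf i)).continuousOn
  have h2 : ∀ i, ∃ M, ∀ y ∈ Metric.closedBall (0 : EuclideanSpace ℝ (Fin n)) 1,
      ‖fderiv ℝ (f i) y‖ ≤ M := fun i => hK.exists_bound_of_continuousOn
        ((contDiff_of_mem_polyFun (hf i)).continuous_fderiv (by simp)).continuousOn
  choose M₁ hM₁ using h1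
  choose M₂ hM₂ using h2
  refine ⟨C * ∑ i, (|M₁ i| + |M₂ i|) + 1, by positivity, fun q hq => ?_⟩
  set a : Fin (Module.finrank ℝ (polyFun n m)) → ℝ := fun i => B.repr ⟨q, hq⟩ i with ha
  have hqa : ∀ x, q x = ∑ i, a i * f i x := by
    intro x
    have := congrArg (fun v : polyFun n m => (v : EuclideanSpace ℝ (Fin n) → ℝ) x)
      (B.sum_repr ⟨q, hq⟩)
    simp only at this
    rw [← this, Submodule.coe_sum, Finset.sum_apply]
    rfl
  have hN : ∀ i, |a i| ≤ C * √(∫ x in Metric.ball 0 ρ, q x ^ 2) := by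
    intro i
    simpa only [hqa] using hbound a i
  set N := √(∫ x in Metric.ball 0 ρ, q x ^ 2) with hNdef
  have hN0 : 0 ≤ N := Real.sqrt_nonneg _
  constructor
  · intro y hy
    rw [hqa]
    calc |∑ i, a i * f i y| ≤ ∑ i, |a i * f i y| := Finset.abs_sum_le_sum_abs _ _
      _ ≤ ∑ i, C * N * (|M₁ i| + |M₂ i|) := by
          refine Finset.sum_le_sum fun i _ => ?_
          rw [abs_mul]
          refine mul_le_mul (hN i) ?_ (abs_nonneg _) (by positivity)
          have := hM₁ i y hy
          rw [Real.norm_eq_abs] at this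
          linarith [le_abs_self (M₁ i), abs_nonneg (M₂ i)]
      _ = C * (∑ i, (|M₁ i| + |M₂ i|)) * N := by rw [← Finset.mul_sum]; ring
      _ ≤ _ := by nlinarith
  · intro y hy y' hy'
    rw [hqa, hqa, ← Finset.sum_sub_distrib]
    calc |∑ i, (a i * f i y - a i * f i y')| ≤ ∑ i, |a i * f i y - a i * f i y'| :=
          Finset.abs_sum_le_sum_abs _ _
      _ ≤ ∑ i, C * N * ((|M₁ i| + |M₂ i|) * ‖y - y'‖) := by
          refine Finset.sum_le_sum fun i _ => ?_
          rw [← mul_sub, abs_mul]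
          refine mul_le_mul (hN i) ?_ (abs_nonneg _) (by positivity)
          have := (convex_closedBall (0 : EuclideanSpace ℝ (Fin n)) 1).norm_image_sub_le_of_norm_fderiv_le
            (𝕜 := ℝ) (fun x _ => (contDiff_of_mem_polyFun (hf i)).differentiable (by simp) x)
            (hM₂ i) hy' hy
          rw [Real.norm_eq_abs] at this
          refine this.trans (mul_le_mul_of_nonneg_right ?_ (norm_nonneg _))
          linarith [le_abs_self (M₂ i), abs_nonneg (M₁ i)]
      _ = C * (∑ i, (|M₁ i| + |M₂ i|)) * N * ‖y - y'‖ := by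
          rw [← Finset.mul_sum, ← Finset.sum_mul]; ring
      _ ≤ _ := by nlinarith [mul_nonneg hN0 (norm_nonneg (y - y'))]

/-- The scaled `L₂` norm of `q` on the ball around `x₀` with radius `ρ h`. -/
def ballNorm (ρ : ℝ) (x₀ : EuclideanSpace ℝ (Fin n)) (h : ℝ) (q : EuclideanSpace ℝ (Fin n) → ℝ) :
    ℝ :=
  √((∫ x in Metric.ball x₀ (ρ * h), q x ^ 2) / h ^ n)

theorem ballNorm_nonneg (ρ : ℝ) (x₀ : EuclideanSpace ℝ (Fin n)) (h : ℝ)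
    (q : EuclideanSpace ℝ (Fin n) → ℝ) : 0 ≤ ballNorm ρ x₀ h q := Real.sqrt_nonneg _

theorem pow_mul_ballNorm_sq (ρ : ℝ) (x₀ : EuclideanSpace ℝ (Fin n)) {h : ℝ} (hh : 0 < h)
    (q : EuclideanSpace ℝ (Fin n) → ℝ) :
    h ^ n * ballNorm ρ x₀ h q ^ 2 = ∫ x in Metric.ball x₀ (ρ * h), q x ^ 2 := by
  rw [ballNorm, Real.sq_sqrt]
  · field_simp
  · exact div_nonneg (integral_nonneg fun x => sq_nonneg _) (by positivity)

theorem ballNorm_eq (ρ : ℝ) (x₀ : EuclideanSpace ℝ (Fin n)) {h : ℝ} (hh : 0 < h)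
    (q : EuclideanSpace ℝ (Fin n) → ℝ) :
    ballNorm ρ x₀ h q = √(∫ y in Metric.ball 0 ρ, q (x₀ + h • y) ^ 2) := by
  rw [ballNorm]
  congr 1
  rw [Measure.setIntegral_comp_smul_of_pos volume (fun y => q (x₀ + y) ^ 2) _ hh,
    finrank_euclideanSpace_fin, smul_ball hh.ne', smul_zero, Real.norm_of_nonneg hh.le]
  have := (measurePreserving_add_left (volume : Measure (EuclideanSpace ℝ (Fin n))) x₀
    ).setIntegral_preimage_emb (measurableEmbedding_addLeft x₀) (fun y => q y ^ 2)
      (Metric.ball x₀ (ρ * h))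
  rw [preimage_add_ball, sub_self] at this
  rw [mul_comm h ρ, this, smul_eq_mul]
  field_simp

/-- The unit-ball estimate transported by `y ↦ x₀ + h • y`. Applied with `h` the diameter of a cell
and a small inscribed ball, it replaces the usual passage to a reference simplex: the `L₂` norm on
the small ball controls values and Lipschitz constant on the whole cell. -/
theorem exists_ballNorm_bound (n m : ℕ) {ρ : ℝ} (hρ : 0 < ρ) :
    ∃ C : ℝ, 0 < C ∧ ∀ q ∈ polyFun n m, ∀ (x₀ : EuclideanSpace ℝ (Fin n)) (h : ℝ), 0 < h →
      (∀ x ∈ Metric.closedBall x₀ h, |q x| ≤ C * ballNorm ρ x₀ h q) ∧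
      ∀ x ∈ Metric.closedBall x₀ h, ∀ x' ∈ Metric.closedBall x₀ h,
        |q x - q x'| ≤ C * ballNorm ρ x₀ h q * (‖x - x'‖ / h) := by
  obtain ⟨C, hC, hbound⟩ := exists_unit_bound n m hρ
  refine ⟨C, hC, fun q hq x₀ h hh => ?_⟩
  obtain ⟨h1, h2⟩ := hbound _ (comp_affine_mem_polyFun hq x₀ h)
  rw [← ballNorm_eq ρ x₀ hh] at h1 h2
  have hmem : ∀ x ∈ Metric.closedBall x₀ h,
      h⁻¹ • (x - x₀) ∈ Metric.closedBall (0 : EuclideanSpace ℝ (Fin n)) 1 := by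
    intro x hx
    rw [mem_closedBall_zero_iff, norm_smul, norm_inv, Real.norm_of_nonneg hh.le,
      inv_mul_le_one₀ hh]
    rwa [mem_closedBall_iff_norm] at hx
  have hx0 : ∀ x, x₀ + h • h⁻¹ • (x - x₀) = x := fun x => by
    rw [smul_inv_smul₀ hh.ne', add_sub_cancel]
  refine ⟨fun x hx => ?_, fun x hx x' hx' => ?_⟩
  · have := h1 _ (hmem x hx)
    rwa [hx0] at this
  · have := h2 _ (hmem x hx) _ (hmem x' hx')
    rw [hx0, hx0, ← smul_sub, sub_sub_sub_cancel_right, norm_smul, norm_inv,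
      Real.norm_of_nonneg hh.le] at this
    rwa [div_eq_inv_mul]

theorem ballNorm_sq_le {ρ h : ℝ} (hh : 0 < h) {x₀ : EuclideanSpace ℝ (Fin n)}
    {q : EuclideanSpace ℝ (Fin n) → ℝ} (hq : Continuous q) {K : Set (EuclideanSpace ℝ (Fin n))}
    (hK : Bornology.IsBounded K) (hsub : Metric.ball x₀ (ρ * h) ⊆ K) :
    h ^ n * ballNorm ρ x₀ h q ^ 2 ≤ ∫ x in K, q x ^ 2 := by
  rw [pow_mul_ballNorm_sq ρ x₀ hh]
  refine setIntegral_mono_set ?_ (ae_of_all _ fun x => sq_nonneg _) hsub.eventuallyLE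
  exact (memLp_restrict_of_continuous hK 2 hq).integrable_sq

variable (n) in
/-- The volume of the unit ball. -/
def unitBallVolume : ℝ := (volume (Metric.ball (0 : EuclideanSpace ℝ (Fin n)) 1)).toReal

theorem unitBallVolume_nonneg : 0 ≤ unitBallVolume n := ENNReal.toReal_nonneg

theorem volume_toReal_le {h : ℝ} (hh : 0 ≤ h) {x₀ : EuclideanSpace ℝ (Fin n)}
    {K : Set (EuclideanSpace ℝ (Fin n))} (hsub : K ⊆ Metric.closedBall x₀ h) :
    (volume K).toReal ≤ h ^ n * unitBallVolume n := by
  have h1 := measure_mono (μ := volume) hsub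
  rw [Measure.addHaar_closedBall volume x₀ hh, finrank_euclideanSpace_fin] at h1
  have h2 := ENNReal.toReal_mono (ENNReal.mul_ne_top ENNReal.ofReal_ne_top
    Metric.isBounded_ball.measure_lt_top.ne) h1
  rwa [ENNReal.toReal_mul, ENNReal.toReal_ofReal (by positivity)] at h2

theorem setIntegral_le_of_abs_le {h a : ℝ} (hh : 0 ≤ h) {x₀ : EuclideanSpace ℝ (Fin n)}
    {K : Set (EuclideanSpace ℝ (Fin n))} (hsub : K ⊆ Metric.closedBall x₀ h) (ha : 0 ≤ a)
    {f : EuclideanSpace ℝ (Fin n) → ℝ} (hf : ∀ᵐ x ∂(volume.restrict K), |f x| ≤ a) :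
    |∫ x in K, f x| ≤ unitBallVolume n * h ^ n * a := by
  have hlt : volume K < ⊤ := (Metric.isBounded_closedBall.subset hsub).measure_lt_top
  have h1 := norm_setIntegral_le_of_norm_le_const_ae (C := a) (f := f) hlt
    (hf.mono fun x hx => by rwa [Real.norm_eq_abs])
  rw [Real.norm_eq_abs] at h1
  refine h1.trans ?_
  rw [Measure.real, mul_comm]
  refine mul_le_mul_of_nonneg_right ((volume_toReal_le hh hsub).trans_eq (mul_comm _ _)) ha

end PolynomialFunctions


/-! ### Continuous piecewise affine interpolation -/

section Interpolation

/-- A bound relative to a fixed base point holds near every point, and the mean value inequality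
along segments makes it global with the same constant. This turns a cellwise affine function into a
Lipschitz one. -/
theorem lipschitzWith_of_finite_closed_cover {E : Type*} [NormedAddCommGroup E] [NormedSpace ℝ E]
    {z : E → ℝ} {Λ : NNReal} {S : Set (Set E)} (hS : S.Finite) (hcl : ∀ F ∈ S, IsClosed F)
    (hcov : ∀ x, ∃ F ∈ S, x ∈ F)
    (hL : ∀ F ∈ S, ∀ x ∈ F, ∀ y ∈ F, |z x - z y| ≤ Λ * ‖x - y‖) : LipschitzWith Λ z := by
  have hloc : ∀ x, ∀ᶠ y in 𝓝 x, |z y - z x| ≤ Λ * ‖y - x‖ := by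
    intro x
    -- Closed sets that miss `x` also miss a neighbourhood of it; there are finitely many.
    have h1 : ∀ᶠ y in 𝓝 x, ∀ F ∈ S, y ∈ F → x ∈ F := by
      rw [Filter.eventually_all_finite hS]
      intro F hF
      by_cases hx : x ∈ F
      · exact Eventually.of_forall fun _ _ => hx
      · filter_upwards [(hcl F hF).isOpen_compl.mem_nhds hx] with y hy hy'
        exact absurd hy' hy
    filter_upwards [h1] with y hy
    obtain ⟨F, hF, hyF⟩ := hcov y
    exact hL F hF y hyF x (hy F hF hyF)
  have hcont : Continuous z := by
    rw [continuous_iff_continuousAt]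
    intro x
    rw [ContinuousAt, tendsto_iff_dist_tendsto_zero]
    refine squeeze_zero' (Eventually.of_forall fun _ => dist_nonneg)
      (g := fun y => Λ * ‖y - x‖) (hloc x) ?_
    have : Continuous fun y => (Λ : ℝ) * ‖y - x‖ := by fun_prop
    simpa using this.tendsto x
  have key : ∀ x y, z y - z x ≤ Λ * ‖y - x‖ := by
    intro x y
    set γ : ℝ → E := fun t => x + t • (y - x) with hγ
    have hγc : Continuous γ := by fun_prop
    have h2 := image_le_of_liminf_slope_right_le_deriv_boundary (f := fun t => z (γ t))
      (a := 0) (b := 1) (B := fun t => z x + Λ * ‖y - x‖ * t) (B' := fun _ => Λ * ‖y - x‖)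
      (hcont.comp hγc).continuousOn (by simp [hγ]) (by fun_prop)
      (fun t _ => by
        have := ((hasDerivAt_id t).const_mul (Λ * ‖y - x‖)).const_add (z x)
        simpa using this.hasDerivWithinAt)
      (fun t _ r hr => by
        refine Eventually.frequently ?_
        have h3 : ∀ᶠ s in 𝓝[>] t, |z (γ s) - z (γ t)| ≤ Λ * ‖γ s - γ t‖ :=
          (hγc.continuousAt.eventually (hloc (γ t))).filter_mono nhdsWithin_le_nhds
        filter_upwards [h3, self_mem_nhdsWithin] with s hs hst
        rw [slope_def_field]
        have hst' : 0 < s - t := sub_pos.2 hst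
        refine lt_of_le_of_lt ?_ hr
        rw [div_le_iff₀ hst']
        have h4 : γ s - γ t = (s - t) • (y - x) := by
          simp only [hγ, sub_smul]; abel
        rw [h4, norm_smul, Real.norm_of_nonneg hst'.le] at hs
        linarith [le_abs_self (z (γ s) - z (γ t))])
      (x := 1) (by simp)
    simp only [hγ, one_smul, add_sub_cancel, mul_one] at h2
    linarith
  refine LipschitzWith.of_dist_le_mul fun x y => ?_
  rw [Real.dist_eq, abs_le, dist_eq_norm]
  have h1 := key x y
  have h2 := key y x
  rw [norm_sub_rev] at h1
  constructor <;> linarith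

namespace RefinementRule

variable {n : ℕ} {ι : Type u} {R : RefinementRule n ι}

-- The interpolant varies by at most `2 Λ δ` on the cell, because its vertex values are within `Λ δ`
-- of each other's base value and it is affine. Comparing with the inscribed ball of radius `δ / (4
-- * max ϱ 1)` bounds its slope by `8 * max ϱ 1 * Λ`.
variable (R) in
theorem exists_affine_interpolant (hn : 1 ≤ n) {ϱ : ℝ} (i : ι)
    (hϱ : shapeParameter (R.cell i) ≤ ϱ)
    {ψ : EuclideanSpace ℝ (Fin n) → ℝ} {Λ : ℝ} (hΛ : 0 ≤ Λ)
    (hψ : ∀ x ∈ R.cell i, ∀ y ∈ R.cell i, |ψ x - ψ y| ≤ Λ * ‖x - y‖) :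
    ∃ I : EuclideanSpace ℝ (Fin n) →ᵃ[ℝ] ℝ,
      (∀ k, I ((R.simplex i).points k) = ψ ((R.simplex i).points k)) ∧
      ∀ x y, |I x - I y| ≤ 8 * max ϱ 1 * Λ * ‖x - y‖ := by
  let B : AffineBasis (Fin (n + 1)) ℝ (EuclideanSpace ℝ (Fin n)) :=
    ⟨(R.simplex i).points, (R.simplex i).independent, R.affineSpan_points i⟩
  have hB : ∀ k, B k = (R.simplex i).points k := fun k => rfl
  let I : EuclideanSpace ℝ (Fin n) →ᵃ[ℝ] ℝ := ∑ k, ψ ((R.simplex i).points k) • B.coord k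
  have hI : ∀ k, I ((R.simplex i).points k) = ψ ((R.simplex i).points k) := by
    intro k
    rw [← hB k]
    have : ∀ x, I x = ∑ k, ψ ((R.simplex i).points k) * B.coord k x := by
      intro x
      let ev : (EuclideanSpace ℝ (Fin n) →ᵃ[ℝ] ℝ) →+ ℝ :=
        { toFun := fun f => f x, map_zero' := rfl, map_add' := fun _ _ => rfl }
      exact map_sum ev _ _
    rw [this]
    simp [AffineBasis.coord_apply]
    rfl
  refine ⟨I, hI, ?_⟩
  set δ := Metric.diam (R.cell i) with hδ
  have hδ0 : 0 < δ := R.diam_cell_pos hn i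
  have hmax : (0 : ℝ) < max ϱ 1 := lt_max_of_lt_right one_pos
  set v₀ := ψ ((R.simplex i).points 0) with hv₀
  have hsup : ∀ x ∈ R.cell i, I x ∈ Metric.closedBall v₀ (Λ * δ) := by
    have : R.cell i ⊆ I ⁻¹' Metric.closedBall v₀ (Λ * δ) := by
      refine convexHull_min ?_ ((convex_closedBall _ _).affine_preimage I)
      rintro _ ⟨k, rfl⟩
      rw [Set.mem_preimage, hI, Metric.mem_closedBall, Real.dist_eq]
      refine (hψ _ (R.points_mem_cell i k) _ (R.points_mem_cell i 0)).trans ?_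
      refine mul_le_mul_of_nonneg_left ?_ hΛ
      rw [← dist_eq_norm]
      exact Metric.dist_le_diam_of_mem (R.isBounded_cell i) (R.points_mem_cell i _)
        (R.points_mem_cell i _)
    exact this
  obtain ⟨x₁, hx₁⟩ := R.exists_closedBall_subset_cell i hϱ
  set r := δ / (4 * max ϱ 1) with hr
  have hr0 : 0 < r := by positivity
  have hlin : ∀ v, |I.linear v| ≤ 8 * max ϱ 1 * Λ * ‖v‖ := by
    intro v
    rcases eq_or_ne v 0 with rfl | hv
    · simp
    have hv0 : 0 < ‖v‖ := norm_pos_iff.2 hv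
    set t := r / ‖v‖ with ht
    have ht0 : 0 < t := by positivity
    have hy : x₁ + t • v ∈ R.cell i := hx₁ (by
      rw [mem_closedBall_iff_norm, add_sub_cancel_left, norm_smul, Real.norm_of_nonneg ht0.le, ht,
        div_mul_cancel₀ _ hv0.ne'])
    have hx : x₁ ∈ R.cell i := hx₁ (Metric.mem_closedBall_self hr0.le)
    have h1 := hsup _ hy
    have h2 := hsup _ hx
    rw [Metric.mem_closedBall, Real.dist_eq] at h1 h2
    have h3 : I (x₁ + t • v) = t * I.linear v + I x₁ := by
      have := I.map_vadd x₁ (t • v)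
      rw [vadd_eq_add, vadd_eq_add, map_smul, smul_eq_mul, add_comm] at this
      exact this
    have h4 : t * |I.linear v| ≤ 2 * (Λ * δ) := by
      rw [show t * |I.linear v| = |t * I.linear v| by rw [abs_mul, abs_of_pos ht0]]
      have : t * I.linear v = (I (x₁ + t • v) - v₀) - (I x₁ - v₀) := by rw [h3]; ring
      rw [this]
      exact (abs_sub _ _).trans (by linarith)
    have h5 : t = δ / (4 * max ϱ 1 * ‖v‖) := by rw [ht, hr, div_div]
    rw [h5, div_mul_eq_mul_div, div_le_iff₀ (by positivity)] at h4
    have h6 : δ * |I.linear v| ≤ δ * (8 * max ϱ 1 * Λ * ‖v‖) := by linarith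
    exact le_of_mul_le_mul_left h6 hδ0
  intro x y
  have : I x - I y = I.linear (x - y) := by
    rw [← vsub_eq_sub, ← vsub_eq_sub, AffineMap.linearMap_vsub]
  rw [this]
  exact hlin _

/-- Conformity is what makes the pieces fit: two local interpolants agree at common vertices, hence
on their convex hull, which is all that the cells share. A cell reaching beyond radius `r₁ + δ` has
all its vertices beyond `r₁`, so the support grows by at most `δ`. -/
theorem exists_conforming_interpolant (hn : 1 ≤ n) {ϱ : ℝ} {D : Finset ι}
    {A : Set (EuclideanSpace ℝ (Fin n))} (hD : R.Tiles D A)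
    (hϱ : ∀ L ∈ D, shapeParameter (R.cell L) ≤ ϱ)
    (hconf : ∀ L ∈ D, ∀ L' ∈ D, R.cell L ∩ R.cell L' = convexHull ℝ
      (Set.range (R.simplex L).points ∩ Set.range (R.simplex L').points))
    {δ : ℝ} (hδ : ∀ L ∈ D, Metric.diam (R.cell L) ≤ δ)
    {ψ : EuclideanSpace ℝ (Fin n) → ℝ} {Λ : ℝ} (hΛ : 0 ≤ Λ)
    (hψ : ∀ x ∈ A, ∀ y ∈ A, |ψ x - ψ y| ≤ Λ * ‖x - y‖)
    {x₀ : EuclideanSpace ℝ (Fin n)} {r₁ r₂ : ℝ} (hr : r₁ + δ ≤ r₂)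
    (hA : Metric.closedBall x₀ r₂ ⊆ A) (hψ0 : ∀ x, r₁ ≤ dist x x₀ → ψ x = 0) :
    ∃ z : EuclideanSpace ℝ (Fin n) → ℝ,
      LipschitzWith (8 * max ϱ 1 * Λ).toNNReal z ∧ (∀ x, r₁ + δ ≤ dist x x₀ → z x = 0) ∧
      (∀ L ∈ D, ∃ I : EuclideanSpace ℝ (Fin n) →ᵃ[ℝ] ℝ, ∀ x ∈ R.cell L, z x = I x) ∧
      ∀ x ∈ A, |z x - ψ x| ≤ (8 * max ϱ 1 + 1) * Λ * δ := by
  classical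
  have hmax : (0 : ℝ) < max ϱ 1 := lt_max_of_lt_right one_pos
  have hex : ∀ L, ∃ I : EuclideanSpace ℝ (Fin n) →ᵃ[ℝ] ℝ, L ∈ D →
      ((∀ k, I ((R.simplex L).points k) = ψ ((R.simplex L).points k)) ∧
      ∀ x y, |I x - I y| ≤ 8 * max ϱ 1 * Λ * ‖x - y‖) := by
    intro L
    by_cases hL : L ∈ D
    · obtain ⟨I, h1, h2⟩ := R.exists_affine_interpolant hn L (hϱ L hL) hΛ
        fun x hx y hy => hψ x (hD.cell_subset hL hx) y (hD.cell_subset hL hy)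
      exact ⟨I, fun _ => ⟨h1, h2⟩⟩
    · exact ⟨0, fun h => absurd h hL⟩
  choose I hI using hex
  have hglue : ∀ L ∈ D, ∀ L' ∈ D, ∀ x ∈ R.cell L, x ∈ R.cell L' → I L x = I L' x := by
    intro L hL L' hL' x hx hx'
    have hx2 : x ∈ R.cell L ∩ R.cell L' := ⟨hx, hx'⟩
    rw [hconf L hL L' hL'] at hx2
    have hsub : convexHull ℝ (Set.range (R.simplex L).points ∩ Set.range (R.simplex L').points) ⊆
        (I L - I L') ⁻¹' {0} := by
      refine convexHull_min ?_ ((convex_singleton (0 : ℝ)).affine_preimage (I L - I L'))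
      rintro _ ⟨⟨k, rfl⟩, ⟨k', hk'⟩⟩
      have e1 := (hI L hL).1 k
      have e2 := (hI L' hL').1 k'
      rw [hk'] at e2
      simp [e1, e2]
    have := hsub hx2
    simp only [Set.mem_preimage, Set.mem_singleton_iff, AffineMap.coe_sub, Pi.sub_apply] at this
    linarith
  set z : EuclideanSpace ℝ (Fin n) → ℝ := fun x =>
    if h : ∃ L ∈ D, x ∈ R.cell L then I h.choose x else 0 with hz
  have hzL : ∀ L ∈ D, ∀ x ∈ R.cell L, z x = I L x := by
    intro L hL x hx
    have h : ∃ L ∈ D, x ∈ R.cell L := ⟨L, hL, hx⟩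
    simp only [hz, dif_pos h]
    exact hglue _ h.choose_spec.1 L hL x h.choose_spec.2 hx
  have hcover : ∀ x ∈ A, ∃ L ∈ D, x ∈ R.cell L := by
    intro x hx
    rw [← hD.1] at hx
    simpa using hx
  have hz0 : ∀ x, r₁ + δ ≤ dist x x₀ → z x = 0 := by
    intro x hx
    by_cases h : ∃ L ∈ D, x ∈ R.cell L
    · obtain ⟨L, hL, hxL⟩ := h
      rw [hzL L hL x hxL]
      have hsub : R.cell L ⊆ I L ⁻¹' {0} := by
        refine convexHull_min ?_ ((convex_singleton (0 : ℝ)).affine_preimage (I L))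
        rintro _ ⟨k, rfl⟩
        rw [Set.mem_preimage, Set.mem_singleton_iff, (hI L hL).1]
        refine hψ0 _ ?_
        have h1 := Metric.dist_le_diam_of_mem (R.isBounded_cell L) hxL (R.points_mem_cell L k)
        have h2 := dist_triangle x ((R.simplex L).points k) x₀
        have h3 := hδ L hL
        linarith
      exact hsub hxL
    · simp only [hz, dif_neg h]
  refine ⟨z, ?_, hz0, fun L hL => ⟨I L, hzL L hL⟩, ?_⟩
  -- The cells cover `A` only; the closed outer region, on which `z` is zero, covers the rest since
  -- the ball of radius `r₂` lies in `A`.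
  · refine lipschitzWith_of_finite_closed_cover
      (S := insert {x | r₁ + δ ≤ dist x x₀} ((fun L => R.cell L) '' (D : Set ι)))
      ((D.finite_toSet.image _).insert _) ?_ ?_ ?_
    · rintro F (rfl | ⟨L, -, rfl⟩)
      · exact isClosed_le continuous_const (continuous_id.dist continuous_const)
      · exact R.isClosed_cell L
    · intro x
      by_cases hx : r₁ + δ ≤ dist x x₀
      · exact ⟨_, Set.mem_insert _ _, hx⟩
      · have hxA : x ∈ A := hA (Metric.mem_closedBall.2 ((not_le.1 hx).le.trans hr))
        obtain ⟨L, hL, hxL⟩ := hcover x hxA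
        exact ⟨_, Set.mem_insert_of_mem _ ⟨L, hL, rfl⟩, hxL⟩
    · rintro F (rfl | ⟨L, hL, rfl⟩) x hx y hy
      · rw [hz0 x hx, hz0 y hy, sub_self, abs_zero]
        positivity
      · rw [hzL L hL x hx, hzL L hL y hy, Real.coe_toNNReal _ (by positivity)]
        exact (hI L hL).2 x y
  · intro x hx
    obtain ⟨L, hL, hxL⟩ := hcover x hx
    have hp := R.points_mem_cell L 0
    have hd : ‖x - (R.simplex L).points 0‖ ≤ δ := by
      rw [← dist_eq_norm]
      exact (Metric.dist_le_diam_of_mem (R.isBounded_cell L) hxL hp).trans (hδ L hL)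
    have h1 := (hI L hL).2 x ((R.simplex L).points 0)
    have h2 := hψ x hx _ (hD.cell_subset hL hp)
    rw [hzL L hL x hxL]
    have h3 : I L x - ψ x = (I L x - I L ((R.simplex L).points 0)) -
        (ψ x - ψ ((R.simplex L).points 0)) := by rw [(hI L hL).1 0]; ring
    rw [h3]
    refine (abs_sub _ _).trans ((add_le_add h1 h2).trans ?_)
    have h4 : 8 * max ϱ 1 * Λ * ‖x - (R.simplex L).points 0‖ + Λ * ‖x - (R.simplex L).points 0‖ =
      (8 * max ϱ 1 + 1) * Λ * ‖x - (R.simplex L).points 0‖ := by ring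
    rw [h4]
    exact mul_le_mul_of_nonneg_left hd (by positivity)

end RefinementRule

end Interpolation


/-! ### Bubble functions that detect the streamline derivative -/

section Bubble

variable {n : ℕ}

theorem lineDeriv_eq_zero_of_eventually {z : EuclideanSpace ℝ (Fin n) → ℝ}
    {x b : EuclideanSpace ℝ (Fin n)} (h : z =ᶠ[𝓝 x] 0) : lineDeriv ℝ z x b = 0 := by
  have h1 : (fun t : ℝ => z (x + t • b)) =ᶠ[𝓝 0] fun _ => 0 := by
    have hc : Continuous fun t : ℝ => x + t • b := by fun_prop
    have := hc.tendsto 0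
    simp only [zero_smul, add_zero] at this
    exact this.eventually h
  rw [lineDeriv, h1.deriv_eq, deriv_const]

theorem lineDeriv_eq_zero_of_lt_dist {z : EuclideanSpace ℝ (Fin n) → ℝ}
    {x₀ b : EuclideanSpace ℝ (Fin n)} {r : ℝ} (hz : ∀ x, r ≤ dist x x₀ → z x = 0)
    {x : EuclideanSpace ℝ (Fin n)} (hx : r < dist x x₀) : lineDeriv ℝ z x b = 0 := by
  refine lineDeriv_eq_zero_of_eventually ?_
  have : ∀ᶠ y in 𝓝 x, r < dist y x₀ :=
    (continuous_id.dist continuous_const).continuousAt.eventually (lt_mem_nhds hx)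
  filter_upwards [this] with y hy using hz y hy.le

/-- The weak derivative of `z` is tested with `χ * p`, where the bump `χ` equals `1` on the ball
outside which `z` vanishes; thus `p` needs no compact support. -/
theorem setIntegral_mul_lineDeriv {z p : EuclideanSpace ℝ (Fin n) → ℝ} {C : NNReal}
    (hz : LipschitzWith C z) (hp : ContDiff ℝ ∞ p) (b : EuclideanSpace ℝ (Fin n))
    {x₀ : EuclideanSpace ℝ (Fin n)} {r r' : ℝ} (hr' : 0 < r') (hr : r' < r)
    (hz0 : ∀ x, r' ≤ dist x x₀ → z x = 0) {K : Set (EuclideanSpace ℝ (Fin n))}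
    (hK : Metric.closedBall x₀ r ⊆ K) :
    ∫ x in K, p x * lineDeriv ℝ z x b = -∫ x in K, fderiv ℝ p x b * z x := by
  let χ : ContDiffBump x₀ := { rIn := r', rOut := r, rIn_pos := hr', rIn_lt_rOut := hr }
  have hd0 : ∀ x, r' < dist x x₀ → lineDeriv ℝ z x b = 0 := fun x hx =>
    lineDeriv_eq_zero_of_lt_dist hz0 hx
  set φ : EuclideanSpace ℝ (Fin n) → ℝ := fun x => χ x * p x with hφ
  have hsm : ContDiff ℝ ∞ φ := χ.contDiff.mul hp
  have hcs : HasCompactSupport φ := χ.hasCompactSupport.mul_right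
  have hts : tsupport φ ⊆ Metric.ball x₀ (r + 1) := by
    refine (tsupport_mul_subset_left).trans ?_
    rw [χ.tsupport_eq]
    exact Metric.closedBall_subset_ball (by simp [χ])
  have h1 := (hz.hasWeakDirDeriv (b := b) (Metric.isBounded_ball (x := x₀) (r := r + 1))).2.2
    φ hsm hcs hts
  have e1 : ∀ x, z x * fderiv ℝ φ x b = fderiv ℝ p x b * z x := by
    intro x
    by_cases hx : r' ≤ dist x x₀
    · rw [hz0 x hx]; ring
    · have hev : φ =ᶠ[𝓝 x] p := by
        have : ∀ᶠ y in 𝓝 x, dist y x₀ < r' :=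
          (continuous_id.dist continuous_const).continuousAt.eventually (gt_mem_nhds (not_le.1 hx))
        filter_upwards [this] with y hy
        have : χ y = 1 := χ.one_of_mem_closedBall (Metric.mem_closedBall.2 hy.le)
        simp [hφ, this]
      rw [hev.fderiv_eq, mul_comm]
  have e2 : ∀ x, lineDeriv ℝ z x b * φ x = p x * lineDeriv ℝ z x b := by
    intro x
    by_cases hx : r' < dist x x₀
    · rw [hd0 x hx]; ring
    · have : χ x = 1 := χ.one_of_mem_closedBall (Metric.mem_closedBall.2 (not_lt.1 hx))
      simp only [hφ, this]; ring
  simp only [e1, e2] at h1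
  have hout : ∀ S : Set (EuclideanSpace ℝ (Fin n)), Metric.closedBall x₀ r ⊆ S →
      ∀ x ∉ S, r' < dist x x₀ := by
    intro S hS x hx
    by_contra hcon
    exact hx (hS (Metric.mem_closedBall.2 ((not_lt.1 hcon).trans hr.le)))
  have hb : Metric.closedBall x₀ r ⊆ Metric.ball x₀ (r + 1) :=
    Metric.closedBall_subset_ball (by simp)
  rw [setIntegral_eq_integral_of_forall_compl_eq_zero fun x hx => by
      rw [hz0 x (hout _ hb x hx).le, mul_zero],
    setIntegral_eq_integral_of_forall_compl_eq_zero fun x hx => by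
      rw [hd0 x (hout _ hb x hx), mul_zero]] at h1
  rw [setIntegral_eq_integral_of_forall_compl_eq_zero fun x hx => by
      rw [hd0 x (hout _ hK x hx), mul_zero],
    setIntegral_eq_integral_of_forall_compl_eq_zero fun x hx => by
      rw [hz0 x (hout _ hK x hx).le, mul_zero]]
  linarith

/-- The relative radius of balls that are contained in simplices with shape parameter at most
`ϱ`. -/
def innerRadius (ϱ : ℝ) : ℝ := 1 / (4 * max ϱ 1)

theorem innerRadius_pos (ϱ : ℝ) : 0 < innerRadius ϱ := by
  have : (0 : ℝ) < max ϱ 1 := lt_max_of_lt_right one_pos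
  unfold innerRadius; positivity

theorem innerRadius_le (ϱ : ℝ) : innerRadius ϱ ≤ 1 / 4 := by
  have : (1 : ℝ) ≤ max ϱ 1 := le_max_right _ _
  unfold innerRadius
  rw [div_le_div_iff₀ (by positivity) (by norm_num)]
  linarith

/-- A Lipschitz cut-off function that equals one for `dist x x₀ ≤ r / 2` and that vanishes for
`dist x x₀ ≥ 3 r / 4`. -/
def cutoff (x₀ : EuclideanSpace ℝ (Fin n)) (r : ℝ) (x : EuclideanSpace ℝ (Fin n)) : ℝ :=
  max 0 (min 1 (3 - 4 / r * dist x x₀))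

theorem cutoff_nonneg (x₀ : EuclideanSpace ℝ (Fin n)) (r : ℝ) (x : EuclideanSpace ℝ (Fin n)) :
    0 ≤ cutoff x₀ r x := le_max_left _ _

theorem cutoff_le_one (x₀ : EuclideanSpace ℝ (Fin n)) (r : ℝ) (x : EuclideanSpace ℝ (Fin n)) :
    cutoff x₀ r x ≤ 1 := max_le zero_le_one (min_le_left _ _)

theorem cutoff_eq_one {x₀ : EuclideanSpace ℝ (Fin n)} {r : ℝ} (hr : 0 < r)
    {x : EuclideanSpace ℝ (Fin n)} (hx : dist x x₀ ≤ r / 2) : cutoff x₀ r x = 1 := by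
  have : 4 / r * dist x x₀ ≤ 2 := by
    rw [div_mul_eq_mul_div, div_le_iff₀ hr]; linarith
  rw [cutoff, min_eq_left (by linarith), max_eq_right zero_le_one]

theorem cutoff_eq_zero {x₀ : EuclideanSpace ℝ (Fin n)} {r : ℝ} (hr : 0 < r)
    {x : EuclideanSpace ℝ (Fin n)} (hx : 3 / 4 * r ≤ dist x x₀) : cutoff x₀ r x = 0 := by
  have : 3 ≤ 4 / r * dist x x₀ := by
    rw [div_mul_eq_mul_div, le_div_iff₀ hr]; linarith
  exact max_eq_left ((min_le_right _ _).trans (by linarith))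

theorem continuous_cutoff (x₀ : EuclideanSpace ℝ (Fin n)) (r : ℝ) : Continuous (cutoff x₀ r) := by
  unfold cutoff; fun_prop

theorem abs_cutoff_sub_le (x₀ : EuclideanSpace ℝ (Fin n)) {r : ℝ} (hr : 0 < r)
    (x y : EuclideanSpace ℝ (Fin n)) :
    |cutoff x₀ r x - cutoff x₀ r y| ≤ 4 / r * ‖x - y‖ := by
  unfold cutoff
  rw [max_comm 0, max_comm 0, min_comm 1, min_comm 1]
  refine (abs_max_sub_max_le_abs _ _ _).trans ((abs_min_sub_min_le_max _ _ _ _).trans ?_)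
  rw [sub_self, abs_zero, max_eq_left (abs_nonneg _), sub_sub_sub_cancel_left, ← mul_sub, abs_mul,
    abs_of_pos (by positivity : 0 < 4 / r), ← dist_eq_norm]
  refine mul_le_mul_of_nonneg_left ?_ (by positivity)
  rw [abs_sub_comm]
  exact abs_dist_sub_le x y x₀

namespace RefinementRule

/-- The ideal choice is `ψ = -h² χ ∂_b p`: integration by parts gives `h² ∫ χ (∂_b p)²`, at least `h
^ (n + 2) * a ^ 2`. Its nodal interpolant on a sufficiently fine conforming partition loses at most
half of this. The bound on `z` has one more power of `h` than its Lipschitz constant, which is what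
small meshes exploit. -/
theorem exists_bubble (hn : 1 ≤ n) (m : ℕ) (b : EuclideanSpace ℝ (Fin n)) (ϱ : ℝ) :
    ∃ C₁ : ℝ, 0 < C₁ ∧ ∃ θ₀ : ℝ, 0 < θ₀ ∧ ∀ (ι : Type u) (R : RefinementRule n ι) (K : ι)
      (D : Finset ι), R.Tiles D (R.cell K) → (∀ L ∈ D, shapeParameter (R.cell L) ≤ ϱ) →
      (∀ L ∈ D, ∀ L' ∈ D, R.cell L ∩ R.cell L' = convexHull ℝ
        (Set.range (R.simplex L).points ∩ Set.range (R.simplex L').points)) →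
      (∀ L ∈ D, Metric.diam (R.cell L) ≤ θ₀ * Metric.diam (R.cell K)) →
      ∀ p ∈ polyFun n m, ∀ x₀,
      Metric.closedBall x₀ (innerRadius ϱ * Metric.diam (R.cell K)) ⊆ R.cell K →
      ∀ a, a = ballNorm (innerRadius ϱ / 2) x₀ (Metric.diam (R.cell K))
        (fun x => fderiv ℝ p x b) →
      ∃ z : EuclideanSpace ℝ (Fin n) → ℝ,
        LipschitzWith (C₁ * Metric.diam (R.cell K) * a).toNNReal z ∧
        (∀ x, 7 / 8 * (innerRadius ϱ * Metric.diam (R.cell K)) ≤ dist x x₀ → z x = 0) ∧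
        (∀ L ∈ D, ∃ I : EuclideanSpace ℝ (Fin n) →ᵃ[ℝ] ℝ, ∀ x ∈ R.cell L, z x = I x) ∧
        (∀ x, |z x| ≤ C₁ * Metric.diam (R.cell K) ^ 2 * a) ∧
        Metric.diam (R.cell K) ^ (n + 2) * a ^ 2 / 2 ≤
          ∫ x in R.cell K, p x * lineDeriv ℝ z x b := by
  have hρ := innerRadius_pos ϱ
  have hρ4 := innerRadius_le ϱ
  set ρ := innerRadius ϱ with hρdef
  obtain ⟨C, hC, hbound⟩ := exists_ballNorm_bound n m (half_pos hρ)
  have hmax : (1 : ℝ) ≤ max ϱ 1 := le_max_right _ _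
  set P := 8 * max ϱ 1 with hP
  have hP0 : 0 < P := by positivity
  set c₁ := C * (4 / ρ + 1) with hc₁
  have hc₁0 : 0 < c₁ := by positivity
  have hκ := unitBallVolume_nonneg (n := n)
  set κ := unitBallVolume n with hκdef
  set G := κ * C * ((P + 1) * c₁) with hG
  have hG0 : 0 ≤ G := by positivity
  -- The first entry keeps the support within `3/4 + 1/8 = 7/8` of the inner radius; the second
  -- makes the interpolation error cost at most half of the main term.
  set θ₀ := min (ρ / 8) (1 / (2 * (G + 1))) with hθ₀
  have hθ0 : 0 < θ₀ := lt_min (by positivity) (by positivity)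
  have hθ1 : θ₀ ≤ 1 := (min_le_left _ _).trans (by linarith)
  have hθG : G * θ₀ ≤ 1 / 2 := by
    have h1 : θ₀ ≤ 1 / (2 * (G + 1)) := min_le_right _ _
    have h2 : G * θ₀ ≤ G * (1 / (2 * (G + 1))) := mul_le_mul_of_nonneg_left h1 hG0
    refine h2.trans ?_
    rw [mul_one_div, div_le_div_iff₀ (by positivity) (by norm_num)]
    linarith
  set C₁ := P * c₁ + C + (P + 1) * c₁ with hC₁
  have hC₁0 : 0 < C₁ := by positivity
  refine ⟨C₁, hC₁0, θ₀, hθ0, fun ι R K D hD hsh hconf hdiam p hp x₀ hball a ha => ?_⟩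
  have hh : 0 < Metric.diam (R.cell K) := R.diam_cell_pos hn K
  set h := Metric.diam (R.cell K) with hhdef
  set q : EuclideanSpace ℝ (Fin n) → ℝ := fun x => fderiv ℝ p x b with hq
  have hqm : q ∈ polyFun n m := fderiv_apply_mem_polyFun hp b
  have hqc : Continuous q := continuous_of_mem_polyFun hqm
  have ha0 : 0 ≤ a := ha ▸ ballNorm_nonneg _ _ _ _
  obtain ⟨hq1, hq2⟩ := hbound q hqm x₀ h hh
  rw [← ha] at hq1 hq2
  have hx₀K : x₀ ∈ R.cell K := hball (Metric.mem_closedBall_self (by positivity))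
  have hKball : R.cell K ⊆ Metric.closedBall x₀ h := fun x hx =>
    Metric.mem_closedBall.2 (Metric.dist_le_diam_of_mem (R.isBounded_cell K) hx hx₀K)
  have hρh : 0 < ρ * h := by positivity
  set χ := cutoff x₀ (ρ * h) with hχ
  set ψ : EuclideanSpace ℝ (Fin n) → ℝ := fun x => -(h ^ 2 * (χ x * q x)) with hψ
  have hψc : Continuous ψ := ((continuous_cutoff x₀ _).mul hqc).const_mul (h ^ 2) |>.neg
  set Λ := c₁ * h * a with hΛ
  have hΛ0 : 0 ≤ Λ := by positivity
  have hψL : ∀ x ∈ R.cell K, ∀ y ∈ R.cell K, |ψ x - ψ y| ≤ Λ * ‖x - y‖ := by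
    intro x hx y hy
    have h1 : ψ x - ψ y = -(h ^ 2 * ((χ x - χ y) * q x + χ y * (q x - q y))) := by
      simp only [hψ]; ring
    rw [h1, abs_neg, abs_mul, abs_of_nonneg (by positivity : 0 ≤ h ^ 2)]
    have h2 : |(χ x - χ y) * q x| ≤ 4 / (ρ * h) * ‖x - y‖ * (C * a) := by
      rw [abs_mul]
      exact mul_le_mul (abs_cutoff_sub_le x₀ hρh x y) (hq1 x (hKball hx)) (abs_nonneg _)
        (by positivity)
    have h3 : |χ y * (q x - q y)| ≤ 1 * (C * a * (‖x - y‖ / h)) := by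
      rw [abs_mul, abs_of_nonneg (cutoff_nonneg _ _ _)]
      exact mul_le_mul (cutoff_le_one _ _ _) (hq2 x (hKball hx) y (hKball hy)) (abs_nonneg _)
        zero_le_one
    calc h ^ 2 * |(χ x - χ y) * q x + χ y * (q x - q y)|
        ≤ h ^ 2 * (4 / (ρ * h) * ‖x - y‖ * (C * a) + 1 * (C * a * (‖x - y‖ / h))) :=
          mul_le_mul_of_nonneg_left ((abs_add_le _ _).trans (add_le_add h2 h3)) (by positivity)
      _ = Λ * ‖x - y‖ := by
          simp only [hΛ, hc₁]; field_simp
  have hψ0 : ∀ x, 3 / 4 * (ρ * h) ≤ dist x x₀ → ψ x = 0 := by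
    intro x hx
    simp only [hψ, hχ, cutoff_eq_zero hρh hx]; ring
  have hθρ : θ₀ * h ≤ ρ * h / 8 := by
    have : θ₀ ≤ ρ / 8 := min_le_left _ _
    nlinarith
  obtain ⟨z, hzL, hz0, hzI, hzψ⟩ := exists_conforming_interpolant hn hD hsh hconf hdiam hΛ0 hψL
    (r₁ := 3 / 4 * (ρ * h)) (r₂ := ρ * h) (by linarith) hball hψ0
  have hz0' : ∀ x, 7 / 8 * (ρ * h) ≤ dist x x₀ → z x = 0 := fun x hx => hz0 x (by linarith)
  have hψabs : ∀ x ∈ R.cell K, |ψ x| ≤ C * h ^ 2 * a := by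
    intro x hx
    simp only [hψ]
    rw [abs_neg, abs_mul, abs_mul, abs_of_nonneg (by positivity : 0 ≤ h ^ 2),
      abs_of_nonneg (cutoff_nonneg _ _ _)]
    have h1 : χ x * |q x| ≤ 1 * (C * a) :=
      mul_le_mul (cutoff_le_one _ _ _) (hq1 x (hKball hx)) (abs_nonneg _) zero_le_one
    nlinarith [sq_nonneg h]
  have hzψ' : ∀ x ∈ R.cell K, |z x - ψ x| ≤ (P + 1) * c₁ * θ₀ * h ^ 2 * a := by
    intro x hx
    refine (hzψ x hx).trans_eq ?_
    simp only [hΛ]; ring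
  refine ⟨z, hzL.weaken (Real.toNNReal_le_toNNReal ?_), hz0', hzI, fun x => ?_, ?_⟩
  · have : P * Λ = P * c₁ * (h * a) := by simp only [hΛ]; ring
    rw [this, mul_assoc C₁]
    refine mul_le_mul_of_nonneg_right ?_ (by positivity)
    have : 0 < (P + 1) * c₁ := by positivity
    simp only [hC₁]; linarith
  · by_cases hx : x ∈ R.cell K
    · have h1 := hψabs x hx
      have h2 := hzψ' x hx
      have h3 : |z x| ≤ |z x - ψ x| + |ψ x| := by
        have := abs_add_le (z x - ψ x) (ψ x)
        rwa [sub_add_cancel] at this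
      refine h3.trans ((add_le_add h2 h1).trans ?_)
      have h4 : (P + 1) * c₁ * θ₀ * h ^ 2 * a ≤ (P + 1) * c₁ * 1 * h ^ 2 * a := by gcongr
      have h5 : 0 ≤ P * c₁ * h ^ 2 * a := by positivity
      simp only [hC₁]
      nlinarith
    · rw [hz0' x, abs_zero]
      · positivity
      · by_contra hcon
        refine hx (hball (Metric.mem_closedBall.2 ?_))
        linarith [not_le.1 hcon]
  · rw [setIntegral_mul_lineDeriv hzL (contDiff_of_mem_polyFun hp) b
      (by positivity : 0 < 7 / 8 * (ρ * h)) (by linarith) hz0' hball]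
    have hzc := hzL.continuous
    have hbd := R.isBounded_cell K
    have hint : ∀ f : EuclideanSpace ℝ (Fin n) → ℝ, Continuous f → IntegrableOn f (R.cell K) :=
      fun f hf => memLp_one_iff_integrable.1 (memLp_restrict_of_continuous hbd 1 hf)
    -- The part with `ψ` is the main term, the part with `z - ψ` the interpolation error.
    have hsplit : ∫ x in R.cell K, q x * z x =
        (∫ x in R.cell K, q x * (z x - ψ x)) - h ^ 2 * ∫ x in R.cell K, χ x * q x ^ 2 := by
      have i1 : IntegrableOn (fun x => q x * (z x - ψ x)) (R.cell K) :=
        hint _ (hqc.mul (hzc.sub hψc))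
      have i2 : IntegrableOn (fun x => h ^ 2 * (χ x * q x ^ 2)) (R.cell K) :=
        hint _ (((continuous_cutoff x₀ _).mul (hqc.pow 2)).const_mul _)
      rw [← integral_const_mul, ← integral_sub i1 i2]
      refine integral_congr_ae (ae_of_all _ fun x => ?_)
      simp only [hψ]; ring
    have hmain : h ^ n * a ^ 2 ≤ ∫ x in R.cell K, χ x * q x ^ 2 := by
      rw [ha, pow_mul_ballNorm_sq _ _ hh]
      have hsub : Metric.ball x₀ (ρ / 2 * h) ⊆ R.cell K :=
        (Metric.ball_subset_closedBall).trans ((Metric.closedBall_subset_closedBall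
          (by linarith)).trans hball)
      calc ∫ x in Metric.ball x₀ (ρ / 2 * h), q x ^ 2
          = ∫ x in Metric.ball x₀ (ρ / 2 * h), χ x * q x ^ 2 := by
            refine setIntegral_congr_fun Metric.isOpen_ball.measurableSet fun x hx => ?_
            have : χ x = 1 := cutoff_eq_one hρh (by linarith [Metric.mem_ball.1 hx])
            simp only [this, one_mul]
        _ ≤ _ := setIntegral_mono_set (hint _ ((continuous_cutoff x₀ _).mul (hqc.pow 2)))
            (ae_of_all _ fun x => mul_nonneg (cutoff_nonneg _ _ _) (sq_nonneg _))
            hsub.eventuallyLE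
    have herr : |∫ x in R.cell K, q x * (z x - ψ x)| ≤
        κ * h ^ n * (C * a * ((P + 1) * c₁ * θ₀ * h ^ 2 * a)) := by
      refine setIntegral_le_of_abs_le hh.le hKball (by positivity) ?_
      filter_upwards [ae_restrict_mem (R.measurableSet_cell K)] with x hx
      rw [abs_mul]
      exact mul_le_mul (hq1 x (hKball hx)) (hzψ' x hx) (abs_nonneg _) (by positivity)
    have herr2 : κ * h ^ n * (C * a * ((P + 1) * c₁ * θ₀ * h ^ 2 * a)) =
        (G * θ₀) * (h ^ (n + 2) * a ^ 2) := by
      simp only [hG]; ring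
    rw [herr2] at herr
    have hD0 : 0 ≤ h ^ (n + 2) * a ^ 2 := by positivity
    have h7 : (G * θ₀) * (h ^ (n + 2) * a ^ 2) ≤ 1 / 2 * (h ^ (n + 2) * a ^ 2) :=
      mul_le_mul_of_nonneg_right hθG hD0
    have h8 : h ^ (n + 2) * a ^ 2 ≤ h ^ 2 * ∫ x in R.cell K, χ x * q x ^ 2 := by
      have := mul_le_mul_of_nonneg_left hmain (by positivity : 0 ≤ h ^ 2)
      refine le_trans (le_of_eq ?_) this
      ring
    have h9 := (abs_le.1 herr).2
    rw [hsplit]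
    linarith

end RefinementRule

end Bubble


/-! ### Cauchy–Schwarz and Minkowski inequalities for square integrals -/

section SquareIntegrable

variable {α : Type*} [MeasurableSpace α] {μ : Measure α} {f g : α → ℝ}

theorem integral_add_const_mul_sq (hf : MemLp f 2 μ) (hg : MemLp g 2 μ) (t : ℝ) :
    ∫ x, (f x + t * g x) ^ 2 ∂μ =
      (∫ x, f x ^ 2 ∂μ) + 2 * t * (∫ x, f x * g x ∂μ) + t ^ 2 * ∫ x, g x ^ 2 ∂μ := by
  have hfg : Integrable (fun x => f x * g x) μ := hf.integrable_mul hg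
  have i1 : Integrable (fun x => f x ^ 2 + 2 * t * (f x * g x)) μ :=
    hf.integrable_sq.add (hfg.const_mul _)
  have i2 : Integrable (fun x => t ^ 2 * g x ^ 2) μ := hg.integrable_sq.const_mul _
  rw [← integral_const_mul, ← integral_const_mul,
    ← integral_add hf.integrable_sq (hfg.const_mul _), ← integral_add i1 i2]
  exact integral_congr_ae (ae_of_all _ fun x => by ring)

theorem abs_integral_mul_le (hf : MemLp f 2 μ) (hg : MemLp g 2 μ) :
    |∫ x, f x * g x ∂μ| ≤ √(∫ x, f x ^ 2 ∂μ) * √(∫ x, g x ^ 2 ∂μ) := by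
  have hquad : ∀ t : ℝ, 0 ≤ (∫ x, g x ^ 2 ∂μ) * (t * t) + (2 * ∫ x, f x * g x ∂μ) * t +
      ∫ x, f x ^ 2 ∂μ := by
    intro t
    have h1 : 0 ≤ ∫ x, (f x + t * g x) ^ 2 ∂μ := integral_nonneg fun x => sq_nonneg _
    rw [integral_add_const_mul_sq hf hg] at h1
    linarith
  have hd := discrim_le_zero hquad
  rw [discrim] at hd
  rw [← Real.sqrt_mul (integral_nonneg fun x => sq_nonneg _)]
  refine Real.abs_le_sqrt ?_
  nlinarith

theorem sqrt_integral_add_sq_le (hf : MemLp f 2 μ) (hg : MemLp g 2 μ) :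
    √(∫ x, (f x + g x) ^ 2 ∂μ) ≤ √(∫ x, f x ^ 2 ∂μ) + √(∫ x, g x ^ 2 ∂μ) := by
  refine Real.sqrt_le_iff.2 ⟨by positivity, ?_⟩
  have h1 := integral_add_const_mul_sq hf hg 1
  simp only [one_mul, mul_one, one_pow] at h1
  rw [h1, add_sq, Real.sq_sqrt (integral_nonneg fun x => sq_nonneg _),
    Real.sq_sqrt (integral_nonneg fun x => sq_nonneg _)]
  linarith [(le_abs_self _).trans (abs_integral_mul_le hf hg)]

theorem sqrt_integral_sub_sq_le (hf : MemLp f 2 μ) (hg : MemLp g 2 μ) :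
    √(∫ x, (f x - g x) ^ 2 ∂μ) ≤ √(∫ x, f x ^ 2 ∂μ) + √(∫ x, g x ^ 2 ∂μ) := by
  have := sqrt_integral_add_sq_le hf hg.neg
  simpa only [Pi.neg_apply, ← sub_eq_add_neg, neg_sq] using this

theorem sqrt_integral_mul_sq_le {c : α → ℝ} {γ : ℝ} (hγ : 0 ≤ γ) (hc : ∀ᵐ x ∂μ, |c x| ≤ γ)
    (hf : MemLp f 2 μ) : √(∫ x, (c x * f x) ^ 2 ∂μ) ≤ γ * √(∫ x, f x ^ 2 ∂μ) := by
  rw [← Real.sqrt_sq hγ, ← Real.sqrt_mul (sq_nonneg γ), ← integral_const_mul]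
  refine Real.sqrt_le_sqrt ?_
  refine integral_mono_of_nonneg (ae_of_all _ fun x => sq_nonneg _)
    (hf.integrable_sq.const_mul _) ?_
  filter_upwards [hc] with x hx
  simp only [mul_pow]
  refine mul_le_mul_of_nonneg_right ?_ (sq_nonneg _)
  rw [← sq_abs (c x)]
  exact pow_le_pow_left₀ (abs_nonneg _) hx 2

end SquareIntegrable

/-! ### Weak derivatives of smooth functions and of finite sums -/

section SmoothWeakDerivative

variable {n : ℕ}

theorem ContDiff.hasWeakDirDeriv {Ω : Set (EuclideanSpace ℝ (Fin n))}
    {b : EuclideanSpace ℝ (Fin n)} (hΩ : Bornology.IsBounded Ω)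
    {q : EuclideanSpace ℝ (Fin n) → ℝ} (hq : ContDiff ℝ ∞ q) :
    HasWeakDirDeriv Ω b q (fun x => fderiv ℝ q x b) := by
  refine ⟨memLp_restrict_of_continuous hΩ 2 hq.continuous, memLp_fderiv_apply 2 hΩ hq,
    fun φ hφ hc hs => ?_⟩
  have h0 : ∀ x, x ∉ tsupport φ → φ x = 0 := fun x hx => image_eq_zero_of_notMem_tsupport hx
  have h1 : ∀ x, x ∉ tsupport φ → fderiv ℝ φ x b = 0 := fun x hx => by
    rw [image_eq_zero_of_notMem_tsupport fun hx' => hx (tsupport_fderiv_subset ℝ hx')]; simp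
  rw [setIntegral_eq_integral_of_forall_compl_eq_zero fun x hx => by
      rw [h1 x fun hx' => hx (hs hx'), mul_zero],
    setIntegral_eq_integral_of_forall_compl_eq_zero fun x hx => by
      rw [h0 x fun hx' => hx (hs hx'), mul_zero]]
  have c1 : Continuous fun x => fderiv ℝ q x b :=
    (hq.continuous_fderiv (by simp)).clm_apply continuous_const
  have c2 : Continuous fun x => fderiv ℝ φ x b :=
    (hφ.continuous_fderiv (by simp)).clm_apply continuous_const
  have hc2 : HasCompactSupport fun x => fderiv ℝ φ x b := hc.fderiv_apply ℝ b
  exact integral_mul_fderiv_eq_neg_fderiv_mul_of_integrable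
    ((c1.mul hφ.continuous).integrable_of_hasCompactSupport hc.mul_left)
    ((hq.continuous.mul c2).integrable_of_hasCompactSupport hc2.mul_left)
    ((hq.continuous.mul hφ.continuous).integrable_of_hasCompactSupport hc.mul_left)
    (fun x _ => hq.differentiable (by simp) x) (fun x _ => hφ.differentiable (by simp) x)

theorem hasWeakDirDeriv_sum {Ω : Set (EuclideanSpace ℝ (Fin n))} {b : EuclideanSpace ℝ (Fin n)}
    (hΩ : Bornology.IsBounded Ω) {κ : Type*} (S : Finset κ)
    {z d : κ → EuclideanSpace ℝ (Fin n) → ℝ}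
    (h : ∀ K ∈ S, HasWeakDirDeriv Ω b (z K) (d K)) :
    HasWeakDirDeriv Ω b (fun x => ∑ K ∈ S, z K x) (fun x => ∑ K ∈ S, d K x) := by
  classical
  induction S using Finset.induction_on with
  | empty =>
    simp only [Finset.sum_empty]
    exact ⟨MemLp.zero, MemLp.zero, fun φ _ _ _ => by simp⟩
  | insert K S hK ih =>
    simp only [Finset.sum_insert hK]
    exact (h K (Finset.mem_insert_self _ _)).add hΩ
      (ih fun L hL => h L (Finset.mem_insert_of_mem hL))

theorem memHZeroInflow_sum {Ω : Set (EuclideanSpace ℝ (Fin n))} {b : EuclideanSpace ℝ (Fin n)}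
    (hΩ : Bornology.IsBounded Ω) {κ : Type*} (S : Finset κ)
    {z : κ → EuclideanSpace ℝ (Fin n) → ℝ} (h : ∀ K ∈ S, MemHZeroInflow Ω b (z K)) :
    MemHZeroInflow Ω b (fun x => ∑ K ∈ S, z K x) := by
  classical
  induction S using Finset.induction_on with
  | empty => simp only [Finset.sum_empty]; exact memHZeroInflow_zero
  | insert K S hK ih =>
    simp only [Finset.sum_insert hK]
    have := (h K (Finset.mem_insert_self _ _)).add_const_mul hΩ 1
      (ih fun L hL => h L (Finset.mem_insert_of_mem hL))
    simpa only [one_mul] using this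

end SmoothWeakDerivative

namespace RefinementRule

variable {n : ℕ} {ι : Type u} {R : RefinementRule n ι}
  {Ω A : Set (EuclideanSpace ℝ (Fin n))} {b : EuclideanSpace ℝ (Fin n)}
  {c : EuclideanSpace ℝ (Fin n) → ℝ} {T T' : Finset ι} {m : ℕ}

/-! ### Piecewise polynomials on tilings -/

section PiecewisePolynomial

theorem piecewisePolynomial_iff {v : EuclideanSpace ℝ (Fin n) → ℝ} :
    R.PiecewisePolynomial T m v ↔
      ∀ K ∈ T, ∃ q ∈ polyFun n m, ∀ x ∈ interior (R.cell K), v x = q x := by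
  refine forall₂_congr fun K _ => ?_
  constructor
  · rintro ⟨p, hp, hpv⟩
    exact ⟨fun x => MvPolynomial.eval (fun i => x i) p, mem_polyFun.2 ⟨p, hp, fun x => rfl⟩, hpv⟩
  · rintro ⟨q, hq, hqv⟩
    obtain ⟨p, hp, hpq⟩ := mem_polyFun.1 hq
    exact ⟨p, hp, fun x hx => (hqv x hx).trans (hpq x)⟩

theorem Tiles.isBounded_interior (h : R.Tiles T A) : Bornology.IsBounded (interior A) :=
  h.isCompact.isBounded.subset interior_subset

theorem Tiles.memLp (h : R.Tiles T A) {v : EuclideanSpace ℝ (Fin n) → ℝ} {p : ENNReal}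
    {q : ι → EuclideanSpace ℝ (Fin n) → ℝ} (hq : ∀ K ∈ T, Continuous (q K))
    (hv : ∀ K ∈ T, v =ᵐ[volume.restrict (R.cell K)] q K) :
    MemLp v p (volume.restrict (interior A)) := by
  have h1 : MemLp (fun x => ∑ K ∈ T, (interior (R.cell K)).indicator (q K) x) p
      (volume.restrict (interior A)) :=
    memLp_finsetSum _ fun K hK => (memLp_restrict_of_continuous h.isBounded_interior p
      (hq K hK)).indicator isOpen_interior.measurableSet
  refine h1.ae_eq ?_
  have h2 : ∀ᵐ x ∂(volume.restrict (interior A)), ∀ K ∈ T, x ∈ interior (R.cell K) →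
      v x = q K x := by
    rw [Filter.eventually_all_finset]
    intro K hK
    have h3 := hv K hK
    rw [R.restrict_cell, Filter.EventuallyEq, ae_restrict_iff' isOpen_interior.measurableSet] at h3
    exact ae_restrict_of_ae h3
  filter_upwards [h2, h.ae_exists] with x hx hx'
  obtain ⟨K, hK, hxK⟩ := hx'
  rw [hx K hK hxK, Finset.sum_eq_single_of_mem K hK fun L hL hLK =>
    Set.indicator_of_notMem (fun hxL => hLK (h.eq_of_mem hL hK hxL hxK)) _,
    Set.indicator_of_mem hxK]

theorem ae_restrict_cell_of_interior {v q : EuclideanSpace ℝ (Fin n) → ℝ} {K : ι}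
    (h : ∀ x ∈ interior (R.cell K), v x = q x) : v =ᵐ[volume.restrict (R.cell K)] q := by
  filter_upwards [R.ae_mem_interior_cell K] with x hx using h x hx

theorem PiecewisePolynomial.memLp {v : EuclideanSpace ℝ (Fin n) → ℝ}
    (hv : R.PiecewisePolynomial T m v) (h : R.Tiles T A) (p : ENNReal) :
    MemLp v p (volume.restrict (interior A)) := by
  have hv' := piecewisePolynomial_iff.1 hv
  choose! q hq hqv using hv'
  exact h.memLp (fun K hK => continuous_of_mem_polyFun (hq K hK)) fun K hK =>
    ae_restrict_cell_of_interior (hqv K hK)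

theorem PiecewisePolynomial.add_const_mul {v v' : EuclideanSpace ℝ (Fin n) → ℝ}
    (hv : R.PiecewisePolynomial T m v) (hv' : R.PiecewisePolynomial T m v') (t : ℝ) :
    R.PiecewisePolynomial T m (fun x => v x + t * v' x) := by
  rw [piecewisePolynomial_iff] at *
  intro K hK
  obtain ⟨q, hq, hqv⟩ := hv K hK
  obtain ⟨q', hq', hqv'⟩ := hv' K hK
  exact ⟨q + t • q', Submodule.add_mem _ hq (Submodule.smul_mem _ _ hq'), fun x hx => by
    simp [hqv x hx, hqv' x hx]⟩

theorem piecewisePolynomial_zero : R.PiecewisePolynomial T m 0 := fun K _ =>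
  ⟨0, by simp, fun x _ => by simp⟩

/-- Each cell of `T'` is contained in a cell of `T`. -/
def IsFiner (R : RefinementRule n ι) (T T' : Finset ι) : Prop :=
  ∀ L ∈ T', ∃ K ∈ T, R.cell L ⊆ R.cell K

theorem PiecewisePolynomial.of_isFiner {v : EuclideanSpace ℝ (Fin n) → ℝ}
    (hv : R.PiecewisePolynomial T m v) (h : R.IsFiner T T') : R.PiecewisePolynomial T' m v := by
  intro L hL
  obtain ⟨K, hK, hLK⟩ := h L hL
  obtain ⟨p, hp, hpv⟩ := hv K hK
  exact ⟨p, hp, fun x hx => hpv x (interior_mono hLK hx)⟩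

theorem isFiner_refinement (b : EuclideanSpace ℝ (Fin n)) (T M : Finset ι) (r : ℕ) :
    R.IsFiner T (R.refinement b T M r) := by
  intro L hL
  obtain ⟨K, hK, ⟨-, h⟩ | ⟨-, h⟩⟩ := mem_refinement.1 hL
  · exact ⟨K, hK, (tiles_descendants r K).cell_subset h⟩
  · exact ⟨K, hK, h ▸ subset_rfl⟩

theorem isFiner_of_isMesh {T₀ : Finset ι} (hT : R.IsMesh T₀ T) : R.IsFiner T₀ T :=
  fun _ hK => exists_mem_of_isMesh hT hK

theorem MemTrial.of_isFiner {mu mw : ℕ} {u w : EuclideanSpace ℝ (Fin n) → ℝ}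
    (h : R.MemTrial Ω b mu mw T u w) (hf : R.IsFiner T T') : R.MemTrial Ω b mu mw T' u w :=
  ⟨h.1.of_isFiner hf, h.2.1.of_isFiner hf, h.2.2⟩

theorem PiecewisePolynomial.exists_const (hc : R.PiecewisePolynomial T 0 c) {K : ι} (hK : K ∈ T) :
    ∃ γ : ℝ, ∀ x ∈ interior (R.cell K), c x = γ := by
  obtain ⟨p, hp, hpc⟩ := hc K hK
  rw [MvPolynomial.totalDegree_eq_zero_iff_eq_C.1 (Nat.le_zero.1 hp)] at hpc
  exact ⟨p.coeff 0, fun x hx => by rw [hpc x hx, MvPolynomial.eval_C]⟩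

theorem PiecewisePolynomial.mul_left (hc : R.PiecewisePolynomial T 0 c)
    {v : EuclideanSpace ℝ (Fin n) → ℝ} (hv : R.PiecewisePolynomial T m v) :
    R.PiecewisePolynomial T m (fun x => c x * v x) := by
  rw [piecewisePolynomial_iff] at hv ⊢
  intro K hK
  obtain ⟨q, hq, hqv⟩ := hv K hK
  obtain ⟨γ, hγ⟩ := hc.exists_const hK
  exact ⟨γ • q, Submodule.smul_mem _ _ hq, fun x hx => by simp [hqv x hx, hγ x hx]⟩

theorem PiecewisePolynomial.ae_abs_le (hc : R.PiecewisePolynomial T m c) (h : R.Tiles T A) :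
    ∀ᵐ x ∂(volume.restrict (interior A)),
      |c x| ≤ (eLpNorm c ⊤ (volume.restrict (interior A))).toReal := by
  have hfin := (hc.memLp h ⊤).2
  filter_upwards [enorm_ae_le_eLpNormEssSup c (volume.restrict (interior A))] with x hx
  rw [eLpNorm_exponent_top] at hfin ⊢
  have := ENNReal.toReal_mono hfin.ne hx
  simpa using this

/-- Restricted to the interior of a cell, the weak derivative must be the classical derivative of
the local polynomial. Hence the residual is a polynomial on each cell. -/
theorem exists_weakDirDeriv_eq (h : R.Tiles T A) {w d : EuclideanSpace ℝ (Fin n) → ℝ}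
    (hw : R.PiecewisePolynomial T m w) (hd : HasWeakDirDeriv (interior A) b w d) {K : ι}
    (hK : K ∈ T) : ∃ q ∈ polyFun n m, d =ᵐ[volume.restrict (R.cell K)] q := by
  obtain ⟨q, hq, hqw⟩ := piecewisePolynomial_iff.1 hw K hK
  refine ⟨_, fderiv_apply_mem_polyFun hq b, ?_⟩
  have hb : Bornology.IsBounded (interior (R.cell K)) :=
    (R.isBounded_cell K).subset interior_subset
  have h1 : HasWeakDirDeriv (interior (R.cell K)) b q d :=
    (hd.mono (h.interior_cell_subset hK)).congr
      (ae_restrict_of_forall_mem isOpen_interior.measurableSet hqw) (ae_eq_refl _)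
  rw [R.restrict_cell]
  exact h1.ae_unique hb isOpen_interior (ContDiff.hasWeakDirDeriv hb (contDiff_of_mem_polyFun hq))

end PiecewisePolynomial

/-! ### Approximation by piecewise constants -/

section StepFunctions

/-- The function with value `α L` on the interior of the cell `L ∈ T`. -/
def stepFun (R : RefinementRule n ι) (T : Finset ι) (α : ι → ℝ) (x : EuclideanSpace ℝ (Fin n)) :
    ℝ :=
  ∑ L ∈ T, (interior (R.cell L)).indicator (fun _ => α L) x

theorem Tiles.stepFun_eq (h : R.Tiles T A) (α : ι → ℝ) {L : ι} (hL : L ∈ T)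
    {x : EuclideanSpace ℝ (Fin n)} (hx : x ∈ interior (R.cell L)) : R.stepFun T α x = α L := by
  rw [stepFun, Finset.sum_eq_single_of_mem L hL fun L' hL' hne =>
    Set.indicator_of_notMem (fun hx' => hne (h.eq_of_mem hL' hL hx' hx)) _,
    Set.indicator_of_mem hx]

theorem Tiles.piecewisePolynomial_stepFun (h : R.Tiles T A) (α : ι → ℝ) :
    R.PiecewisePolynomial T m (R.stepFun T α) :=
  piecewisePolynomial_iff.2 fun L hL =>
    ⟨_, const_mem_polyFun (α L), fun _ hx => h.stepFun_eq α hL hx⟩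

/-- A point in the interior of the cell `L`. -/
def interiorPoint (R : RefinementRule n ι) (L : ι) : EuclideanSpace ℝ (Fin n) :=
  (R.interior_cell_nonempty L).choose

theorem interiorPoint_mem (R : RefinementRule n ι) (L : ι) :
    R.interiorPoint L ∈ interior (R.cell L) := (R.interior_cell_nonempty L).choose_spec

/-- On a fine cell a polynomial deviates from one of its values by `θ` times its scaled norm on the
coarse cell. Piecewise constants suffice for the first component whatever `mu` is, even `0`. Cells
on which `φ` vanishes are reproduced exactly, so they need no refinement. -/
theorem exists_sampling_bound (hn : 1 ≤ n) (m : ℕ) (ϱ : ℝ) :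
    ∃ C : ℝ, 0 < C ∧ ∀ (ι : Type u) (R : RefinementRule n ι) (A : Set (EuclideanSpace ℝ (Fin n)))
      (T T' : Finset ι), R.Tiles T A → R.Tiles T' A → (∀ K ∈ T, shapeParameter (R.cell K) ≤ ϱ) →
      ∀ (φ : EuclideanSpace ℝ (Fin n) → ℝ) (θ : ℝ), 0 ≤ θ → R.PiecewisePolynomial T m φ →
      (∀ L ∈ T', ∃ K ∈ T, R.cell L ⊆ R.cell K ∧ ((∀ x ∈ interior (R.cell K), φ x = 0) ∨
        Metric.diam (R.cell L) ≤ θ * Metric.diam (R.cell K))) →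
      √(∫ x in interior A, (R.stepFun T' (fun L => φ (R.interiorPoint L)) x - φ x) ^ 2) ≤
        C * θ * √(∫ x in interior A, φ x ^ 2) := by
  obtain ⟨C, hC, hbound⟩ := exists_ballNorm_bound n m (innerRadius_pos ϱ)
  have hκ := unitBallVolume_nonneg (n := n)
  refine ⟨(√(unitBallVolume n) + 1) * C, by positivity,
    fun ι R A T T' hT hT' hsh φ θ hθ hφ hsub => ?_⟩
  set v := R.stepFun T' (fun L => φ (R.interiorPoint L)) with hv
  have hφL := hφ.memLp hT 2
  have hvL : MemLp v 2 (volume.restrict (interior A)) :=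
    (hT'.piecewisePolynomial_stepFun (m := 0) _).memLp hT' 2
  have hcell : ∀ K ∈ T, ∫ x in R.cell K, (v x - φ x) ^ 2 ≤
      unitBallVolume n * (C * θ) ^ 2 * ∫ x in R.cell K, φ x ^ 2 := by
    intro K hK
    obtain ⟨q, hq, hqφ⟩ := piecewisePolynomial_iff.1 hφ K hK
    set h := Metric.diam (R.cell K) with hh
    have hh0 : 0 < h := R.diam_cell_pos hn K
    obtain ⟨x₀, hx₀⟩ := R.exists_closedBall_subset_cell K (hsh K hK)
    have hx₀' : Metric.closedBall x₀ (innerRadius ϱ * h) ⊆ R.cell K := by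
      rwa [innerRadius, one_div_mul_eq_div]
    have hx₀K : x₀ ∈ R.cell K := hx₀' (Metric.mem_closedBall_self
      (mul_nonneg (innerRadius_pos ϱ).le hh0.le))
    have hKball : R.cell K ⊆ Metric.closedBall x₀ h := fun x hx =>
      Metric.mem_closedBall.2 (Metric.dist_le_diam_of_mem (R.isBounded_cell K) hx hx₀K)
    obtain ⟨-, hq2⟩ := hbound q hq x₀ h hh0
    set a := ballNorm (innerRadius ϱ) x₀ h q with ha
    have ha0 : 0 ≤ a := ballNorm_nonneg _ _ _ _
    have hae : ∀ᵐ x ∂(volume.restrict (R.cell K)), ∃ L ∈ T', x ∈ interior (R.cell L) :=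
      ae_mono (hT.restrict_cell_le hK) hT'.ae_exists
    have h1 : ∀ᵐ x ∂(volume.restrict (R.cell K)), |(v x - φ x) ^ 2| ≤ (C * a * θ) ^ 2 := by
      filter_upwards [hae, R.ae_mem_interior_cell K] with x ⟨L, hL, hxL⟩ hxK
      obtain ⟨K', hK', hLK', hor⟩ := hsub L hL
      have hKK : K' = K := hT.eq_of_mem hK' hK (interior_mono hLK' hxL) hxK
      subst hKK
      have hpt : R.interiorPoint L ∈ interior (R.cell K') :=
        interior_mono hLK' (R.interiorPoint_mem L)
      rw [abs_of_nonneg (sq_nonneg _)]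
      refine sq_le_sq' ?_ ?_ <;> rw [hv, hT'.stepFun_eq _ hL hxL]
      all_goals
        rcases hor with h0 | hdiam
        · rw [h0 _ hpt, h0 _ hxK]
          have : 0 ≤ C * a * θ := by positivity
          linarith
        · rw [hqφ _ hpt, hqφ _ hxK]
          have h2 := hq2 _ (hKball (interior_subset hpt)) x (hKball (interior_subset hxK))
          have h3 : ‖R.interiorPoint L - x‖ / h ≤ θ := by
            rw [div_le_iff₀ hh0, ← dist_eq_norm]
            exact (Metric.dist_le_diam_of_mem (R.isBounded_cell L)
              (interior_subset (R.interiorPoint_mem L)) (interior_subset hxL)).trans hdiam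
          have h4 := h2.trans (mul_le_mul_of_nonneg_left h3 (by positivity : 0 ≤ C * a))
          have h5 := abs_le.1 h4
          linarith [h5.1, h5.2]
    have h2 := (le_abs_self _).trans (setIntegral_le_of_abs_le hh0.le hKball (sq_nonneg _) h1)
    have h3 : h ^ n * a ^ 2 ≤ ∫ x in R.cell K, φ x ^ 2 := by
      have h4 : ∫ x in R.cell K, φ x ^ 2 = ∫ x in R.cell K, q x ^ 2 :=
        integral_congr_ae ((ae_restrict_cell_of_interior hqφ).mono fun x hx => by simp only [hx])
      rw [h4]
      exact ballNorm_sq_le hh0 (continuous_of_mem_polyFun hq) (R.isBounded_cell K)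
        (Metric.ball_subset_closedBall.trans hx₀')
    refine h2.trans ?_
    have h4 : unitBallVolume n * h ^ n * (C * a * θ) ^ 2 =
        unitBallVolume n * (C * θ) ^ 2 * (h ^ n * a ^ 2) := by ring
    rw [h4]
    exact mul_le_mul_of_nonneg_left h3 (by positivity)
  have hsum : ∫ x in interior A, (v x - φ x) ^ 2 ≤
      unitBallVolume n * (C * θ) ^ 2 * ∫ x in interior A, φ x ^ 2 := by
    have i1 : IntegrableOn (fun x => (v x - φ x) ^ 2) (interior A) :=
      (hvL.sub hφL).integrable_sq
    rw [hT.setIntegral i1, hT.setIntegral hφL.integrable_sq,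
      Finset.mul_sum]
    exact Finset.sum_le_sum hcell
  calc √(∫ x in interior A, (v x - φ x) ^ 2)
      ≤ √(unitBallVolume n * (C * θ) ^ 2 * ∫ x in interior A, φ x ^ 2) := Real.sqrt_le_sqrt hsum
    _ = √(unitBallVolume n) * (C * θ) * √(∫ x in interior A, φ x ^ 2) := by
        rw [Real.sqrt_mul (by positivity), Real.sqrt_mul hκ, Real.sqrt_sq (by positivity)]
    _ ≤ (√(unitBallVolume n) + 1) * C * θ * √(∫ x in interior A, φ x ^ 2) := by
        refine mul_le_mul_of_nonneg_right ?_ (Real.sqrt_nonneg _)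
        have : 0 ≤ C * θ := by positivity
        nlinarith

end StepFunctions

/-! ### Descent directions and Galerkin orthogonality -/

section Energy

variable {mu mw mf : ℕ} {u w f : EuclideanSpace ℝ (Fin n) → ℝ}

theorem MemTrial.add_const_mul (hΩ : Bornology.IsBounded Ω)
    {v z : EuclideanSpace ℝ (Fin n) → ℝ} (h : R.MemTrial Ω b mu mw T u w)
    (h' : R.MemTrial Ω b mu mw T v z) (t : ℝ) :
    R.MemTrial Ω b mu mw T (fun x => u x + t * v x) (fun x => w x + t * z x) :=
  ⟨h.1.add_const_mul h'.1 t, h.2.1.add_const_mul h'.2.1 t, h.2.2.add_const_mul hΩ t h'.2.2⟩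

theorem MemTrial.memLp_diff (hT : R.Tiles T A) (h : R.MemTrial (interior A) b mu mw T u w) :
    MemLp (fun x => u x - w x) 2 (volume.restrict (interior A)) :=
  (h.1.memLp hT 2).sub (h.2.1.memLp hT 2)

theorem MemTrial.memLp_residual (hT : R.Tiles T A) (hc : R.PiecewisePolynomial T 0 c)
    (hf : R.PiecewisePolynomial T mf f) (h : R.MemTrial (interior A) b mu mw T u w) :
    MemLp (transportResidual (interior A) b c u w f) 2 (volume.restrict (interior A)) :=
  (h.2.2.hasWeakDirDeriv.2.1.add ((hc.mul_left h.1).memLp hT 2)).sub (hf.memLp hT 2)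

theorem etaSq_nonneg (S : Set (EuclideanSpace ℝ (Fin n))) : 0 ≤ etaSq Ω b c u w f S :=
  add_nonneg (integral_nonneg fun _ => sq_nonneg _) (integral_nonneg fun _ => sq_nonneg _)

theorem etaSq_add_const_mul (hT : R.Tiles T A) (hc : R.PiecewisePolynomial T 0 c)
    (hf : R.PiecewisePolynomial T mf f) (h : R.MemTrial (interior A) b mu mw T u w)
    {v z d : EuclideanSpace ℝ (Fin n) → ℝ} (h' : R.MemTrial (interior A) b mu mw T v z)
    (hd : HasWeakDirDeriv (interior A) b z d) (t : ℝ) :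
    etaSq (interior A) b c (fun x => u x + t * v x) (fun x => w x + t * z x) f (interior A) =
      etaSq (interior A) b c u w f (interior A) +
      2 * t * ((∫ x in interior A, (u x - w x) * (v x - z x)) +
        ∫ x in interior A, transportResidual (interior A) b c u w f x * (d x + c x * v x)) +
      t ^ 2 * ((∫ x in interior A, (v x - z x) ^ 2) +
        ∫ x in interior A, (d x + c x * v x) ^ 2) := by
  have hb := hT.isBounded_interior
  have e2 := h.memLp_diff hT
  have g2 := h.memLp_residual hT hc hf
  have y2 := h'.memLp_diff hT
  have k2 : MemLp (fun x => d x + c x * v x) 2 (volume.restrict (interior A)) :=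
    hd.2.1.add ((hc.mul_left h'.1).memLp hT 2)
  have e1 : ∫ x in interior A, (u x + t * v x - (w x + t * z x)) ^ 2 =
      ∫ x in interior A, ((u x - w x) + t * (v x - z x)) ^ 2 :=
    integral_congr_ae (ae_of_all _ fun x => by ring)
  have hwd := (h.2.2.hasWeakDirDeriv.add hb (hd.const_mul t)).weakDirDeriv_ae_eq hb isOpen_interior
  have e3 : ∫ x in interior A, (transportResidual (interior A) b c (fun x => u x + t * v x)
      (fun x => w x + t * z x) f x) ^ 2 = ∫ x in interior A,
        (transportResidual (interior A) b c u w f x + t * (d x + c x * v x)) ^ 2 := by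
    refine integral_congr_ae (hwd.mono fun x hx => ?_)
    simp only [transportResidual, hx]
    ring
  rw [etaSq, etaSq, e1, e3, integral_add_const_mul_sq e2 y2, integral_add_const_mul_sq g2 k2]
  ring

/-- Some `(v, z)` in the trial space for `T'` has an inner product with the residual of `(u, w)`
of at least `κ` times the product of the norms. -/
def HasDescent (R : RefinementRule n ι) (Ω : Set (EuclideanSpace ℝ (Fin n)))
    (b : EuclideanSpace ℝ (Fin n)) (c : EuclideanSpace ℝ (Fin n) → ℝ) (mu mw : ℕ) (T' : Finset ι)
    (u w f : EuclideanSpace ℝ (Fin n) → ℝ) (κ : ℝ) : Prop :=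
  ∃ (v z d : EuclideanSpace ℝ (Fin n) → ℝ) (N : ℝ), R.MemTrial Ω b mu mw T' v z ∧
    HasWeakDirDeriv Ω b z d ∧ 0 < N ∧
    (∫ x in Ω, (v x - z x) ^ 2) + (∫ x in Ω, (d x + c x * v x) ^ 2) ≤ N ^ 2 ∧
    κ * √(etaSq Ω b c u w f Ω) * N ≤ (∫ x in Ω, (u x - w x) * (v x - z x)) +
      ∫ x in Ω, transportResidual Ω b c u w f x * (d x + c x * v x)

theorem HasDescent.mono {κ κ' : ℝ} (h : R.HasDescent Ω b c mu mw T' u w f κ) (hκ : κ' ≤ κ) :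
    R.HasDescent Ω b c mu mw T' u w f κ' := by
  obtain ⟨v, z, d, N, h1, h2, h3, h4, h5⟩ := h
  refine ⟨v, z, d, N, h1, h2, h3, h4, le_trans ?_ h5⟩
  gcongr

/-- Along the line through `(u, w)` with direction `(v, z)` the functional is the parabola `E + 2 t
B + t² Q` with `Q ≤ N²`. The step `t = -B / N²` already gains `B² / N² ≥ κ² E`, and the refined
minimizer does no worse. -/
theorem HasDescent.sqrt_etaSq_le (hT : R.Tiles T' A) (hc : R.PiecewisePolynomial T' 0 c)
    (hf : R.PiecewisePolynomial T' mf f) (h : R.MemTrial (interior A) b mu mw T' u w) {κ : ℝ}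
    (hκ : 0 ≤ κ) (hdes : R.HasDescent (interior A) b c mu mw T' u w f κ)
    {u' w' : EuclideanSpace ℝ (Fin n) → ℝ}
    (hsol : R.IsLeastSquaresSol (interior A) b c mu mw T' f u' w') :
    √(etaSq (interior A) b c u' w' f (interior A)) ≤
      √(1 - κ ^ 2) * √(etaSq (interior A) b c u w f (interior A)) := by
  obtain ⟨v, z, d, N, h1, h2, h3, h4, h5⟩ := hdes
  have hexp := fun t : ℝ => (hsol.2 _ _ (h.add_const_mul hT.isBounded_interior h1 t)).trans_eq
    (etaSq_add_const_mul hT hc hf h h1 h2 t)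
  set E := etaSq (interior A) b c u w f (interior A) with hE
  have hE0 : 0 ≤ E := etaSq_nonneg _
  set B := (∫ x in interior A, (u x - w x) * (v x - z x)) +
    ∫ x in interior A, transportResidual (interior A) b c u w f x * (d x + c x * v x) with hB
  set Q := (∫ x in interior A, (v x - z x) ^ 2) +
    ∫ x in interior A, (d x + c x * v x) ^ 2 with hQ
  have h6 := hexp (-(B / N ^ 2))
  have h7 : E + 2 * -(B / N ^ 2) * B + (-(B / N ^ 2)) ^ 2 * Q ≤ E - B ^ 2 / N ^ 2 := by
    have : (-(B / N ^ 2)) ^ 2 * Q ≤ (-(B / N ^ 2)) ^ 2 * N ^ 2 :=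
      mul_le_mul_of_nonneg_left h4 (sq_nonneg _)
    have h8 : (-(B / N ^ 2)) ^ 2 * N ^ 2 = B ^ 2 / N ^ 2 := by field_simp
    have h9 : 2 * -(B / N ^ 2) * B = -2 * (B ^ 2 / N ^ 2) := by ring
    rw [h9]; linarith
  have h8 : κ ^ 2 * E ≤ B ^ 2 / N ^ 2 := by
    rw [le_div_iff₀ (by positivity)]
    have := pow_le_pow_left₀ (by positivity) h5 2
    rwa [mul_pow, mul_pow, Real.sq_sqrt hE0] at this
  rw [← Real.sqrt_mul' _ hE0]
  exact Real.sqrt_le_sqrt (by linarith)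

theorem IsLeastSquaresSol.orthogonal (hT : R.Tiles T A) (hc : R.PiecewisePolynomial T 0 c)
    (hf : R.PiecewisePolynomial T mf f)
    (hsol : R.IsLeastSquaresSol (interior A) b c mu mw T f u w)
    {v z d : EuclideanSpace ℝ (Fin n) → ℝ} (h' : R.MemTrial (interior A) b mu mw T v z)
    (hd : HasWeakDirDeriv (interior A) b z d) :
    (∫ x in interior A, (u x - w x) * (v x - z x)) +
      ∫ x in interior A, transportResidual (interior A) b c u w f x * (d x + c x * v x) = 0 := by
  have hexp := fun t : ℝ => (hsol.2 _ _ (hsol.1.add_const_mul hT.isBounded_interior h' t)).trans_eq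
    (etaSq_add_const_mul hT hc hf hsol.1 h' hd t)
  set B := (∫ x in interior A, (u x - w x) * (v x - z x)) +
    ∫ x in interior A, transportResidual (interior A) b c u w f x * (d x + c x * v x) with hB
  set Q := (∫ x in interior A, (v x - z x) ^ 2) +
    ∫ x in interior A, (d x + c x * v x) ^ 2 with hQ
  have hQ0 : 0 ≤ Q :=
    add_nonneg (integral_nonneg fun _ => sq_nonneg _) (integral_nonneg fun _ => sq_nonneg _)
  -- The summand `1` covers directions with `Q = 0`.
  have h6 := hexp (-(B / (Q + 1)))
  have h7 : 2 * -(B / (Q + 1)) * B + (-(B / (Q + 1))) ^ 2 * Q =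
      -(B ^ 2 * (Q + 2) / (Q + 1) ^ 2) := by field_simp; ring
  have h8 : B ^ 2 * (Q + 2) / (Q + 1) ^ 2 ≤ 0 := by linarith
  by_contra hne
  have : 0 < B ^ 2 * (Q + 2) / (Q + 1) ^ 2 := by positivity
  linarith

end Energy

end RefinementRule


namespace RefinementRule

variable {n : ℕ} {ι : Type u} {R : RefinementRule n ι}
  {A : Set (EuclideanSpace ℝ (Fin n))} {b : EuclideanSpace ℝ (Fin n)}
  {c : EuclideanSpace ℝ (Fin n) → ℝ} {T T' : Finset ι} {m : ℕ}

/-! ### Functions assembled from cellwise pieces -/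

section PieceFunctions

/-- The function that equals `q K` on the interior of the cells `K ∈ S` and vanishes elsewhere. -/
def pieceFun (R : RefinementRule n ι) (S : Finset ι) (q : ι → EuclideanSpace ℝ (Fin n) → ℝ)
    (x : EuclideanSpace ℝ (Fin n)) : ℝ :=
  ∑ K ∈ S, (interior (R.cell K)).indicator (q K) x

theorem Tiles.pieceFun_eq (h : R.Tiles T A) {S : Finset ι} (hS : S ⊆ T)
    (q : ι → EuclideanSpace ℝ (Fin n) → ℝ) {K : ι} (hK : K ∈ S)
    {x : EuclideanSpace ℝ (Fin n)} (hx : x ∈ interior (R.cell K)) :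
    R.pieceFun S q x = q K x := by
  rw [pieceFun, Finset.sum_eq_single_of_mem K hK fun L hL hne =>
    Set.indicator_of_notMem (fun hx' => hne (h.eq_of_mem (hS hL) (hS hK) hx' hx)) _,
    Set.indicator_of_mem hx]

theorem Tiles.pieceFun_eq_zero (h : R.Tiles T A) {S : Finset ι} (hS : S ⊆ T)
    (q : ι → EuclideanSpace ℝ (Fin n) → ℝ) {K : ι} (hK : K ∈ T) (hKS : K ∉ S)
    {x : EuclideanSpace ℝ (Fin n)} (hx : x ∈ interior (R.cell K)) :
    R.pieceFun S q x = 0 := by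
  refine Finset.sum_eq_zero fun L hL => Set.indicator_of_notMem (fun hx' => hKS ?_) _
  exact h.eq_of_mem (hS hL) hK hx' hx ▸ hL

theorem Tiles.setIntegral_eq_sum_of_subset (h : R.Tiles T A) {S : Finset ι} (hS : S ⊆ T)
    {F : EuclideanSpace ℝ (Fin n) → ℝ} (hF : IntegrableOn F (interior A))
    (h0 : ∀ K ∈ T, K ∉ S → ∀ x ∈ interior (R.cell K), F x = 0) :
    ∫ x in interior A, F x = ∑ K ∈ S, ∫ x in R.cell K, F x := by
  rw [h.setIntegral hF]
  refine (Finset.sum_subset hS fun K hK hKS => ?_).symm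
  rw [integral_congr_ae (ae_restrict_cell_of_interior (h0 K hK hKS)), integral_zero]

theorem Tiles.memLp_pieceFun (h : R.Tiles T A) {S : Finset ι} (hS : S ⊆ T) {p : ENNReal}
    {q : ι → EuclideanSpace ℝ (Fin n) → ℝ}
    (hq : ∀ K ∈ S, MemLp (q K) p (volume.restrict (R.cell K))) :
    MemLp (R.pieceFun S q) p (volume.restrict (interior A)) := by
  refine memLp_finsetSum _ fun K hK => ?_
  refine (memLp_indicator_iff_restrict isOpen_interior.measurableSet).2 ?_
  rw [Measure.restrict_restrict isOpen_interior.measurableSet,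
    Set.inter_eq_left.2 (h.interior_cell_subset (hS hK)), ← R.restrict_cell]
  exact hq K hK

theorem Tiles.integral_pieceFun_sq (h : R.Tiles T A) {S : Finset ι} (hS : S ⊆ T)
    {q : ι → EuclideanSpace ℝ (Fin n) → ℝ}
    (hq : ∀ K ∈ S, MemLp (q K) 2 (volume.restrict (R.cell K))) :
    ∫ x in interior A, R.pieceFun S q x ^ 2 = ∑ K ∈ S, ∫ x in R.cell K, q K x ^ 2 := by
  rw [h.setIntegral_eq_sum_of_subset hS (h.memLp_pieceFun hS hq).integrable_sq
    fun K hK hKS x hx => by rw [h.pieceFun_eq_zero hS q hK hKS hx]; norm_num]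
  refine Finset.sum_congr rfl fun K hK => integral_congr_ae
    (ae_restrict_cell_of_interior fun x hx => ?_)
  simp only [h.pieceFun_eq hS q hK hx]

end PieceFunctions

/-! ### Descent from reaction-type residuals and from bubbles -/

section Descent

variable {mu mw mf : ℕ} {u w f : EuclideanSpace ℝ (Fin n) → ℝ}

theorem MemTrial.exists_residual_eq (hT : R.Tiles T A) (hc : R.PiecewisePolynomial T 0 c)
    (hf : R.PiecewisePolynomial T mf f) (h : R.MemTrial (interior A) b mu mw T u w) {K : ι}
    (hK : K ∈ T) : ∃ p ∈ polyFun n (max (max mu mw) mf),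
      transportResidual (interior A) b c u w f =ᵐ[volume.restrict (R.cell K)] p := by
  obtain ⟨q, hq, hqw⟩ := exists_weakDirDeriv_eq hT h.2.1 h.2.2.hasWeakDirDeriv hK
  obtain ⟨y, hy, hyc⟩ := piecewisePolynomial_iff.1 (hc.mul_left h.1) K hK
  obtain ⟨k, hk, hkf⟩ := piecewisePolynomial_iff.1 hf K hK
  refine ⟨q + y - k, Submodule.sub_mem _ (Submodule.add_mem _
    (polyFun_mono ((le_max_right _ _).trans (le_max_left _ _)) hq)
    (polyFun_mono ((le_max_left _ _).trans (le_max_left _ _)) hy))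
    (polyFun_mono (le_max_right _ _) hk), ?_⟩
  filter_upwards [hqw, R.ae_mem_interior_cell K] with x hx hxK
  simp only [transportResidual, Pi.sub_apply, Pi.add_apply, hx, hyc x hxK, hkf x hxK]

theorem MemTrial.exists_diff_eq (h : R.MemTrial (interior A) b mu mw T u w) {K : ι}
    (hK : K ∈ T) : ∃ p ∈ polyFun n (max (max mu mw) mf),
      ∀ x ∈ interior (R.cell K), u x - w x = p x := by
  obtain ⟨q, hq, hqu⟩ := piecewisePolynomial_iff.1 h.1 K hK
  obtain ⟨y, hy, hyw⟩ := piecewisePolynomial_iff.1 h.2.1 K hK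
  exact ⟨q - y, Submodule.sub_mem _
    (polyFun_mono ((le_max_left _ _).trans (le_max_left _ _)) hq)
    (polyFun_mono ((le_max_right _ _).trans (le_max_left _ _)) hy),
    fun x hx => by simp only [Pi.sub_apply, hqu x hx, hyw x hx]⟩

/-- With `z = 0` the pairing with the residual is `∫ (e + c g) v`. For `φ = e + c g` on `S`, zero
elsewhere, the hypotheses say `‖φ‖ ≥ √(β α) √E`, and `v` is a sampling of `φ`. -/
theorem exists_hasDescent_of_type_one (hn : 1 ≤ n) (mu mw mf : ℕ) (ϱ : ℝ) {β α γ : ℝ} (hβ : 0 < β)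
    (hα : 0 < α) (hγ : 0 ≤ γ) :
    ∃ κ : ℝ, 0 < κ ∧ ∃ θ : ℝ, 0 < θ ∧ ∀ (ι : Type u) (R : RefinementRule n ι)
      (A : Set (EuclideanSpace ℝ (Fin n))) (b : EuclideanSpace ℝ (Fin n))
      (c : EuclideanSpace ℝ (Fin n) → ℝ) (T T' S : Finset ι) (u w f : EuclideanSpace ℝ (Fin n) → ℝ),
      R.Tiles T A → R.Tiles T' A → (∀ K ∈ T, shapeParameter (R.cell K) ≤ ϱ) →
      R.PiecewisePolynomial T 0 c → (∀ᵐ x ∂(volume.restrict (interior A)), |c x| ≤ γ) →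
      R.PiecewisePolynomial T mf f → R.MemTrial (interior A) b mu mw T u w → S ⊆ T →
      (∀ L ∈ T', ∃ K ∈ T, R.cell L ⊆ R.cell K ∧
        (K ∉ S ∨ Metric.diam (R.cell L) ≤ θ * Metric.diam (R.cell K))) →
      (∀ K ∈ S, β * etaSq (interior A) b c u w f (R.cell K) ≤
        ∫ x in R.cell K, ((u x - w x) + c x * transportResidual (interior A) b c u w f x) ^ 2) →
      α * etaSq (interior A) b c u w f (interior A) ≤
        ∑ K ∈ S, etaSq (interior A) b c u w f (R.cell K) →
      0 < etaSq (interior A) b c u w f (interior A) →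
      R.HasDescent (interior A) b c mu mw T' u w f κ := by
  obtain ⟨C, hC, hsample⟩ := exists_sampling_bound.{u} hn (max (max mu mw) mf) ϱ
  -- This `θ` makes the relative sampling error `1/2`: the pairing is then at least `‖φ‖² / 2`, and
  -- `2 * (1 + γ) * ‖φ‖` bounds the norm of the image `(v, c v)`.
  refine ⟨√(β * α) / (4 * (1 + γ)), by positivity, 1 / (2 * C), by positivity, ?_⟩
  intro ι R A b c T T' S u w f hT hT' hsh hc hcγ hf htr hS hsub hbig hbulk hE
  set g := transportResidual (interior A) b c u w f with hg
  set E := etaSq (interior A) b c u w f (interior A) with hEdef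
  have hexq : ∀ K ∈ T, ∃ q ∈ polyFun n (max (max mu mw) mf),
      (fun x => (u x - w x) + c x * g x) =ᵐ[volume.restrict (R.cell K)] q := by
    intro K hK
    obtain ⟨p, hp, hpg⟩ := htr.exists_residual_eq hT hc hf hK
    obtain ⟨y, hy, hye⟩ := htr.exists_diff_eq (mf := mf) hK
    obtain ⟨γ', hγ'⟩ := hc.exists_const hK
    refine ⟨y + γ' • p, Submodule.add_mem _ hy (Submodule.smul_mem _ _ hp), ?_⟩
    filter_upwards [hpg, R.ae_mem_interior_cell K] with x hx hxK
    simp [hg, hx, hye x hxK, hγ' x hxK]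
  choose! q hq hqeq using hexq
  have hqc : ∀ K ∈ S, MemLp (q K) 2 (volume.restrict (R.cell K)) := fun K hK =>
    memLp_restrict_of_continuous (R.isBounded_cell K) 2 (continuous_of_mem_polyFun (hq K (hS hK)))
  set φ := R.pieceFun S q with hφ
  have hφS : ∀ K ∈ S, ∀ x ∈ interior (R.cell K), φ x = q K x := fun K hK x hx =>
    hT.pieceFun_eq hS q hK hx
  have hφ0 : ∀ K ∈ T, K ∉ S → ∀ x ∈ interior (R.cell K), φ x = 0 := fun K hK hKS x hx =>
    hT.pieceFun_eq_zero hS q hK hKS hx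
  have hφpp : R.PiecewisePolynomial T (max (max mu mw) mf) φ := by
    refine piecewisePolynomial_iff.2 fun K hK => ?_
    by_cases hKS : K ∈ S
    · exact ⟨q K, hq K hK, hφS K hKS⟩
    · exact ⟨0, Submodule.zero_mem _, hφ0 K hK hKS⟩
  have hφL := hφpp.memLp hT 2
  set X := √(∫ x in interior A, φ x ^ 2) with hX
  have hX2 : X ^ 2 = ∫ x in interior A, φ x ^ 2 :=
    Real.sq_sqrt (integral_nonneg fun _ => sq_nonneg _)
  have hXE : √(β * α) * √E ≤ X := by
    rw [← Real.sqrt_mul (by positivity)]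
    refine Real.sqrt_le_sqrt ?_
    rw [hφ, hT.integral_pieceFun_sq hS hqc, mul_assoc]
    refine (mul_le_mul_of_nonneg_left hbulk hβ.le).trans ?_
    rw [Finset.mul_sum]
    refine Finset.sum_le_sum fun K hK => (hbig K hK).trans_eq ?_
    exact integral_congr_ae ((hqeq K (hS hK)).mono fun x hx => by simp only [← hx])
  have hE' : 0 < √E := Real.sqrt_pos.2 hE
  have hX0 : 0 < X := lt_of_lt_of_le (by positivity) hXE
  have hstep := hsample ι R A T T' hT hT' hsh φ (1 / (2 * C)) (by positivity) hφpp
    fun L hL => by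
      obtain ⟨K, hK, hLK, hor⟩ := hsub L hL
      exact ⟨K, hK, hLK, hor.imp_left fun h => hφ0 K hK h⟩
  set v := R.stepFun T' (fun L => φ (R.interiorPoint L)) with hv
  have hvpp : R.PiecewisePolynomial T' mu v := hT'.piecewisePolynomial_stepFun _
  have hvL := hvpp.memLp hT' 2
  rw [show C * (1 / (2 * C)) = 1 / 2 by field_simp, ← hX] at hstep
  have hvX : √(∫ x in interior A, v x ^ 2) ≤ 2 * X := by
    have := sqrt_integral_add_sq_le (hvL.sub hφL) hφL
    simp only [Pi.sub_apply, sub_add_cancel] at this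
    linarith
  have hcv := sqrt_integral_mul_sq_le hγ hcγ hvL
  -- Outside `S` the identity holds because `v`, sampling the zero values of `φ`, vanishes there
  -- too.
  have hae : ∀ᵐ x ∂(volume.restrict (interior A)),
      (u x - w x) * (v x - 0) + g x * (0 + c x * v x) = φ x * v x := by
    have h2 : ∀ᵐ x ∂(volume.restrict (interior A)), ∀ K ∈ T, x ∈ interior (R.cell K) →
        (u x - w x) + c x * g x = q K x := by
      rw [Filter.eventually_all_finset]
      intro K hK
      have h3 := hqeq K hK
      rw [R.restrict_cell, Filter.EventuallyEq, ae_restrict_iff' isOpen_interior.measurableSet] at h3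
      exact ae_restrict_of_ae h3
    filter_upwards [h2, hT.ae_exists, hT'.ae_exists] with x hx ⟨K, hK, hxK⟩ ⟨L, hL, hxL⟩
    by_cases hKS : K ∈ S
    · rw [hφS K hKS x hxK, ← hx K hK hxK]; ring
    · obtain ⟨K', hK', hLK, -⟩ := hsub L hL
      have hKK : K' = K := hT.eq_of_mem hK' hK (interior_mono hLK hxL) hxK
      subst hKK
      have hv0 : v x = 0 := by
        rw [hv, hT'.stepFun_eq _ hL hxL]
        exact hφ0 K' hK hKS _ (interior_mono hLK (R.interiorPoint_mem L))
      rw [hv0]; ring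
  have heL := htr.memLp_diff hT
  have hgL := htr.memLp_residual hT hc hf
  have hcvL : MemLp (fun x => c x * v x) 2 (volume.restrict (interior A)) := by
    have hcL : MemLp c ⊤ (volume.restrict (interior A)) := hc.memLp hT ⊤
    exact hvL.mul hcL
  refine ⟨v, 0, 0, 2 * (1 + γ) * X, ⟨hvpp, piecewisePolynomial_zero, memHZeroInflow_zero⟩, ?_,
    by positivity, ?_, ?_⟩
  · exact ⟨MemLp.zero, MemLp.zero, fun φ _ _ _ => by simp⟩
  · simp only [Pi.zero_apply, sub_zero, zero_add]
    have h1 : ∫ x in interior A, v x ^ 2 ≤ (2 * X) ^ 2 := by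
      rw [← Real.sq_sqrt (integral_nonneg fun x => sq_nonneg (v x) :
        0 ≤ ∫ x in interior A, v x ^ 2)]
      exact pow_le_pow_left₀ (Real.sqrt_nonneg _) hvX 2
    have h2 : ∫ x in interior A, (c x * v x) ^ 2 ≤ (γ * (2 * X)) ^ 2 := by
      rw [← Real.sq_sqrt (integral_nonneg fun x => sq_nonneg (c x * v x) :
        0 ≤ ∫ x in interior A, (c x * v x) ^ 2)]
      exact pow_le_pow_left₀ (Real.sqrt_nonneg _)
        (hcv.trans (mul_le_mul_of_nonneg_left hvX hγ)) 2
    nlinarith [mul_nonneg hγ (sq_nonneg X)]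
  · simp only [Pi.zero_apply]
    have i1 : Integrable (fun x => (u x - w x) * (v x - 0)) (volume.restrict (interior A)) := by
      simp only [sub_zero]; exact heL.integrable_mul hvL
    have i2 : Integrable (fun x => g x * (0 + c x * v x)) (volume.restrict (interior A)) := by
      simp only [zero_add]; exact hgL.integrable_mul hcvL
    have i3 : Integrable (fun x => φ x * (v x - φ x)) (volume.restrict (interior A)) :=
      hφL.integrable_mul (hvL.sub hφL)
    rw [← integral_add i1 i2, integral_congr_ae hae]
    have h1 : ∫ x in interior A, φ x * v x =
        (∫ x in interior A, φ x ^ 2) + ∫ x in interior A, φ x * (v x - φ x) := by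
      rw [← integral_add hφL.integrable_sq i3]
      exact integral_congr_ae (ae_of_all _ fun x => by ring)
    rw [h1, ← hX2]
    have h2 := (abs_le.1 (abs_integral_mul_le hφL (hvL.sub hφL))).1
    simp only [Pi.sub_apply] at h2
    rw [← hX] at h2
    have h3 : √(β * α) / (4 * (1 + γ)) * √E * (2 * (1 + γ) * X) = √(β * α) * √E * X / 2 := by
      field_simp; ring
    rw [h3]
    have h4 : √(β * α) * √E * X ≤ X * X := mul_le_mul_of_nonneg_right hXE hX0.le
    have h5 : X * √(∫ x in interior A, (v x - φ x) ^ 2) ≤ X * (1 / 2 * X) :=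
      mul_le_mul_of_nonneg_left hstep hX0.le
    nlinarith

/-- The direction is `(0, Z)` with `Z` the sum of the bubbles of the cells in `S`, which have
disjoint supports. With `D = ∑ h ^ (n + 2) * a ^ 2` one has `∫ g ∂_b Z ≥ D / 2`, whereas `‖Z‖` and
`‖∂_b Z‖` are at most multiples of `√D`, the former with an additional factor `σ`. -/
theorem exists_hasDescent_of_bubble (hn : 1 ≤ n) (b : EuclideanSpace ℝ (Fin n)) (mu mw mf : ℕ)
    (hmw : 1 ≤ mw) (ϱ : ℝ) {δ : ℝ} (hδ : 0 < δ) :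
    ∃ κ : ℝ, 0 < κ ∧ ∃ θ : ℝ, 0 < θ ∧ ∃ σ : ℝ, 0 < σ ∧ ∀ (ι : Type u) (R : RefinementRule n ι)
      (A : Set (EuclideanSpace ℝ (Fin n)))
      (c : EuclideanSpace ℝ (Fin n) → ℝ) (T T' S : Finset ι) (u w f : EuclideanSpace ℝ (Fin n) → ℝ)
      (D : ι → Finset ι) (p : ι → EuclideanSpace ℝ (Fin n) → ℝ)
      (x₀ : ι → EuclideanSpace ℝ (Fin n)),
      R.Tiles T A → R.Tiles T' A → R.PiecewisePolynomial T 0 c →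
      R.PiecewisePolynomial T mf f → R.MemTrial (interior A) b mu mw T u w → S ⊆ T →
      (∀ K ∈ S, R.Tiles (D K) (R.cell K)) →
      (∀ K ∈ S, ∀ L ∈ D K, shapeParameter (R.cell L) ≤ ϱ) →
      (∀ K ∈ S, ∀ L ∈ D K, ∀ L' ∈ D K, R.cell L ∩ R.cell L' = convexHull ℝ
        (Set.range (R.simplex L).points ∩ Set.range (R.simplex L').points)) →
      (∀ K ∈ S, ∀ L ∈ D K, Metric.diam (R.cell L) ≤ θ * Metric.diam (R.cell K)) →
      (∀ K ∈ S, Metric.diam (R.cell K) ≤ σ) →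
      (∀ L ∈ T', ∃ K ∈ T, R.cell L ⊆ R.cell K ∧ (K ∉ S ∨ L ∈ D K)) →
      (∀ K ∈ S, p K ∈ polyFun n (max (max mu mw) mf)) →
      (∀ K ∈ S, transportResidual (interior A) b c u w f =ᵐ[volume.restrict (R.cell K)] p K) →
      (∀ K ∈ S, Metric.closedBall (x₀ K) (innerRadius ϱ * Metric.diam (R.cell K)) ⊆ R.cell K) →
      δ * etaSq (interior A) b c u w f (interior A) ≤
        ∑ K ∈ S, Metric.diam (R.cell K) ^ (n + 2) * ballNorm (innerRadius ϱ / 2) (x₀ K)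
          (Metric.diam (R.cell K)) (fun x => fderiv ℝ (p K) x b) ^ 2 →
      0 < etaSq (interior A) b c u w f (interior A) →
      R.HasDescent (interior A) b c mu mw T' u w f κ := by
  obtain ⟨C, hC, θ, hθ, hbub⟩ := exists_bubble.{u} hn (max (max mu mw) mf) b ϱ
  have hμ := unitBallVolume_nonneg (n := n)
  set μ := √(unitBallVolume n) * C with hμdef
  have hμ0 : 0 ≤ μ := by positivity
  -- Chosen such that `|∫ e Z| ≤ √E (√δ / 4) √D ≤ D / 4`, half of the main term.
  set σ := √δ / (4 * (μ + 1)) with hσ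
  have hδ' : 0 < √δ := Real.sqrt_pos.2 hδ
  have hσ0 : 0 < σ := by positivity
  have hμσ : μ * σ ≤ √δ / 4 := by
    rw [hσ, mul_div_assoc', div_le_div_iff₀ (by positivity) (by norm_num)]
    nlinarith
  set N₁ := μ * (σ + ‖b‖) + 1 with hN₁
  have hN₁0 : 0 < N₁ := by positivity
  refine ⟨√δ / (4 * N₁), by positivity, θ, hθ, σ, hσ0, ?_⟩
  intro ι R A c T T' S u w f D p x₀ hT hT' hc hf htr hS hD hsh hconf hdiam hsize hsub hp hpg
    hball hbulk hE
  set g := transportResidual (interior A) b c u w f with hg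
  set E := etaSq (interior A) b c u w f (interior A) with hEdef
  set h : ι → ℝ := fun K => Metric.diam (R.cell K) with hh
  set a : ι → ℝ := fun K => ballNorm (innerRadius ϱ / 2) (x₀ K) (h K)
    (fun x => fderiv ℝ (p K) x b) with ha
  have hh0 : ∀ K, 0 < h K := fun K => R.diam_cell_pos hn K
  have ha0 : ∀ K, 0 ≤ a K := fun K => ballNorm_nonneg _ _ _ _
  have hΩb := hT.isBounded_interior
  have hρ := innerRadius_pos ϱ
  have hex : ∀ K ∈ S, _ := fun K hK => hbub ι R K (D K) (hD K hK) (hsh K hK) (hconf K hK)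
    (hdiam K hK) (p K) (hp K hK) (x₀ K) (hball K hK) (a K) rfl
  choose! z hzL hz0 hzI hzabs hzint using hex
  have hzout : ∀ K ∈ S, ∀ x, x ∉ interior (R.cell K) → z K x = 0 := by
    intro K hK x hx
    refine hz0 K hK x ?_
    by_contra hcon
    refine hx (interior_mono (hball K hK) (Metric.ball_subset_interior_closedBall ?_))
    rw [Metric.mem_ball]
    have := mul_pos hρ (hh0 K)
    simp only [hh] at this
    linarith [not_le.1 hcon]
  have hdout : ∀ K ∈ S, ∀ L ∈ T, L ≠ K → ∀ x ∈ interior (R.cell L),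
      lineDeriv ℝ (z K) x b = 0 := by
    intro K hK L hL hne x hx
    refine lineDeriv_eq_zero_of_eventually ?_
    filter_upwards [isOpen_interior.mem_nhds hx] with y hy
    exact hzout K hK y fun hy' => hne (hT.eq_of_mem hL (hS hK) hy hy')
  -- The inflow boundary lies in the frontier, outside the inner ball of `K`, hence an eighth of the
  -- inner radius away from every point where `z K` is nonzero.
  have hzH : ∀ K ∈ S, MemHZeroInflow (interior A) b (z K) := by
    intro K hK
    refine ⟨_, (hzL K hK).hasWeakDirDeriv hΩb, ?_⟩
    have hρh := mul_pos hρ (hh0 K)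
    refine (hzL K hK).isInflowLimit hΩb (δ := innerRadius ϱ * h K / 8) (by positivity)
      fun x hx y hy => hz0 K hK y ?_
    have hxf : x ∈ frontier (interior A) := by
      refine closure_minimal ?_ isClosed_frontier hx
      rintro x ⟨hx, -⟩
      exact hx
    have hxK : x ∉ interior (R.cell K) := fun hxK => by
      rw [isOpen_interior.frontier_eq] at hxf
      exact hxf.2 (hT.interior_cell_subset (hS hK) hxK)
    have h1 : innerRadius ϱ * h K ≤ dist x (x₀ K) := by
      by_contra hcon
      exact hxK (interior_mono (hball K hK) (Metric.ball_subset_interior_closedBall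
        (Metric.mem_ball.2 (not_le.1 hcon))))
    have h2 := dist_triangle x y (x₀ K)
    rw [Metric.mem_ball, dist_comm] at hy
    simp only [hh] at h1 hy hρh
    linarith
  set Z : EuclideanSpace ℝ (Fin n) → ℝ := fun x => ∑ K ∈ S, z K x with hZ
  set d : EuclideanSpace ℝ (Fin n) → ℝ := fun x => ∑ K ∈ S, lineDeriv ℝ (z K) x b with hd
  have hZd : HasWeakDirDeriv (interior A) b Z d :=
    hasWeakDirDeriv_sum hΩb S fun K hK => (hzL K hK).hasWeakDirDeriv hΩb
  have hZS : ∀ K ∈ S, ∀ x ∈ interior (R.cell K), Z x = z K x := fun K hK x hx =>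
    Finset.sum_eq_single_of_mem K hK fun L hL hne => hzout L hL x fun hx' =>
      hne (hT.eq_of_mem (hS hL) (hS hK) hx' hx)
  have hZ0 : ∀ K ∈ T, K ∉ S → ∀ x ∈ interior (R.cell K), Z x = 0 := fun K hK hKS x hx =>
    Finset.sum_eq_zero fun L hL => hzout L hL x fun hx' =>
      hKS (hT.eq_of_mem (hS hL) hK hx' hx ▸ hL)
  have hdS : ∀ K ∈ S, ∀ x ∈ interior (R.cell K), d x = lineDeriv ℝ (z K) x b :=
    fun K hK x hx => Finset.sum_eq_single_of_mem K hK fun L hL hne =>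
      hdout L hL K (hS hK) hne.symm x hx
  have hd0 : ∀ K ∈ T, K ∉ S → ∀ x ∈ interior (R.cell K), d x = 0 := fun K hK hKS x hx =>
    Finset.sum_eq_zero fun L hL => hdout L hL K hK (fun h => hKS (h ▸ hL)) x hx
  have hZpp : R.PiecewisePolynomial T' mw Z := by
    refine piecewisePolynomial_iff.2 fun L hL => ?_
    obtain ⟨K, hK, hLK, hor⟩ := hsub L hL
    by_cases hKS : K ∈ S
    · obtain ⟨I, hI⟩ := hzI K hKS L (hor.resolve_left (not_not.2 hKS))
      refine ⟨(fun x => I.linear x) + fun _ => I 0,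
        Submodule.add_mem _ (linear_mem_polyFun hmw I.linear) (const_mem_polyFun _),
        fun x hx => ?_⟩
      rw [hZS K hKS x (interior_mono hLK hx), hI x (interior_subset hx), Pi.add_apply]
      exact congrFun I.decomp x
    · exact ⟨0, Submodule.zero_mem _, fun x hx => hZ0 K hK hKS x (interior_mono hLK hx)⟩
  set Dsum := ∑ K ∈ S, h K ^ (n + 2) * a K ^ 2 with hDsum
  have hterm0 : ∀ K, 0 ≤ h K ^ (n + 2) * a K ^ 2 := fun K =>
    mul_nonneg (pow_nonneg (hh0 K).le _) (sq_nonneg _)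
  have hD0 : 0 ≤ Dsum := Finset.sum_nonneg fun K _ => hterm0 K
  have hDE : √δ * √E ≤ √Dsum := by
    rw [← Real.sqrt_mul hδ.le]
    exact Real.sqrt_le_sqrt hbulk
  have hE' : 0 < √E := Real.sqrt_pos.2 hE
  have hDp : 0 < √Dsum := lt_of_lt_of_le (by positivity) hDE
  have hKball : ∀ K ∈ S, R.cell K ⊆ Metric.closedBall (x₀ K) (h K) := fun K hK x hx =>
    Metric.mem_closedBall.2 (Metric.dist_le_diam_of_mem (R.isBounded_cell K) hx
      (hball K hK (Metric.mem_closedBall_self (mul_nonneg hρ.le (hh0 K).le))))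
  -- Used twice: with `s = σ` for `Z` and with `s = ‖b‖` for its derivative.
  have hcellbound : ∀ K ∈ S, ∀ F : EuclideanSpace ℝ (Fin n) → ℝ, ∀ s : ℝ, 0 ≤ s →
      (∀ x ∈ interior (R.cell K), |F x| ≤ s * (C * h K * a K)) →
      ∫ x in R.cell K, F x ^ 2 ≤ (μ * s) ^ 2 * (h K ^ (n + 2) * a K ^ 2) := by
    intro K hK F s hs hF
    have h1 := (le_abs_self _).trans (setIntegral_le_of_abs_le (f := fun x => F x ^ 2)
      (a := (s * (C * h K * a K)) ^ 2) (hh0 K).le (hKball K hK) (sq_nonneg _) (by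
        filter_upwards [R.ae_mem_interior_cell K] with x hx
        rw [abs_pow]
        exact pow_le_pow_left₀ (abs_nonneg _) (hF x hx) 2))
    refine h1.trans_eq ?_
    have h2 : (μ * s) ^ 2 = unitBallVolume n * (C * s) ^ 2 := by
      rw [hμdef, mul_assoc, mul_pow, Real.sq_sqrt hμ]
    rw [h2]
    ring
  have hZsq : ∫ x in interior A, Z x ^ 2 ≤ (μ * σ) ^ 2 * Dsum := by
    rw [hT.setIntegral_eq_sum_of_subset hS hZd.1.integrable_sq fun K hK hKS x hx => by
      rw [hZ0 K hK hKS x hx]; norm_num, hDsum, Finset.mul_sum]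
    refine Finset.sum_le_sum fun K hK => hcellbound K hK Z σ hσ0.le fun x hx => ?_
    rw [hZS K hK x hx]
    refine (hzabs K hK x).trans ?_
    have h1 : C * h K ^ 2 * a K = h K * (C * h K * a K) := by ring
    rw [h1]
    exact mul_le_mul_of_nonneg_right (hsize K hK)
      (mul_nonneg (mul_nonneg hC.le (hh0 K).le) (ha0 K))
  have hdsq : ∫ x in interior A, d x ^ 2 ≤ (μ * ‖b‖) ^ 2 * Dsum := by
    rw [hT.setIntegral_eq_sum_of_subset hS hZd.2.1.integrable_sq fun K hK hKS x hx => by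
      rw [hd0 K hK hKS x hx]; norm_num, hDsum, Finset.mul_sum]
    refine Finset.sum_le_sum fun K hK => hcellbound K hK d ‖b‖ (norm_nonneg b) fun x hx => ?_
    rw [hdS K hK x hx, ← Real.norm_eq_abs]
    refine (norm_lineDeriv_le_of_lipschitz ℝ (hzL K hK)).trans_eq ?_
    rw [Real.coe_toNNReal _ (mul_nonneg (mul_nonneg hC.le (hh0 K).le) (ha0 K)), mul_comm]
  have hgd : Dsum / 2 ≤ ∫ x in interior A, g x * d x := by
    have hgL := htr.memLp_residual hT hc hf
    have i1 : IntegrableOn (fun x => g x * d x) (interior A) := hgL.integrable_mul hZd.2.1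
    rw [hT.setIntegral_eq_sum_of_subset hS i1 fun K hK hKS x hx => by
      rw [hd0 K hK hKS x hx, mul_zero], hDsum, Finset.sum_div]
    refine Finset.sum_le_sum fun K hK => (hzint K hK).trans_eq (integral_congr_ae ?_)
    filter_upwards [hpg K hK, R.ae_mem_interior_cell K] with x hx hxK
    rw [hx, hdS K hK x hxK]
  refine ⟨0, Z, d, N₁ * √Dsum, ⟨piecewisePolynomial_zero, hZpp, memHZeroInflow_sum hΩb S hzH⟩,
    hZd, by positivity, ?_, ?_⟩
  · simp only [Pi.zero_apply, zero_sub, neg_sq, mul_zero, add_zero]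
    rw [mul_pow, Real.sq_sqrt hD0]
    refine (add_le_add hZsq hdsq).trans ?_
    rw [← add_mul]
    refine mul_le_mul_of_nonneg_right ?_ hD0
    have h1 : 0 ≤ μ * σ := by positivity
    have h2 : 0 ≤ μ * ‖b‖ := by positivity
    rw [hN₁, mul_add]
    nlinarith [mul_nonneg h1 h2]
  · simp only [Pi.zero_apply, zero_sub, mul_zero, add_zero]
    have heL := htr.memLp_diff hT
    have h1 := (abs_le.1 (abs_integral_mul_le heL hZd.1.neg)).1
    simp only [Pi.neg_apply, neg_sq] at h1
    have h2 : √(∫ x in interior A, (u x - w x) ^ 2) ≤ √E := by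
      refine Real.sqrt_le_sqrt ?_
      rw [hEdef, etaSq]
      exact le_add_of_nonneg_right (integral_nonneg fun _ => sq_nonneg _)
    have h3 : √(∫ x in interior A, Z x ^ 2) ≤ μ * σ * √Dsum := by
      refine (Real.sqrt_le_sqrt hZsq).trans_eq ?_
      rw [Real.sqrt_mul (sq_nonneg _), Real.sqrt_sq (by positivity)]
    have h4 : √(∫ x in interior A, (u x - w x) ^ 2) * √(∫ x in interior A, Z x ^ 2) ≤
        √E * (√δ / 4 * √Dsum) :=
      mul_le_mul h2 (h3.trans (mul_le_mul_of_nonneg_right hμσ hDp.le)) (Real.sqrt_nonneg _) hE'.le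
    have h5 : √δ / (4 * N₁) * √E * (N₁ * √Dsum) = √δ * √E * √Dsum / 4 := by
      field_simp
    have h6 : Dsum = √Dsum * √Dsum := (Real.mul_self_sqrt hD0).symm
    have h7 : √δ * √E * √Dsum ≤ √Dsum * √Dsum := mul_le_mul_of_nonneg_right hDE hDp.le
    rw [h5]
    linarith

end Descent

end RefinementRule


/-! ### Streamline averages -/

section LineAverage

variable {n : ℕ} {b : EuclideanSpace ℝ (Fin n)} {K : Set (EuclideanSpace ℝ (Fin n))}

/-- By convexity the line meets `K` in a segment of parameter length at most `diam K / ‖b‖`. By the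
mean value inequality `p` stays on it in a closed ball around `p x`, which then contains the
average. -/
theorem lineAverage_mem_closedBall (hb : b ≠ 0) (hK : IsCompact K) (hKc : Convex ℝ K)
    {p : EuclideanSpace ℝ (Fin n) → ℝ} (hp : ContDiff ℝ ∞ p) {G : ℝ}
    (hG : ∀ y ∈ K, |fderiv ℝ p y b| ≤ G) {x : EuclideanSpace ℝ (Fin n)} (hx : x ∈ interior K) :
    |lineAverage b K p x - p x| ≤ Metric.diam K / ‖b‖ * G := by
  have hb' : 0 < ‖b‖ := norm_pos_iff.2 hb
  set S : Set ℝ := {t : ℝ | x + t • b ∈ K} with hS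
  have hcont : Continuous fun t : ℝ => x + t • b := by fun_prop
  have hxK : x ∈ K := interior_subset hx
  have hG0 : 0 ≤ G := (abs_nonneg _).trans (hG x hxK)
  have hSconv : Convex ℝ S := by
    intro t ht t' ht' α β hα hβ hαβ
    have h1 := hKc ht ht' hα hβ hαβ
    have h2 : x + (α • t + β • t') • b = α • (x + t • b) + β • (x + t' • b) := by
      rw [smul_add, smul_add, add_add_add_comm, ← add_smul, hαβ, one_smul, add_smul,
        smul_assoc, smul_assoc]
    change x + (α • t + β • t') • b ∈ K
    rwa [h2]
  have hSabs : ∀ t ∈ S, |t| ≤ Metric.diam K / ‖b‖ := by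
    intro t ht
    rw [le_div_iff₀ hb']
    have h1 := Metric.dist_le_diam_of_mem hK.isBounded ht hxK
    rwa [dist_self_add_left, norm_smul, Real.norm_eq_abs] at h1
  have hSsub : S ⊆ Metric.closedBall 0 (Metric.diam K / ‖b‖) := fun t ht => by
    rw [Metric.mem_closedBall, dist_zero_right, Real.norm_eq_abs]
    exact hSabs t ht
  have hSmeas : MeasurableSet S := (hK.isClosed.preimage hcont).measurableSet
  have h0S : S ∈ 𝓝 (0 : ℝ) := by
    refine hcont.continuousAt.preimage_mem_nhds ?_
    simp only [zero_smul, add_zero]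
    exact mem_interior_iff_mem_nhds.1 hx
  have hSpos : volume S ≠ 0 := (Measure.measure_pos_of_mem_nhds volume h0S).ne'
  have hSfin : volume S ≠ ⊤ :=
    ((measure_mono hSsub).trans_lt measure_closedBall_lt_top).ne
  have hderiv : ∀ t ∈ S, HasDerivWithinAt (fun t : ℝ => p (x + t • b))
      (fderiv ℝ p (x + t • b) b) S t := by
    intro t ht
    have h1 : HasDerivAt (fun t : ℝ => x + t • b) b t := by
      simpa using ((hasDerivAt_id t).smul_const b).const_add x
    exact ((hp.differentiable (by simp) (x + t • b)).hasFDerivAt.comp_hasDerivAt t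
      h1).hasDerivWithinAt
  have hdiff : ∀ t ∈ S, p (x + t • b) ∈ Metric.closedBall (p x) (Metric.diam K / ‖b‖ * G) := by
    intro t ht
    have h1 := hSconv.norm_image_sub_le_of_norm_hasDerivWithin_le hderiv
      (fun t ht => (Real.norm_eq_abs _).trans_le (hG _ ht)) (mem_of_mem_nhds h0S) ht
    rw [zero_smul, add_zero, sub_zero, Real.norm_eq_abs t] at h1
    rw [Metric.mem_closedBall, dist_eq_norm]
    refine h1.trans ?_
    rw [mul_comm]
    exact mul_le_mul_of_nonneg_right (hSabs t ht) hG0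
  have hint : IntegrableOn (fun t : ℝ => p (x + t • b)) S :=
    ((hp.continuous.comp hcont).continuousOn.integrableOn_compact
      (isCompact_closedBall 0 (Metric.diam K / ‖b‖))).mono_set hSsub
  have h2 := (convex_closedBall (p x) (Metric.diam K / ‖b‖ * G)).set_average_mem
    Metric.isClosed_closedBall hSpos hSfin
    ((ae_restrict_iff' hSmeas).2 (ae_of_all _ hdiff)) hint
  rwa [Metric.mem_closedBall, Real.dist_eq] at h2

/-- By Fubini, almost every line in direction `b` meets a given null set in a one-dimensional null
set. This is needed because the residual is a polynomial only almost everywhere. -/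
theorem lineAverage_ae_eq (hK : MeasurableSet K) {g p : EuclideanSpace ℝ (Fin n) → ℝ}
    (h : g =ᵐ[volume.restrict K] p) : lineAverage b K g =ᵐ[volume] lineAverage b K p := by
  have hset : ∀ᵐ x ∂(volume : Measure (EuclideanSpace ℝ (Fin n))),
      x ∈ (toMeasurable volume {x | ¬ (x ∈ K → g x = p x)})ᶜ := by
    have h1 := (ae_restrict_iff' hK).1 h
    rw [ae_iff] at h1
    rw [ae_iff]
    simpa [measure_toMeasurable] using h1
  have h2 := (ae_ae_add_linearMap_mem_iff (LinearMap.toSpanSingleton ℝ (EuclideanSpace ℝ (Fin n)) b)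
    volume volume (measurableSet_toMeasurable _ _).compl).2 hset
  filter_upwards [h2] with x hx
  have hmeas : MeasurableSet {t : ℝ | x + t • b ∈ K} :=
    hK.preimage (by fun_prop : Measurable fun t : ℝ => x + t • b)
  rw [lineAverage, lineAverage, setAverage_eq, setAverage_eq]
  congr 1
  refine setIntegral_congr_ae hmeas ?_
  filter_upwards [hx] with t ht htK
  by_contra hne
  exact ht (subset_toMeasurable _ _ (by
    rw [LinearMap.toSpanSingleton_apply]
    exact fun hc => hne (hc htK)))

theorem measurable_lineAverage (hK : MeasurableSet K) {p : EuclideanSpace ℝ (Fin n) → ℝ}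
    (hp : Continuous p) : Measurable (lineAverage b K p) := by
  have hmap : Measurable fun q : EuclideanSpace ℝ (Fin n) × ℝ => q.1 + q.2 • b := by fun_prop
  have hset : MeasurableSet {q : EuclideanSpace ℝ (Fin n) × ℝ | q.1 + q.2 • b ∈ K} :=
    hK.preimage hmap
  have h1 : Measurable fun x : EuclideanSpace ℝ (Fin n) =>
      (volume {t : ℝ | x + t • b ∈ K}) := measurable_measure_prodMk_left hset
  have h2 : Measurable fun x : EuclideanSpace ℝ (Fin n) =>
      ∫ t in {t : ℝ | x + t • b ∈ K}, p (x + t • b) := by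
    have h3 : (fun x : EuclideanSpace ℝ (Fin n) =>
        ∫ t in {t : ℝ | x + t • b ∈ K}, p (x + t • b)) = fun x => ∫ t : ℝ,
        ({q : EuclideanSpace ℝ (Fin n) × ℝ | q.1 + q.2 • b ∈ K}.indicator
          (fun q => p (q.1 + q.2 • b))) (x, t) := by
      funext x
      have hmeas : MeasurableSet {t : ℝ | x + t • b ∈ K} :=
        hK.preimage (by fun_prop : Measurable fun t : ℝ => x + t • b)
      rw [← integral_indicator hmeas]
      rfl
    rw [h3]
    exact (((hp.measurable.comp hmap).stronglyMeasurable.indicator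
      hset).integral_prod_right' (ν := volume)).measurable
  have h4 : lineAverage b K p = fun x => (volume {t : ℝ | x + t • b ∈ K}).toReal⁻¹ *
      ∫ t in {t : ℝ | x + t • b ∈ K}, p (x + t • b) := by
    funext x
    rw [lineAverage, setAverage_eq]
    rfl
  rw [h4]
  exact h1.ennreal_toReal.inv.mul h2

end LineAverage

namespace RefinementRule

variable {n : ℕ}

/-- A Poincaré inequality along streamlines; its right-hand side is the quantity that the bubbles
detect. -/
theorem exists_lineAverage_bound (hn : 1 ≤ n) {b : EuclideanSpace ℝ (Fin n)} (hb : b ≠ 0) (m : ℕ)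
    (ϱ : ℝ) :
    ∃ C : ℝ, 0 < C ∧ ∀ (ι : Type u) (R : RefinementRule n ι) (K : ι), ∀ p ∈ polyFun n m, ∀ x₀,
      Metric.closedBall x₀ (innerRadius ϱ * Metric.diam (R.cell K)) ⊆ R.cell K →
      ∀ g : EuclideanSpace ℝ (Fin n) → ℝ, g =ᵐ[volume.restrict (R.cell K)] p →
        MemLp (lineAverage b (R.cell K) g) 2 (volume.restrict (R.cell K)) ∧
        ∫ x in R.cell K, (g x - lineAverage b (R.cell K) g x) ^ 2 ≤
          C * (Metric.diam (R.cell K) ^ (n + 2) * ballNorm (innerRadius ϱ / 2) x₀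
            (Metric.diam (R.cell K)) (fun x => fderiv ℝ p x b) ^ 2) := by
  obtain ⟨C, hC, hbound⟩ := exists_ballNorm_bound n m (half_pos (innerRadius_pos ϱ))
  have hμ := unitBallVolume_nonneg (n := n)
  have hb' : 0 < ‖b‖ := norm_pos_iff.2 hb
  refine ⟨(unitBallVolume n + 1) * (C / ‖b‖) ^ 2, by positivity, ?_⟩
  intro ι R K p hp x₀ hx₀ g hg
  set h := Metric.diam (R.cell K) with hh
  have hh0 : 0 < h := R.diam_cell_pos hn K
  set a := ballNorm (innerRadius ϱ / 2) x₀ h (fun x => fderiv ℝ p x b) with ha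
  have ha0 : 0 ≤ a := ballNorm_nonneg _ _ _ _
  have hx₀K : x₀ ∈ R.cell K :=
    hx₀ (Metric.mem_closedBall_self (mul_nonneg (innerRadius_pos ϱ).le hh0.le))
  have hKball : R.cell K ⊆ Metric.closedBall x₀ h := fun x hx =>
    Metric.mem_closedBall.2 (Metric.dist_le_diam_of_mem (R.isBounded_cell K) hx hx₀K)
  have hGb := (hbound _ (fderiv_apply_mem_polyFun hp b) x₀ h hh0).1
  have hpt : ∀ x ∈ interior (R.cell K), |lineAverage b (R.cell K) p x - p x| ≤ h / ‖b‖ * (C * a) :=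
    fun x hx => lineAverage_mem_closedBall hb (R.isCompact_cell K) (R.convex_cell K)
      (contDiff_of_mem_polyFun hp) (fun y hy => hGb y (hKball hy)) hx
  have hae := ae_restrict_of_ae (s := R.cell K)
    (lineAverage_ae_eq (b := b) (R.measurableSet_cell K) hg)
  have hpL : MemLp p 2 (volume.restrict (R.cell K)) :=
    memLp_restrict_of_continuous (R.isBounded_cell K) 2 (continuous_of_mem_polyFun hp)
  have : IsFiniteMeasure (volume.restrict (R.cell K)) :=
    isFiniteMeasure_restrict.2 (R.volume_cell_lt_top K).ne
  have hdL : MemLp (fun x => lineAverage b (R.cell K) p x - p x) 2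
      (volume.restrict (R.cell K)) := by
    refine MemLp.of_bound ((measurable_lineAverage (R.measurableSet_cell K)
      (continuous_of_mem_polyFun hp)).sub
      (continuous_of_mem_polyFun hp).measurable).aestronglyMeasurable (h / ‖b‖ * (C * a)) ?_
    filter_upwards [R.ae_mem_interior_cell K] with x hx using hpt x hx
  constructor
  · refine MemLp.ae_eq ?_ (hdL.add hpL)
    filter_upwards [hae] with x hx
    rw [hx]
    simp
  · have h1 := setIntegral_le_of_abs_le hh0.le hKball
      (f := fun x => (g x - lineAverage b (R.cell K) g x) ^ 2)
      (sq_nonneg (h / ‖b‖ * (C * a))) (by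
        filter_upwards [R.ae_mem_interior_cell K, hae, hg] with x hx hx2 hx3
        rw [hx2, hx3, abs_pow, abs_sub_comm]
        exact pow_le_pow_left₀ (abs_nonneg _) (hpt x hx) 2)
    refine ((le_abs_self _).trans h1).trans ?_
    have h2 : unitBallVolume n * h ^ n * (h / ‖b‖ * (C * a)) ^ 2 =
        unitBallVolume n * ((C / ‖b‖) ^ 2 * (h ^ (n + 2) * a ^ 2)) := by
      rw [pow_add]; ring
    rw [h2, mul_assoc]
    exact mul_le_mul_of_nonneg_right (by linarith) (by positivity)

end RefinementRule

/-! ### Descent from the function supplied by the conjecture -/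

namespace RefinementRule

variable {n : ℕ}

/-- If `∂_b z + c z ≈ F` and `v ≈ z`, the image of `(v, z)` is nearly `(0, F)`, and its pairing with
the residual is nearly `∫ g F ≈ ‖F‖²`. The error `ξ ‖F‖` is paired with all of `g`, which costs `ξ
√E ‖F‖`; this is affordable since `‖F‖` is almost `ξ₀ √E` with `ξ < ξ₀`. -/
theorem exists_hasDescent_of_transport (hn : 1 ≤ n) (mu mw mf : ℕ) (ϱ : ℝ) {ξ₀ ξ γ : ℝ} (C : ℝ)
    (hξ₀ : 0 < ξ₀) (hξ : ξ < ξ₀) (hγ : 0 ≤ γ) :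
    ∃ κ : ℝ, 0 < κ ∧ ∃ τ : ℝ, 0 < τ ∧ ∃ θ : ℝ, 0 < θ ∧ ∀ (ι : Type u) (R : RefinementRule n ι)
      (A : Set (EuclideanSpace ℝ (Fin n))) (b : EuclideanSpace ℝ (Fin n))
      (c : EuclideanSpace ℝ (Fin n) → ℝ) (T T₁ T' S : Finset ι)
      (u w f F z : EuclideanSpace ℝ (Fin n) → ℝ),
      R.Tiles T A → R.Tiles T₁ A → R.Tiles T' A → (∀ K ∈ T₁, shapeParameter (R.cell K) ≤ ϱ) →
      R.PiecewisePolynomial T 0 c → (∀ᵐ x ∂(volume.restrict (interior A)), |c x| ≤ γ) →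
      R.PiecewisePolynomial T mf f → R.MemTrial (interior A) b mu mw T u w → S ⊆ T →
      MemLp F 2 (volume.restrict (interior A)) →
      (∀ K ∈ T, K ∉ S → ∀ x ∈ interior (R.cell K), F x = 0) →
      √(∑ K ∈ S, ∫ x in R.cell K, (transportResidual (interior A) b c u w f x - F x) ^ 2) ≤
        τ * √(etaSq (interior A) b c u w f (interior A)) →
      ξ₀ * √(etaSq (interior A) b c u w f (interior A)) ≤
        √(∑ K ∈ S, ∫ x in R.cell K, (transportResidual (interior A) b c u w f x) ^ 2) →
      R.MemTrial (interior A) b mu mw T₁ 0 z → R.IsFiner T₁ T' →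
      √(∫ x in interior A, (weakDirDeriv (interior A) b z x + c x * z x - F x) ^ 2) ≤
        ξ * √(∫ x in interior A, F x ^ 2) →
      √(∫ x in interior A, z x ^ 2) ≤ C * √(∫ x in interior A, F x ^ 2) →
      (∀ L ∈ T', ∃ K ∈ T₁, R.cell L ⊆ R.cell K ∧ ((∀ x ∈ interior (R.cell K), z x = 0) ∨
        Metric.diam (R.cell L) ≤ θ * Metric.diam (R.cell K))) →
      0 < etaSq (interior A) b c u w f (interior A) →
      R.HasDescent (interior A) b c mu mw T' u w f κ := by
  obtain ⟨Cs, hCs, hsample⟩ := exists_sampling_bound.{u} hn mw ϱ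
  set ξp := max ξ 0 with hξp
  have hξp0 : 0 ≤ ξp := le_max_right _ _
  have hμ : 0 < ξ₀ - ξp := sub_pos.2 (max_lt hξ hξ₀)
  -- The gap `μ` is the whole budget: `μ / 8` is spent twice on replacing `g` by `F`, `μ / 4` on
  -- sampling `z`, and `μ / 2` remains. The positive parts of `ξ` and `C` allow for negative
  -- constants.
  set μ := ξ₀ - ξp with hμdef
  set ε := μ / (4 * (1 + γ)) with hε
  have hε0 : 0 < ε := by positivity
  set Cp := max C 0 with hCp
  have hCp0 : 0 ≤ Cp := le_max_right _ _
  set N₁ := ε + ξp + 1 + γ * ε with hN₁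
  have hN₁0 : 0 < N₁ := by positivity
  refine ⟨μ / (2 * N₁), by positivity, μ / 8, by positivity, ε / (Cs * (Cp + 1)),
    by positivity, ?_⟩
  intro ι R A b c T T₁ T' S u w f F z hT hT₁ hT' hsh hc hcγ hf htr hS hFL hF0 hgF hgS hz hfine
    hres hzC hsub hE
  set g := transportResidual (interior A) b c u w f with hg
  set E := etaSq (interior A) b c u w f (interior A) with hEdef
  set d := weakDirDeriv (interior A) b z with hd
  have hE' : 0 < √E := Real.sqrt_pos.2 hE
  have hgL : MemLp g 2 (volume.restrict (interior A)) := htr.memLp_residual hT hc hf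
  have heL := htr.memLp_diff hT
  have hzd : HasWeakDirDeriv (interior A) b z d := hz.2.2.hasWeakDirDeriv
  set X := √(∫ x in interior A, F x ^ 2) with hX
  have hX0 : 0 ≤ X := Real.sqrt_nonneg _
  have hX2 : X ^ 2 = ∫ x in interior A, F x ^ 2 :=
    Real.sq_sqrt (integral_nonneg fun _ => sq_nonneg _)
  set v := R.stepFun T' (fun L => z (R.interiorPoint L)) with hv
  have hvpp : R.PiecewisePolynomial T' mu v := hT'.piecewisePolynomial_stepFun _
  have hvL := hvpp.memLp hT' 2
  have hcL : MemLp c ⊤ (volume.restrict (interior A)) := hc.memLp hT ⊤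
  -- the residual and its restriction to the cells in `S`
  have hgP : MemLp (R.pieceFun S fun _ => g) 2 (volume.restrict (interior A)) :=
    hT.memLp_pieceFun hS fun K hK => hgL.mono_measure (hT.restrict_cell_le (hS hK))
  set gS := R.pieceFun S fun _ => g with hgSdef
  have hgFL : MemLp (fun x => gS x - F x) 2 (volume.restrict (interior A)) := hgP.sub hFL
  have hgS_eq : ∫ x in interior A, gS x ^ 2 = ∑ K ∈ S, ∫ x in R.cell K, g x ^ 2 :=
    hT.integral_pieceFun_sq hS fun K hK => hgL.mono_measure (hT.restrict_cell_le (hS hK))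
  have hgF_eq : ∫ x in interior A, (gS x - F x) ^ 2 =
      ∑ K ∈ S, ∫ x in R.cell K, (g x - F x) ^ 2 := by
    rw [hT.setIntegral_eq_sum_of_subset hS hgFL.integrable_sq fun K hK hKS x hx => by
      simp [hgSdef, hT.pieceFun_eq_zero hS _ hK hKS hx, hF0 K hK hKS x hx]]
    refine Finset.sum_congr rfl fun K hK => integral_congr_ae
      (ae_restrict_cell_of_interior fun x hx => ?_)
    simp only [hgSdef, hT.pieceFun_eq hS _ hK hx]
  rw [← hgS_eq] at hgS
  rw [← hgF_eq] at hgF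
  have hXE : (ξ₀ - μ / 8) * √E ≤ X := by
    have h1 := sqrt_integral_add_sq_le (hgP.sub hFL) hFL
    simp only [Pi.sub_apply, sub_add_cancel] at h1
    rw [sub_mul]
    linarith
  have hξμ : 0 < ξ₀ - μ / 8 := by
    have : μ ≤ ξ₀ := by rw [hμdef]; linarith
    linarith
  have hXpos : 0 < X := lt_of_lt_of_le (mul_pos hξμ hE') hXE
  -- the sampling error
  have hstep : √(∫ x in interior A, (v x - z x) ^ 2) ≤ ε * X := by
    refine (hsample ι R A T₁ T' hT₁ hT' hsh z _ (by positivity) hz.2.1 hsub).trans ?_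
    have h1 : √(∫ x in interior A, z x ^ 2) ≤ (Cp + 1) * X :=
      hzC.trans (mul_le_mul_of_nonneg_right (by linarith [le_max_left C 0]) hX0)
    refine (mul_le_mul_of_nonneg_left h1 (by positivity)).trans_eq ?_
    field_simp
  have hvzL : MemLp (fun x => v x - z x) 2 (volume.restrict (interior A)) := hvL.sub hzd.1
  have hczL : MemLp (fun x => c x * z x) 2 (volume.restrict (interior A)) := hzd.1.mul hcL
  have hcvzL : MemLp (fun x => c x * (v x - z x)) 2 (volume.restrict (interior A)) :=
    hvzL.mul hcL
  have hcstep : √(∫ x in interior A, (c x * (v x - z x)) ^ 2) ≤ γ * (ε * X) :=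
    (sqrt_integral_mul_sq_le hγ hcγ hvzL).trans (mul_le_mul_of_nonneg_left hstep hγ)
  have hrL : MemLp (fun x => d x + c x * z x - F x) 2 (volume.restrict (interior A)) :=
    (hzd.2.1.add hczL).sub hFL
  have hres' : √(∫ x in interior A, (d x + c x * z x - F x) ^ 2) ≤ ξp * X :=
    hres.trans (mul_le_mul_of_nonneg_right (le_max_left _ _) hX0)
  have hGE : √(∫ x in interior A, g x ^ 2) ≤ √E :=
    Real.sqrt_le_sqrt (le_add_of_nonneg_left (integral_nonneg fun _ => sq_nonneg _))
  have heE : √(∫ x in interior A, (u x - w x) ^ 2) ≤ √E :=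
    Real.sqrt_le_sqrt (le_add_of_nonneg_right (integral_nonneg fun _ => sq_nonneg _))
  have hsplit : ∀ x, d x + c x * v x = ((d x + c x * z x - F x) + c x * (v x - z x)) + F x :=
    fun x => by ring
  refine ⟨v, z, d, N₁ * X, ⟨hvpp, (hz.of_isFiner hfine).2⟩, hzd, by positivity, ?_, ?_⟩
  · have h1 : ∫ x in interior A, (v x - z x) ^ 2 ≤ (ε * X) ^ 2 := by
      rw [← Real.sq_sqrt (integral_nonneg fun x => sq_nonneg (v x - z x) :
        0 ≤ ∫ x in interior A, (v x - z x) ^ 2)]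
      exact pow_le_pow_left₀ (Real.sqrt_nonneg _) hstep 2
    have h2 : √(∫ x in interior A, (d x + c x * v x) ^ 2) ≤ (ξp + γ * ε + 1) * X := by
      have h3 := sqrt_integral_add_sq_le (hrL.add hcvzL) hFL
      have h4 := sqrt_integral_add_sq_le hrL hcvzL
      simp only [Pi.add_apply] at h3
      simp only [hsplit]
      refine h3.trans ?_
      have h5 : (ξp + γ * ε + 1) * X = ξp * X + γ * (ε * X) + X := by ring
      rw [h5]
      linarith
    have h3 : ∫ x in interior A, (d x + c x * v x) ^ 2 ≤ ((ξp + γ * ε + 1) * X) ^ 2 := by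
      rw [← Real.sq_sqrt (integral_nonneg fun x => sq_nonneg (d x + c x * v x) :
        0 ≤ ∫ x in interior A, (d x + c x * v x) ^ 2)]
      exact pow_le_pow_left₀ (Real.sqrt_nonneg _) h2 2
    have h4 : N₁ * X = ε * X + (ξp + γ * ε + 1) * X := by rw [hN₁]; ring
    rw [h4]
    nlinarith [mul_nonneg (mul_nonneg hε0.le hX0)
      (mul_nonneg (by positivity : 0 ≤ ξp + γ * ε + 1) hX0)]
  · have h1 := (abs_le.1 (abs_integral_mul_le heL hvzL)).1
    have h2 := (abs_le.1 (abs_integral_mul_le hgL hrL)).1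
    have h3 := (abs_le.1 (abs_integral_mul_le hgL hcvzL)).1
    have h4 : X ^ 2 - μ / 8 * √E * X ≤ ∫ x in interior A, g x * F x := by
      have h5 : ∫ x in interior A, g x * F x =
          (∫ x in interior A, F x ^ 2) + ∫ x in interior A, (gS x - F x) * F x := by
        have i1 : Integrable (fun x => (gS x - F x) * F x) (volume.restrict (interior A)) :=
          hgFL.integrable_mul hFL
        rw [← integral_add hFL.integrable_sq i1]
        refine integral_congr_ae ?_
        filter_upwards [hT.ae_exists] with x ⟨K, hK, hxK⟩
        by_cases hKS : K ∈ S
        · rw [hgSdef, hT.pieceFun_eq hS _ hKS hxK]; ring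
        · rw [hF0 K hK hKS x hxK]; ring
      have h6 := (abs_le.1 (abs_integral_mul_le hgFL hFL)).1
      rw [h5, ← hX2]
      have h7 := mul_le_mul_of_nonneg_right hgF hX0
      linarith
    have h5 : ∫ x in interior A, g x * (d x + c x * v x) =
        ((∫ x in interior A, g x * (d x + c x * z x - F x)) +
          ∫ x in interior A, g x * (c x * (v x - z x))) + ∫ x in interior A, g x * F x := by
      have i1 : Integrable (fun x => g x * (d x + c x * z x - F x))
        (volume.restrict (interior A)) := hgL.integrable_mul hrL
      have i2 : Integrable (fun x => g x * (c x * (v x - z x)))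
        (volume.restrict (interior A)) := hgL.integrable_mul hcvzL
      have i3 : Integrable (fun x => g x * F x) (volume.restrict (interior A)) :=
        hgL.integrable_mul hFL
      have i4 : Integrable (fun x => g x * (d x + c x * z x - F x) + g x * (c x * (v x - z x)))
        (volume.restrict (interior A)) := i1.add i2
      rw [← integral_add i1 i2, ← integral_add i4 i3]
      exact integral_congr_ae (ae_of_all _ fun x => by simp only [hsplit x]; ring)
    have k1 := mul_le_mul heE hstep (Real.sqrt_nonneg _) hE'.le
    have k2 := mul_le_mul hGE hres' (Real.sqrt_nonneg _) hE'.le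
    have k3 := mul_le_mul hGE hcstep (Real.sqrt_nonneg _) hE'.le
    have k4 : (ξ₀ - μ / 8) * √E * X ≤ X * X := mul_le_mul_of_nonneg_right hXE hX0
    have k5 : μ / (2 * N₁) * √E * (N₁ * X) = μ / 2 * (√E * X) := by field_simp
    have k6 : (1 + γ) * ε = μ / 4 := by rw [hε]; field_simp
    have k7 : √E * (ε * X) + √E * (γ * (ε * X)) = μ / 4 * (√E * X) := by rw [← k6]; ring
    have k8 : ξ₀ = μ + ξp := by rw [hμdef]; ring
    rw [h5, k5]
    rw [k8] at k4
    have k9 : (μ + ξp - μ / 8) * √E * X =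
        7 / 8 * μ * (√E * X) + √E * (ξp * X) := by ring
    have k10 : μ / 8 * √E * X = μ / 8 * (√E * X) := by ring
    rw [k9, ← pow_two] at k4
    rw [k10] at h4
    linarith

end RefinementRule

/-! ### Intervals: coordinates, ends and automatic conformity -/

section OneDimensional

/-- The coordinate `t` of the point `t • b` of the line. -/
def lineCoord (b : EuclideanSpace ℝ (Fin 1)) : EuclideanSpace ℝ (Fin 1) →L[ℝ] ℝ :=
  (b 0)⁻¹ • EuclideanSpace.proj 0

variable {b : EuclideanSpace ℝ (Fin 1)}

theorem apply_zero_ne_zero (hb : b ≠ 0) : b 0 ≠ 0 := fun h => hb (by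
  ext i
  rw [Subsingleton.elim i 0, h]
  rfl)

theorem lineCoord_self (hb : b ≠ 0) : lineCoord b b = 1 := by
  simp [lineCoord, apply_zero_ne_zero hb]

theorem lineCoord_smul_self (hb : b ≠ 0) (x : EuclideanSpace ℝ (Fin 1)) :
    lineCoord b x • b = x := by
  ext i
  rw [Subsingleton.elim i 0]
  simp [lineCoord]
  field_simp [apply_zero_ne_zero hb]

theorem lineCoord_smul (hb : b ≠ 0) (t : ℝ) : lineCoord b (t • b) = t := by
  rw [map_smul, lineCoord_self hb, smul_eq_mul, mul_one]

theorem lineCoord_add_smul (hb : b ≠ 0) (x : EuclideanSpace ℝ (Fin 1)) (t : ℝ) :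
    lineCoord b (x + t • b) = lineCoord b x + t := by
  rw [map_add, lineCoord_smul hb]

theorem lineCoord_injective (hb : b ≠ 0) : Function.Injective (lineCoord b) := fun x y h => by
  rw [← lineCoord_smul_self hb x, h, lineCoord_smul_self hb]

theorem norm_sub_eq_lineCoord (hb : b ≠ 0) (x y : EuclideanSpace ℝ (Fin 1)) :
    ‖x - y‖ = |lineCoord b x - lineCoord b y| * ‖b‖ := by
  conv_lhs => rw [← lineCoord_smul_self hb x, ← lineCoord_smul_self hb y, ← sub_smul, norm_smul]
  rw [Real.norm_eq_abs]

theorem isOpenMap_lineCoord (hb : b ≠ 0) : IsOpenMap (lineCoord b) :=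
  (lineCoord b).isOpenMap fun t => ⟨t • b, lineCoord_smul hb t⟩

namespace RefinementRule

variable {ι : Type u} {R : RefinementRule 1 ι}

/-- The initial point of the interval `K` with respect to the direction `b`. -/
def leftEnd (R : RefinementRule 1 ι) (b : EuclideanSpace ℝ (Fin 1)) (K : ι) : ℝ :=
  min (lineCoord b ((R.simplex K).points 0)) (lineCoord b ((R.simplex K).points 1))

/-- The final point of the interval `K` with respect to the direction `b`. -/
def rightEnd (R : RefinementRule 1 ι) (b : EuclideanSpace ℝ (Fin 1)) (K : ι) : ℝ :=
  max (lineCoord b ((R.simplex K).points 0)) (lineCoord b ((R.simplex K).points 1))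

theorem leftEnd_lt_rightEnd (hb : b ≠ 0) (K : ι) : R.leftEnd b K < R.rightEnd b K := by
  refine min_lt_max.2 fun h => ?_
  have := (R.simplex K).independent.injective (lineCoord_injective hb h)
  exact absurd this (by decide)

theorem range_points (hb : b ≠ 0) (K : ι) :
    Set.range (R.simplex K).points = {R.leftEnd b K • b, R.rightEnd b K • b} := by
  have h1 : Set.range (R.simplex K).points =
      {(R.simplex K).points 0, (R.simplex K).points 1} := by
    ext x
    simp [Fin.exists_fin_two, eq_comm]
  rw [h1, leftEnd, rightEnd]
  rcases le_total (lineCoord b ((R.simplex K).points 0)) (lineCoord b ((R.simplex K).points 1))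
    with h | h
  · rw [min_eq_left h, max_eq_right h, lineCoord_smul_self hb, lineCoord_smul_self hb]
  · rw [min_eq_right h, max_eq_left h, lineCoord_smul_self hb, lineCoord_smul_self hb,
      Set.pair_comm]

theorem cell_eq_preimage (hb : b ≠ 0) (K : ι) :
    R.cell K = lineCoord b ⁻¹' Set.Icc (R.leftEnd b K) (R.rightEnd b K) := by
  have h1 : lineCoord b '' R.cell K = Set.Icc (R.leftEnd b K) (R.rightEnd b K) := by
    have h2 := (lineCoord b).toLinearMap.image_convexHull (Set.range (R.simplex K).points)
    rw [range_points hb] at h2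
    rw [cell, range_points hb]
    refine h2.trans ?_
    simp only [ContinuousLinearMap.coe_coe, Set.image_pair, lineCoord_smul hb, convexHull_pair]
    exact segment_eq_Icc (leftEnd_lt_rightEnd hb K).le
  rw [← h1, Set.preimage_image_eq _ (lineCoord_injective hb)]

theorem mem_cell_iff (hb : b ≠ 0) {K : ι} {x : EuclideanSpace ℝ (Fin 1)} :
    x ∈ R.cell K ↔ R.leftEnd b K ≤ lineCoord b x ∧ lineCoord b x ≤ R.rightEnd b K := by
  rw [cell_eq_preimage hb]
  rfl

theorem mem_interior_cell_iff (hb : b ≠ 0) {K : ι} {x : EuclideanSpace ℝ (Fin 1)} :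
    x ∈ interior (R.cell K) ↔ R.leftEnd b K < lineCoord b x ∧ lineCoord b x < R.rightEnd b K := by
  rw [cell_eq_preimage hb, ← (isOpenMap_lineCoord hb).preimage_interior_eq_interior_preimage
    (lineCoord b).continuous, interior_Icc]
  rfl

theorem rightEnd_le_leftEnd_or (hb : b ≠ 0) {K L : ι}
    (h : Disjoint (interior (R.cell K)) (interior (R.cell L))) :
    R.rightEnd b K ≤ R.leftEnd b L ∨ R.rightEnd b L ≤ R.leftEnd b K := by
  by_contra! hcon
  have h1 := leftEnd_lt_rightEnd (R := R) hb K
  have h2 := leftEnd_lt_rightEnd (R := R) hb L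
  obtain ⟨t, ht1, ht2⟩ := exists_between
    (max_lt (lt_min h1 hcon.2) (lt_min hcon.1 h2) :
      max (R.leftEnd b K) (R.leftEnd b L) < min (R.rightEnd b K) (R.rightEnd b L))
  rw [max_lt_iff] at ht1
  rw [lt_min_iff] at ht2
  have h3 : t • b ∈ interior (R.cell K) := by
    rw [mem_interior_cell_iff hb, lineCoord_smul hb]
    exact ⟨ht1.1, ht2.1⟩
  refine Set.disjoint_left.1 h h3 ?_
  rw [mem_interior_cell_iff hb, lineCoord_smul hb]
  exact ⟨ht1.2, ht2.2⟩

theorem inter_eq_convexHull_of_rightEnd_le (hb : b ≠ 0) {K L : ι}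
    (h : R.rightEnd b K ≤ R.leftEnd b L) :
    R.cell K ∩ R.cell L = convexHull ℝ
      (Set.range (R.simplex K).points ∩ Set.range (R.simplex L).points) := by
  have hK := leftEnd_lt_rightEnd (R := R) hb K
  have hL := leftEnd_lt_rightEnd (R := R) hb L
  refine Set.Subset.antisymm (fun x hx => subset_convexHull ℝ _ ?_)
    (convexHull_min (Set.inter_subset_inter (subset_convexHull ℝ _) (subset_convexHull ℝ _))
      ((R.convex_cell K).inter (R.convex_cell L)))
  obtain ⟨h1, h2⟩ := (mem_cell_iff hb).1 hx.1
  obtain ⟨h3, h4⟩ := (mem_cell_iff hb).1 hx.2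
  rw [range_points hb, range_points hb, ← lineCoord_smul_self hb x,
    show lineCoord b x = R.rightEnd b K by linarith]
  refine ⟨Or.inr rfl, Or.inl ?_⟩
  rw [show R.rightEnd b K = R.leftEnd b L by linarith]

/-- Two intervals with disjoint interiors share at most an end point, so conformity need not be
assumed for `n = 1`. -/
theorem Tiles.inter_eq_convexHull {T : Finset ι} {A : Set (EuclideanSpace ℝ (Fin 1))}
    (h : R.Tiles T A) {K L : ι} (hK : K ∈ T) (hL : L ∈ T) :
    R.cell K ∩ R.cell L = convexHull ℝ
      (Set.range (R.simplex K).points ∩ Set.range (R.simplex L).points) := by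
  have hb : (EuclideanSpace.single 0 1 : EuclideanSpace ℝ (Fin 1)) ≠ 0 := fun h0 => by
    simpa using congrArg (fun x : EuclideanSpace ℝ (Fin 1) => x 0) h0
  by_cases hKL : K = L
  · rw [hKL, Set.inter_self, Set.inter_self, cell]
  · rcases rightEnd_le_leftEnd_or hb (h.2 K hK L hL hKL) with h1 | h1
    · exact inter_eq_convexHull_of_rightEnd_le hb h1
    · rw [Set.inter_comm, inter_eq_convexHull_of_rightEnd_le hb h1, Set.inter_comm]

theorem cell_eq_closedBall (hb : b ≠ 0) (K : ι) :
    R.cell K = Metric.closedBall (((R.leftEnd b K + R.rightEnd b K) / 2) • b)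
      ((R.rightEnd b K - R.leftEnd b K) / 2 * ‖b‖) := by
  ext x
  rw [mem_cell_iff hb, Metric.mem_closedBall, dist_eq_norm, norm_sub_eq_lineCoord hb,
    lineCoord_smul hb, mul_le_mul_iff_left₀ (norm_pos_iff.2 hb), abs_le]
  constructor
  · rintro ⟨h1, h2⟩
    constructor <;> linarith
  · rintro ⟨h1, h2⟩
    constructor <;> linarith

theorem volume_cell_eq (hb : b ≠ 0) (K : ι) :
    (volume (R.cell K)).toReal = (R.rightEnd b K - R.leftEnd b K) *
      (‖b‖ / 2 * (volume (Metric.ball (0 : EuclideanSpace ℝ (Fin 1)) 1)).toReal) := by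
  have h := leftEnd_lt_rightEnd (R := R) hb K
  rw [cell_eq_closedBall hb, Measure.addHaar_closedBall _ _ (by
    have := norm_nonneg b
    have : 0 ≤ R.rightEnd b K - R.leftEnd b K := by linarith
    positivity), ENNReal.toReal_mul, ENNReal.toReal_ofReal (by
    have := norm_nonneg b
    have : 0 ≤ R.rightEnd b K - R.leftEnd b K := by linarith
    positivity), finrank_euclideanSpace, Fintype.card_fin]
  ring

theorem rightEnd_sub_leftEnd_le (hb : b ≠ 0) (K : ι) :
    (R.rightEnd b K - R.leftEnd b K) * ‖b‖ ≤ Metric.diam (R.cell K) := by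
  have h := leftEnd_lt_rightEnd (R := R) hb K
  have h1 : R.rightEnd b K • b ∈ R.cell K := (mem_cell_iff hb).2 (by
    rw [lineCoord_smul hb]; exact ⟨h.le, le_rfl⟩)
  have h2 : R.leftEnd b K • b ∈ R.cell K := (mem_cell_iff hb).2 (by
    rw [lineCoord_smul hb]; exact ⟨le_rfl, h.le⟩)
  have h3 := Metric.dist_le_diam_of_mem (R.isBounded_cell K) h1 h2
  rwa [dist_eq_norm, ← sub_smul, norm_smul, Real.norm_of_nonneg (by linarith)] at h3

end RefinementRule

end OneDimensional

/-! ### Discrete Gronwall lemma and plateau test functions -/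

section OneDimensionalGalerkin

/-- Discrete Gronwall inequality running upstream. The index with the smallest `lo` occurs in no
other index's sum, so it can be added last, at the cost of a factor `1 + γ * l i ≤ exp (γ * l i)`.
-/
theorem sum_le_exp_mul_sum {κ : Type*} (T : Finset κ) (lo x a l : κ → ℝ) {γ : ℝ} (hγ : 0 ≤ γ)
    (hx : ∀ j ∈ T, 0 ≤ x j) (ha : ∀ j ∈ T, 0 ≤ a j) (hl : ∀ j ∈ T, 0 ≤ l j)
    (h : ∀ j ∈ T, x j ≤ a j + γ * l j * ∑ i ∈ T with lo j < lo i, x i) :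
    ∑ j ∈ T, x j ≤ Real.exp (γ * ∑ j ∈ T, l j) * ∑ j ∈ T, a j := by
  classical
  induction T using Finset.induction_on_min_value lo with
  | empty => simp
  | insert i s hi hmin ih =>
    have hs : ∀ j ∈ s, j ∈ insert i s := fun j hj => Finset.mem_insert_of_mem hj
    have h1 := ih (fun j hj => hx j (hs j hj)) (fun j hj => ha j (hs j hj))
      (fun j hj => hl j (hs j hj)) fun j hj => by
        have h2 := h j (hs j hj)
        rwa [Finset.filter_insert, if_neg (not_lt.2 (hmin j hj))] at h2
    have h2 := h i (Finset.mem_insert_self i s)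
    have hli := hl i (Finset.mem_insert_self i s)
    have hai := ha i (Finset.mem_insert_self i s)
    have h3 : ∑ j ∈ insert i s with lo i < lo j, x j ≤ ∑ j ∈ s, x j := by
      refine Finset.sum_le_sum_of_subset_of_nonneg (fun j hj => ?_) fun j hj _ => hx j (hs j hj)
      rw [Finset.mem_filter] at hj
      exact Finset.mem_of_mem_insert_of_ne hj.1 fun hji => by
        rw [hji] at hj
        exact lt_irrefl _ hj.2
    rw [Finset.sum_insert hi, Finset.sum_insert hi, Finset.sum_insert hi, mul_add γ, Real.exp_add]
    have hγl : 0 ≤ γ * l i := mul_nonneg hγ hli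
    have h4 : x i ≤ a i + γ * l i * ∑ j ∈ s, x j :=
      h2.trans (add_le_add_right (mul_le_mul_of_nonneg_left h3 hγl) _)
    have h5 : 1 + γ * l i ≤ Real.exp (γ * l i) := by
      rw [add_comm]; exact Real.add_one_le_exp _
    have h6 : 0 ≤ ∑ j ∈ s, x j := Finset.sum_nonneg fun j hj => hx j (hs j hj)
    have h7 : 1 ≤ Real.exp (γ * ∑ j ∈ s, l j) :=
      Real.one_le_exp (mul_nonneg hγ (Finset.sum_nonneg fun j hj => hl j (hs j hj)))
    have h8 : 1 ≤ Real.exp (γ * l i) := Real.one_le_exp hγl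
    calc x i + ∑ j ∈ s, x j ≤ a i + (1 + γ * l i) * ∑ j ∈ s, x j := by linarith
      _ ≤ a i + Real.exp (γ * l i) * (Real.exp (γ * ∑ j ∈ s, l j) * ∑ j ∈ s, a j) :=
        add_le_add_right (mul_le_mul h5 h1 h6 (Real.exp_pos _).le) _
      _ ≤ Real.exp (γ * l i) * Real.exp (γ * ∑ j ∈ s, l j) * a i +
          Real.exp (γ * l i) * (Real.exp (γ * ∑ j ∈ s, l j) * ∑ j ∈ s, a j) :=
        add_le_add_left (le_mul_of_one_le_left hai (one_le_mul_of_one_le_of_one_le h8 h7)) _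
      _ = _ := by ring

namespace RefinementRule

variable {ι : Type u} {R : RefinementRule 1 ι} {T : Finset ι}
  {A : Set (EuclideanSpace ℝ (Fin 1))} {b : EuclideanSpace ℝ (Fin 1)}

/-- The function has slope one along `b` on `K`, then stays constant up to the end `e` of the
component of the domain containing `K`, and drops to zero in the gap behind `e`, where no cell lies.
Its derivative on the domain thus lives on `K` alone. The point `e` is an outflow point, so the jump
there is allowed. `P` consists of the cells of the plateau. -/
theorem Tiles.exists_plateau (h : R.Tiles T A) (hb : b ≠ 0) {K : ι} (hK : K ∈ T) :
    ∃ (z : EuclideanSpace ℝ (Fin 1) → ℝ) (C : NNReal) (P : Set ι), LipschitzWith C z ∧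
      (∀ x, 0 ≤ z x) ∧ (∀ x, z x ≤ R.rightEnd b K - R.leftEnd b K) ∧
      (∀ x ∈ inflowBoundary (interior A) b, z x = 0) ∧
      (∀ L ∈ P, R.leftEnd b K < R.leftEnd b L) ∧
      (∀ x ∈ interior (R.cell K), z x = lineCoord b x - R.leftEnd b K) ∧
      (∀ L ∈ P, ∀ x ∈ interior (R.cell L), z x = R.rightEnd b K - R.leftEnd b K) ∧
      ∀ L ∈ T, L ≠ K → L ∉ P → ∀ x ∈ interior (R.cell L), z x = 0 := by
  set α := R.leftEnd b K with hα
  set β := R.rightEnd b K with hβ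
  have hαβ : α < β := leftEnd_lt_rightEnd hb K
  have hb' : 0 < ‖b‖ := norm_pos_iff.2 hb
  have hsm : Continuous fun t : ℝ => t • b := by fun_prop
  set Q : Set ℝ := {t | β ≤ t ∧ t • b ∉ interior A} with hQ
  have hQne : Q.Nonempty := by
    obtain ⟨M, hM⟩ := h.isBounded_interior.exists_norm_le
    refine ⟨max β ((|M| + 1) / ‖b‖), le_max_left _ _, fun hmem => ?_⟩
    have h1 := hM _ hmem
    rw [norm_smul, Real.norm_eq_abs] at h1
    have h2 : (|M| + 1) / ‖b‖ ≤ |max β ((|M| + 1) / ‖b‖)| :=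
      (le_max_right _ _).trans (le_abs_self _)
    rw [div_le_iff₀ hb'] at h2
    linarith [le_abs_self M]
  have hQbdd : BddBelow Q := ⟨β, fun t ht => ht.1⟩
  have hQcl : IsClosed Q := by
    have h1 : IsClosed {t : ℝ | t • b ∉ interior A} :=
      (isOpen_interior.preimage hsm).isClosed_compl
    exact isClosed_Ici.inter h1
  set e := sInf Q with he
  have heQ : e ∈ Q := hQcl.csInf_mem hQne hQbdd
  have hβe : β ≤ e := heQ.1
  have hKint : ∀ t, α < t → t < β → t • b ∈ interior A := fun t h1 h2 =>
    h.interior_cell_subset hK ((mem_interior_cell_iff hb).2 (by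
      rw [lineCoord_smul hb]; exact ⟨h1, h2⟩))
  have hKA : ∀ t, α ≤ t → t ≤ β → t • b ∈ A := fun t h1 h2 =>
    h.cell_subset hK ((mem_cell_iff hb).2 (by rw [lineCoord_smul hb]; exact ⟨h1, h2⟩))
  have hbefore : ∀ t, β ≤ t → t < e → t • b ∈ interior A := by
    intro t h1 h2
    by_contra hcon
    exact (not_lt.2 (csInf_le hQbdd (show t ∈ Q from ⟨h1, hcon⟩))) h2
  -- A cell reaching beyond `e` would, together with the stretch from `K` to `e`, put `e` into the
  -- interior of `A`.
  have hend : ∀ L ∈ T, R.leftEnd b L ≤ e → R.rightEnd b L ≤ e := by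
    intro L hL hle
    by_contra! hcon
    refine heQ.2 (mem_interior.2 ⟨lineCoord b ⁻¹' Set.Ioo α (R.rightEnd b L), ?_,
      isOpen_Ioo.preimage (lineCoord b).continuous, ?_⟩)
    · rintro x ⟨h1, h2⟩
      rw [← lineCoord_smul_self hb x]
      rcases lt_or_ge (lineCoord b x) β with h3 | h3
      · exact hKA _ h1.le h3.le
      · rcases lt_or_ge (lineCoord b x) e with h4 | h4
        · exact interior_subset (hbefore _ h3 h4)
        · refine h.cell_subset hL ((mem_cell_iff hb).2 ?_)
          rw [lineCoord_smul hb]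
          exact ⟨hle.trans h4, h2.le⟩
    · rw [Set.mem_preimage, lineCoord_smul hb]
      exact ⟨hαβ.trans_le hβe, hcon⟩
  -- Finitely many cells leave a gap of positive length behind `e`; the descent takes place inside
  -- it.
  obtain ⟨ε, hεall, hε⟩ : ∃ ε : ℝ, (∀ L ∈ T, e < R.leftEnd b L → e + ε ≤ R.leftEnd b L) ∧
      0 < ε := by
    have h1 : ∀ᶠ ε in 𝓝[>] (0 : ℝ), ∀ L ∈ T, e < R.leftEnd b L → e + ε ≤ R.leftEnd b L := by
      rw [Filter.eventually_all_finset]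
      intro L hL
      by_cases hlt : e < R.leftEnd b L
      · filter_upwards [Ioc_mem_nhdsGT (sub_pos.2 hlt)] with ε hε _
        linarith [hε.2]
      · exact Eventually.of_forall fun ε h => absurd h hlt
    exact (h1.and self_mem_nhdsWithin).exists
  set l := β - α with hl
  have hl0 : 0 < l := sub_pos.2 hαβ
  set z : EuclideanSpace ℝ (Fin 1) → ℝ := fun x =>
    max 0 (min (min (lineCoord b x - α) l) ((e + ε - lineCoord b x) * (l / ε))) with hz
  have hzdown : ∀ x, lineCoord b x ≤ e → l ≤ (e + ε - lineCoord b x) * (l / ε) := by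
    intro x hx
    have h1 : ε * (l / ε) = l := by field_simp
    calc l = ε * (l / ε) := h1.symm
      _ ≤ _ := mul_le_mul_of_nonneg_right (by linarith) (by positivity)
  have hz1 : ∀ x, α ≤ lineCoord b x → lineCoord b x ≤ β → z x = lineCoord b x - α := by
    intro x h1 h2
    have h3 := hzdown x (h2.trans hβe)
    simp only [hz]
    rw [min_eq_left (by linarith : lineCoord b x - α ≤ l), min_eq_left (by linarith),
      max_eq_right (by linarith)]
  have hz2 : ∀ x, β ≤ lineCoord b x → lineCoord b x ≤ e → z x = l := by
    intro x h1 h2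
    have h3 := hzdown x h2
    simp only [hz]
    rw [min_eq_right (by linarith : l ≤ lineCoord b x - α), min_eq_left h3, max_eq_right hl0.le]
  have hz3 : ∀ x, e + ε ≤ lineCoord b x → z x = 0 := by
    intro x h1
    refine max_eq_left ((min_le_right _ _).trans ?_)
    exact mul_nonpos_of_nonpos_of_nonneg (by linarith) (by positivity)
  have hz4 : ∀ x, lineCoord b x ≤ α → z x = 0 := fun x h1 =>
    max_eq_left (((min_le_left _ _).trans (min_le_left _ _)).trans (by linarith))
  have hzlip : ∃ C, LipschitzWith C z := by
    have h1 := (lineCoord b).lipschitz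
    have h2 : LipschitzWith _ fun x => lineCoord b x - α := h1.sub (LipschitzWith.const α)
    have h3 : LipschitzWith _ fun x => (l / ε) • (e + ε - lineCoord b x) :=
      (lipschitzWith_smul (l / ε)).comp ((LipschitzWith.const (e + ε)).sub h1)
    have h4 : ∀ x, (l / ε) • (e + ε - lineCoord b x) = (e + ε - lineCoord b x) * (l / ε) :=
      fun x => mul_comm _ _
    simp only [h4] at h3
    exact ⟨_, ((h2.min_const l).min h3).const_max 0⟩
  obtain ⟨C, hC⟩ := hzlip
  refine ⟨z, C, {L | L ∈ T ∧ β ≤ R.leftEnd b L ∧ R.leftEnd b L ≤ e}, hC, fun x => le_max_left _ _,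
    fun x => max_le hl0.le ((min_le_left _ _).trans (min_le_right _ _)), ?_,
    fun L hL => hαβ.trans_le hL.2.1, ?_, ?_, ?_⟩
  · refine fun x hx => closure_minimal ?_ (isClosed_singleton.preimage hC.continuous) hx
    rintro x ⟨hxf, ν, ⟨-, δ, hδ, hν⟩, hνb⟩
    have hx0 : x ∉ interior A := fun hxi => by
      have := (hν x (Metric.mem_ball_self hδ)).1 hxi
      simp at this
    change z x = 0
    rcases le_or_gt (lineCoord b x) α with h1 | h1
    · exact hz4 x h1
    rcases le_or_gt (e + ε) (lineCoord b x) with h2 | h2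
    · exact hz3 x h2
    exfalso
    rcases lt_trichotomy (lineCoord b x) e with h3 | h3 | h3
    · rw [← lineCoord_smul_self hb x] at hx0
      rcases lt_or_ge (lineCoord b x) β with h4 | h4
      · exact hx0 (hKint _ h1 h4)
      · exact hx0 (hbefore _ h4 h3)
    -- At `e` the domain lies on the upstream side, so an outward normal `ν` satisfies `ν · b > 0`.
    · have hnear : ∀ᶠ t in 𝓝[>] (0 : ℝ), x + (-t) • b ∈ Metric.ball x δ := by
        refine (tendsto_nhdsWithin_of_tendsto_nhds (Continuous.tendsto' (by fun_prop) 0 x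
          (by simp))).eventually (Metric.ball_mem_nhds x hδ)
      have hnear2 : ∀ᶠ t in 𝓝[>] (0 : ℝ), t < e - α :=
        nhdsWithin_le_nhds (Iio_mem_nhds (by linarith))
      obtain ⟨t, ⟨ht1, ht2⟩, ht3⟩ := ((hnear.and hnear2).and self_mem_nhdsWithin).exists
      have ht4 : x + (-t) • b ∈ interior A := by
        have h5 : lineCoord b (x + (-t) • b) = e - t := by
          rw [lineCoord_add_smul hb, h3]; ring
        rw [← lineCoord_smul_self hb (x + (-t) • b), h5]
        rcases lt_or_ge (e - t) β with h6 | h6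
        · exact hKint _ (by linarith) h6
        · exact hbefore _ h6 (by linarith)
      have h5 := (hν _ ht1).1 ht4
      rw [add_sub_cancel_left, inner_smul_left, real_inner_comm] at h5
      simp only [conj_trivial] at h5
      nlinarith
    · have hxA : x ∈ A := by
        have := frontier_subset_closure hxf
        exact closure_minimal interior_subset h.isCompact.isClosed this
      rw [← h.1] at hxA
      simp only [Set.mem_iUnion] at hxA
      obtain ⟨L, hL, hxL⟩ := hxA
      obtain ⟨h4, h5⟩ := (mem_cell_iff hb).1 hxL
      rcases le_or_gt (R.leftEnd b L) e with h6 | h6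
      · linarith [hend L hL h6]
      · linarith [hεall L hL h6]
  · intro x hx
    obtain ⟨h1, h2⟩ := (mem_interior_cell_iff hb).1 hx
    exact hz1 x h1.le h2.le
  · rintro L ⟨hL, h1, h2⟩ x hx
    obtain ⟨h3, h4⟩ := (mem_interior_cell_iff hb).1 hx
    exact hz2 x (h1.trans h3.le) (h4.le.trans (hend L hL h2))
  · intro L hL hne hLP x hx
    obtain ⟨h3, h4⟩ := (mem_interior_cell_iff hb).1 hx
    rcases rightEnd_le_leftEnd_or hb (h.2 K hK L hL hne.symm) with h5 | h5
    · have h6 : e < R.leftEnd b L := by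
        by_contra! hcon
        exact hLP ⟨hL, h5, hcon⟩
      exact hz3 x ((hεall L hL h6).trans h3.le)
    · exact hz4 x (h4.le.trans h5)

end RefinementRule

end OneDimensionalGalerkin

/-! ### Smallness of the residual means in one dimension -/

section OneDimensionalResidual

namespace RefinementRule

theorem PiecewisePolynomial.exists_const_abs_le {n : ℕ} {ι : Type u} {R : RefinementRule n ι}
    {T : Finset ι} {A : Set (EuclideanSpace ℝ (Fin n))} {c : EuclideanSpace ℝ (Fin n) → ℝ}
    (hc : R.PiecewisePolynomial T 0 c) (hT : R.Tiles T A) {γ : ℝ}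
    (hcγ : ∀ᵐ x ∂(volume.restrict (interior A)), |c x| ≤ γ) {K : ι} (hK : K ∈ T) :
    ∃ γ' : ℝ, |γ'| ≤ γ ∧ ∀ x ∈ interior (R.cell K), c x = γ' := by
  obtain ⟨γ', hγ'⟩ := hc.exists_const hK
  refine ⟨γ', ?_, hγ'⟩
  have h1 : ∀ᵐ x ∂(volume.restrict (interior (R.cell K))), |c x| ≤ γ := by
    rw [← R.restrict_cell]
    exact Filter.Eventually.filter_mono (ae_mono (hT.restrict_cell_le hK)) hcγ
  rw [ae_restrict_iff' isOpen_interior.measurableSet] at h1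
  obtain ⟨x, hx, hxK⟩ := (h1.and_frequently ((frequently_ae_iff).2
    (isOpen_interior.measure_pos volume (R.interior_cell_nonempty K)).ne')).exists
  rw [← hγ' x hxK]
  exact hx hxK

variable {ι : Type u} {R : RefinementRule 1 ι} {T : Finset ι}
  {A : Set (EuclideanSpace ℝ (Fin 1))} {b : EuclideanSpace ℝ (Fin 1)}
  {c u w f : EuclideanSpace ℝ (Fin 1) → ℝ} {mu mw mf : ℕ}

/-- Orthogonality is tested with the plateau function `z` and with `v` equal to `z` on the plateau
cells and `0` elsewhere. Then `v - z` lives on `K`, and `∂_b z + c v` is `1` on `K` and `c` times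
the plateau height downstream. Both components are admissible on the coarse mesh as `mw ≥ 1`. -/
theorem IsLeastSquaresSol.abs_setIntegral_residual_le (hT : R.Tiles T A) (hb : b ≠ 0)
    (hc : R.PiecewisePolynomial T 0 c) (hf : R.PiecewisePolynomial T mf f) (hmw : 1 ≤ mw)
    {γ : ℝ} (hcγ : ∀ᵐ x ∂(volume.restrict (interior A)), |c x| ≤ γ)
    (hsol : R.IsLeastSquaresSol (interior A) b c mu mw T f u w) {K : ι} (hK : K ∈ T) :
    |∫ x in R.cell K, transportResidual (interior A) b c u w f x| ≤
      (R.rightEnd b K - R.leftEnd b K) * (√(volume (R.cell K)).toReal *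
        √(∫ x in R.cell K, (u x - w x) ^ 2)) +
      γ * (R.rightEnd b K - R.leftEnd b K) * ∑ L ∈ T with R.leftEnd b K < R.leftEnd b L,
        |∫ x in R.cell L, transportResidual (interior A) b c u w f x| := by
  classical
  obtain ⟨z, C, P, hzC, hz0, hzl, hzin, hP, hzK, hzP, hzN⟩ := hT.exists_plateau hb hK
  set l := R.rightEnd b K - R.leftEnd b K with hl
  have hl0 : 0 < l := sub_pos.2 (leftEnd_lt_rightEnd hb K)
  set g := transportResidual (interior A) b c u w f with hg
  have hKP : K ∉ P := fun h => lt_irrefl _ (hP K h)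
  have hΩb := hT.isBounded_interior
  set v := R.stepFun T (fun L => if L ∈ P then l else 0) with hv
  set d : EuclideanSpace ℝ (Fin 1) → ℝ := fun x => lineDeriv ℝ z x b with hd
  have hzd : HasWeakDirDeriv (interior A) b z d := hzC.hasWeakDirDeriv hΩb
  have hvpp : R.PiecewisePolynomial T mu v := hT.piecewisePolynomial_stepFun _
  have hzpp : R.PiecewisePolynomial T mw z := by
    refine piecewisePolynomial_iff.2 fun L hL => ?_
    by_cases hLK : L = K
    · rw [hLK]
      exact ⟨_, Submodule.sub_mem _ (linear_mem_polyFun hmw (lineCoord b).toLinearMap)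
        (const_mem_polyFun (R.leftEnd b K)), hzK⟩
    by_cases hLP : L ∈ P
    · exact ⟨_, const_mem_polyFun l, hzP L hLP⟩
    · exact ⟨_, const_mem_polyFun 0, hzN L hL hLK hLP⟩
  have htrial : R.MemTrial (interior A) b mu mw T v z :=
    ⟨hvpp, hzpp, hzC.memHZeroInflow_of_nonneg hΩb hz0 hzin⟩
  have horth := hsol.orthogonal hT hc hf htrial hzd
  have hgL : MemLp g 2 (volume.restrict (interior A)) := hsol.1.memLp_residual hT hc hf
  have heL := hsol.1.memLp_diff hT
  have hvL := hvpp.memLp hT 2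
  have hcL : MemLp c ⊤ (volume.restrict (interior A)) := hc.memLp hT ⊤
  have i1 : Integrable (fun x => (u x - w x) * (v x - z x)) (volume.restrict (interior A)) :=
    heL.integrable_mul (hvL.sub hzd.1)
  have hcv : MemLp (fun x => c x * v x) 2 (volume.restrict (interior A)) := hvL.mul hcL
  have i2 : Integrable (fun x => g x * (d x + c x * v x)) (volume.restrict (interior A)) :=
    hgL.integrable_mul (hzd.2.1.add hcv)
  rw [hT.setIntegral i1, hT.setIntegral i2] at horth
  -- the derivative of the test function
  have hslope : ∀ L, ∀ x ∈ interior (R.cell L), ∀ y : EuclideanSpace ℝ (Fin 1) → ℝ,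
      (∀ x' ∈ interior (R.cell L), z x' = y x') → lineDeriv ℝ z x b = lineDeriv ℝ y x b := by
    intro L x hx y hy
    refine Filter.EventuallyEq.lineDeriv_eq ?_
    filter_upwards [isOpen_interior.mem_nhds hx] with x' hx' using hy x' hx'
  have hdK : ∀ x ∈ interior (R.cell K), d x = 1 := by
    intro x hx
    rw [hd]
    simp only
    rw [hslope K x hx _ hzK]
    refine HasLineDerivAt.lineDeriv ?_
    have h1 : (fun t : ℝ => lineCoord b (x + t • b) - R.leftEnd b K) =
        fun t => lineCoord b x + t - R.leftEnd b K := by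
      funext t
      rw [lineCoord_add_smul hb]
    rw [HasLineDerivAt, h1]
    exact ((hasDerivAt_id (0 : ℝ)).const_add _).sub_const _
  have hd0 : ∀ L ∈ T, L ≠ K → ∀ x ∈ interior (R.cell L), d x = 0 := by
    intro L hL hne x hx
    rw [hd]
    simp only
    by_cases hLP : L ∈ P
    · rw [hslope L x hx _ (hzP L hLP)]
      simp [lineDeriv]
    · rw [hslope L x hx _ (hzN L hL hne hLP)]
      simp [lineDeriv]
  have hvK : ∀ x ∈ interior (R.cell K), v x = 0 := fun x hx => by
    rw [hv, hT.stepFun_eq _ hK hx, if_neg hKP]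
  have hvP : ∀ L ∈ T, L ∈ P → ∀ x ∈ interior (R.cell L), v x = l := fun L hL hLP x hx => by
    rw [hv, hT.stepFun_eq _ hL hx, if_pos hLP]
  have hvN : ∀ L ∈ T, L ∉ P → ∀ x ∈ interior (R.cell L), v x = 0 := fun L hL hLP x hx => by
    rw [hv, hT.stepFun_eq _ hL hx, if_neg hLP]
  have hsum1 : ∑ L ∈ T, ∫ x in R.cell L, (u x - w x) * (v x - z x) =
      -∫ x in R.cell K, (u x - w x) * z x := by
    rw [Finset.sum_eq_single_of_mem K hK, ← integral_neg]
    · refine integral_congr_ae (ae_restrict_cell_of_interior fun x hx => ?_)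
      simp only [hvK x hx]
      ring
    · intro L hL hne
      rw [integral_congr_ae (ae_restrict_cell_of_interior (q := fun _ => 0) fun x hx => ?_),
        integral_zero]
      by_cases hLP : L ∈ P
      · rw [hvP L hL hLP x hx, hzP L hLP x hx, sub_self, mul_zero]
      · rw [hvN L hL hLP x hx, hzN L hL hne hLP x hx, sub_self, mul_zero]
  have hsum2 : |∑ L ∈ T.erase K, ∫ x in R.cell L, g x * (d x + c x * v x)| ≤
      γ * l * ∑ L ∈ T with R.leftEnd b K < R.leftEnd b L, |∫ x in R.cell L, g x| := by
    have h1 : ∀ L ∈ T.erase K, |∫ x in R.cell L, g x * (d x + c x * v x)| ≤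
        if R.leftEnd b K < R.leftEnd b L then γ * l * |∫ x in R.cell L, g x| else 0 := by
      intro L hL
      obtain ⟨hne, hL⟩ := Finset.mem_erase.1 hL
      obtain ⟨γ', hγ', hcγ'⟩ := hc.exists_const_abs_le hT hcγ hL
      have hγ0 : 0 ≤ γ := (abs_nonneg _).trans hγ'
      by_cases hLP : L ∈ P
      · rw [if_pos (hP L hLP), integral_congr_ae (ae_restrict_cell_of_interior
          (q := fun x => γ' * l * g x) fun x hx => by
            rw [hd0 L hL hne x hx, hvP L hL hLP x hx, hcγ' x hx]; ring),
          integral_const_mul, abs_mul, abs_mul, abs_of_pos hl0]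
        gcongr
      · rw [integral_congr_ae (ae_restrict_cell_of_interior (q := fun x => 0) fun x hx => by
            rw [hd0 L hL hne x hx, hvN L hL hLP x hx]; ring), integral_zero, abs_zero]
        split_ifs
        · positivity
        · exact le_rfl
    refine (Finset.abs_sum_le_sum_abs _ _).trans ((Finset.sum_le_sum h1).trans_eq ?_)
    have h2 : (if R.leftEnd b K < R.leftEnd b K then γ * l * |∫ x in R.cell K, g x| else 0) = 0 :=
      if_neg (lt_irrefl _)
    rw [Finset.sum_erase (f := fun L => if R.leftEnd b K < R.leftEnd b L then
      γ * l * |∫ x in R.cell L, g x| else 0) _ h2, ← Finset.sum_filter, Finset.mul_sum]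
  have hKterm : ∫ x in R.cell K, g x * (d x + c x * v x) = ∫ x in R.cell K, g x :=
    integral_congr_ae (ae_restrict_cell_of_interior fun x hx => by
      rw [hdK x hx, hvK x hx]; ring)
  rw [hsum1, ← Finset.add_sum_erase _ _ hK, hKterm] at horth
  have hez : |∫ x in R.cell K, (u x - w x) * z x| ≤
      l * (√(volume (R.cell K)).toReal * √(∫ x in R.cell K, (u x - w x) ^ 2)) := by
    have hle := hT.restrict_cell_le hK
    have h1 := abs_integral_mul_le (heL.mono_measure hle) (hzd.1.mono_measure hle)
    have hfin := (R.volume_cell_lt_top K).ne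
    have h2 : ∫ x in R.cell K, z x ^ 2 ≤ l ^ 2 * (volume (R.cell K)).toReal := by
      have h3 : ∫ x in R.cell K, z x ^ 2 ≤ ∫ _ in R.cell K, l ^ 2 :=
        integral_mono (hzd.1.mono_measure hle).integrable_sq
          (integrableOn_const hfin) fun x => pow_le_pow_left₀ (hz0 x) (hzl x) 2
      rw [setIntegral_const, smul_eq_mul, mul_comm] at h3
      exact h3
    have h3 := Real.sqrt_le_sqrt h2
    rw [Real.sqrt_mul (sq_nonneg _), Real.sqrt_sq hl0.le] at h3
    refine h1.trans ((mul_le_mul_of_nonneg_left h3 (Real.sqrt_nonneg _)).trans_eq ?_)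
    ring
  have h1 : ∫ x in R.cell K, g x = (∫ x in R.cell K, (u x - w x) * z x) -
      ∑ L ∈ T.erase K, ∫ x in R.cell L, g x * (d x + c x * v x) := by linarith
  rw [h1]
  exact (abs_sub _ _).trans (add_le_add hez hsum2)

/-- Gronwall applied to the preceding cellwise bound controls the sum `B` of all `|∫_K g|` by a
multiple of `σ √E`. Inserting `B` once more into the cellwise bound gives the sum of squares. -/
theorem exists_sum_sq_setIntegral_residual_le (hb : b ≠ 0) (mu mw mf : ℕ) (hmw : 1 ≤ mw) {γ W : ℝ}
    (hγ : 0 ≤ γ) :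
    ∃ C : ℝ, 0 < C ∧ ∀ (ι : Type u) (R : RefinementRule 1 ι) (A : Set (EuclideanSpace ℝ (Fin 1)))
      (c : EuclideanSpace ℝ (Fin 1) → ℝ) (T : Finset ι) (u w f : EuclideanSpace ℝ (Fin 1) → ℝ)
      (σ : ℝ), R.Tiles T A → R.PiecewisePolynomial T 0 c →
      (∀ᵐ x ∂(volume.restrict (interior A)), |c x| ≤ γ) → R.PiecewisePolynomial T mf f →
      R.IsLeastSquaresSol (interior A) b c mu mw T f u w →
      (volume (interior A)).toReal ≤ W → 0 ≤ σ → (∀ K ∈ T, Metric.diam (R.cell K) ≤ σ) →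
      ∑ K ∈ T, (∫ x in R.cell K, transportResidual (interior A) b c u w f x) ^ 2 /
        (volume (R.cell K)).toReal ≤
        C * σ ^ 2 * etaSq (interior A) b c u w f (interior A) := by
  have hb' : 0 < ‖b‖ := norm_pos_iff.2 hb
  have hV : 0 < (volume (Metric.ball (0 : EuclideanSpace ℝ (Fin 1)) 1)).toReal :=
    ENNReal.toReal_pos (Metric.measure_ball_pos volume 0 one_pos).ne' measure_ball_lt_top.ne
  set lam := ‖b‖ / 2 * (volume (Metric.ball (0 : EuclideanSpace ℝ (Fin 1)) 1)).toReal with hlam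
  have hlam0 : 0 < lam := by positivity
  set X := Real.exp (γ * (W / lam)) with hX
  have hX0 : 0 < X := Real.exp_pos _
  -- The two summands stem from the local term with `e` and from the downstream term; `lam` is the
  -- volume per unit of the coordinate, and `X` is the Gronwall factor.
  refine ⟨(2 + 2 * γ ^ 2 * W ^ 2 / lam ^ 2 * X ^ 2) / ‖b‖ ^ 2, by positivity, ?_⟩
  intro ι R A c T u w f σ hT hc hcγ hf hsol hW hσ hdiam
  set g := transportResidual (interior A) b c u w f with hg
  set E := etaSq (interior A) b c u w f (interior A) with hE
  set k : ι → ℝ := fun K => (volume (R.cell K)).toReal with hk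
  set l : ι → ℝ := fun K => R.rightEnd b K - R.leftEnd b K with hl
  set e : ι → ℝ := fun K => ∫ x in R.cell K, (u x - w x) ^ 2 with he
  set s := σ / ‖b‖ with hs
  have hs0 : 0 ≤ s := by positivity
  have hE0 : 0 ≤ E := etaSq_nonneg _
  have hW0 : 0 ≤ W := ENNReal.toReal_nonneg.trans hW
  have hl0 : ∀ K, 0 < l K := fun K => sub_pos.2 (leftEnd_lt_rightEnd hb K)
  have hkl : ∀ K, k K = l K * lam := fun K => volume_cell_eq hb K
  have hk0 : ∀ K, 0 < k K := fun K => by rw [hkl]; exact mul_pos (hl0 K) hlam0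
  have hls : ∀ K ∈ T, l K ≤ s := fun K hK => by
    rw [hs, le_div_iff₀ hb']
    exact (rightEnd_sub_leftEnd_le hb K).trans (hdiam K hK)
  have he0 : ∀ K, 0 ≤ e K := fun K => integral_nonneg fun _ => sq_nonneg _
  have hesum : ∑ K ∈ T, e K ≤ E := by
    have h1 := hT.setIntegral (hsol.1.memLp_diff hT).integrable_sq
    rw [← h1]
    exact le_add_of_nonneg_right (integral_nonneg fun _ => sq_nonneg _)
  have hksum : ∑ K ∈ T, k K ≤ W := by
    have h1 := hT.setIntegral (f := fun _ => (1 : ℝ))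
      (integrableOn_const hT.isBounded_interior.measure_lt_top.ne)
    simp only [setIntegral_const, smul_eq_mul, mul_one] at h1
    exact h1.symm.le.trans hW
  have hlsum : ∑ K ∈ T, l K ≤ W / lam := by
    rw [le_div_iff₀ hlam0, Finset.sum_mul]
    simpa only [hkl] using hksum
  have hqsum : ∑ K ∈ T, l K * (√(k K) * √(e K)) ≤ s * (√W * √E) := by
    have h1 : ∑ K ∈ T, √(k K) * √(e K) ≤ √W * √E :=
      (Real.sum_sqrt_mul_sqrt_le T (fun K => (hk0 K).le) he0).trans
        (mul_le_mul (Real.sqrt_le_sqrt hksum) (Real.sqrt_le_sqrt hesum) (Real.sqrt_nonneg _)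
          (Real.sqrt_nonneg _))
    refine le_trans ?_ (mul_le_mul_of_nonneg_left h1 hs0)
    rw [Finset.mul_sum]
    exact Finset.sum_le_sum fun K hK => mul_le_mul_of_nonneg_right (hls K hK) (by positivity)
  have hcell := fun K (hK : K ∈ T) => hsol.abs_setIntegral_residual_le hT hb hc hf hmw hcγ hK
  have hgron := sum_le_exp_mul_sum T (R.leftEnd b)
    (fun K => |∫ x in R.cell K, g x|) (fun K => l K * (√(k K) * √(e K))) l hγ
    (fun _ _ => abs_nonneg _) (fun K _ => mul_nonneg (hl0 K).le (by positivity))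
    (fun K _ => (hl0 K).le) hcell
  set B := X * (s * (√W * √E)) with hB
  have hB0 : 0 ≤ B := by positivity
  have hgB : ∑ K ∈ T, |∫ x in R.cell K, g x| ≤ B := by
    refine hgron.trans (mul_le_mul (Real.exp_le_exp.2 (mul_le_mul_of_nonneg_left hlsum hγ)) hqsum
      (Finset.sum_nonneg fun K _ => mul_nonneg (hl0 K).le (by positivity)) hX0.le)
  have hterm : ∀ K ∈ T, (∫ x in R.cell K, g x) ^ 2 / k K ≤
      2 * s ^ 2 * e K + 2 * γ ^ 2 / lam ^ 2 * B ^ 2 * k K := by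
    intro K hK
    have h1 : |∫ x in R.cell K, g x| ≤ l K * (√(k K) * √(e K)) + γ * l K * B := by
      refine (hcell K hK).trans (add_le_add_right (mul_le_mul_of_nonneg_left
        (le_trans ?_ hgB) (mul_nonneg hγ (hl0 K).le)) _)
      exact Finset.sum_le_sum_of_subset_of_nonneg (Finset.filter_subset _ _)
        fun _ _ _ => abs_nonneg _
    have h2 : (∫ x in R.cell K, g x) ^ 2 ≤
        2 * (l K * (√(k K) * √(e K))) ^ 2 + 2 * (γ * l K * B) ^ 2 := by
      rw [← sq_abs]
      refine (pow_le_pow_left₀ (abs_nonneg _) h1 2).trans ?_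
      nlinarith [sq_nonneg (l K * (√(k K) * √(e K)) - γ * l K * B)]
    rw [div_le_iff₀ (hk0 K)]
    refine h2.trans ?_
    rw [mul_pow, mul_pow (√(k K)), Real.sq_sqrt (hk0 K).le, Real.sq_sqrt (he0 K), add_mul]
    refine add_le_add ?_ (le_of_eq ?_)
    · have h3 : l K ^ 2 ≤ s ^ 2 := pow_le_pow_left₀ (hl0 K).le (hls K hK) 2
      have h4 := mul_le_mul_of_nonneg_right h3 (mul_nonneg (hk0 K).le (he0 K))
      linarith
    · rw [hkl]
      field_simp
  have hsum := Finset.sum_le_sum hterm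
  rw [Finset.sum_add_distrib, ← Finset.mul_sum, ← Finset.mul_sum] at hsum
  refine hsum.trans ?_
  have h1 : 2 * s ^ 2 * ∑ K ∈ T, e K ≤ 2 * s ^ 2 * E :=
    mul_le_mul_of_nonneg_left hesum (by positivity)
  have h2 : 2 * γ ^ 2 / lam ^ 2 * B ^ 2 * ∑ K ∈ T, k K ≤ 2 * γ ^ 2 / lam ^ 2 * B ^ 2 * W :=
    mul_le_mul_of_nonneg_left hksum (by positivity)
  have h3 : B ^ 2 = X ^ 2 * (s ^ 2 * (W * E)) := by
    rw [hB, mul_pow, mul_pow, mul_pow, Real.sq_sqrt hW0, Real.sq_sqrt hE0]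
  refine (add_le_add h1 h2).trans_eq ?_
  rw [h3, hs]
  field_simp

/-- On an interval `g` is its mean plus a deviation controlled by `∂_b g`, as `b` is the only
direction; the means are small by the preceding lemma. -/
theorem exists_sum_setIntegral_residual_sq_le (hb : b ≠ 0) (mu mw mf : ℕ) (hmw : 1 ≤ mw) (ϱ : ℝ)
    {γ W : ℝ} (hγ : 0 ≤ γ) :
    ∃ C : ℝ, 0 < C ∧ ∀ (ι : Type u) (R : RefinementRule 1 ι) (A : Set (EuclideanSpace ℝ (Fin 1)))
      (c : EuclideanSpace ℝ (Fin 1) → ℝ) (T S : Finset ι) (u w f : EuclideanSpace ℝ (Fin 1) → ℝ)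
      (p : ι → EuclideanSpace ℝ (Fin 1) → ℝ) (x₀ : ι → EuclideanSpace ℝ (Fin 1))
      (σ : ℝ), R.Tiles T A → R.PiecewisePolynomial T 0 c →
      (∀ᵐ x ∂(volume.restrict (interior A)), |c x| ≤ γ) → R.PiecewisePolynomial T mf f →
      R.IsLeastSquaresSol (interior A) b c mu mw T f u w →
      (volume (interior A)).toReal ≤ W → 0 ≤ σ → (∀ K ∈ T, Metric.diam (R.cell K) ≤ σ) →
      S ⊆ T → (∀ K ∈ S, p K ∈ polyFun 1 (max (max mu mw) mf)) →
      (∀ K ∈ S, transportResidual (interior A) b c u w f =ᵐ[volume.restrict (R.cell K)] p K) →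
      (∀ K ∈ S, Metric.closedBall (x₀ K) (innerRadius ϱ * Metric.diam (R.cell K)) ⊆ R.cell K) →
      ∑ K ∈ S, ∫ x in R.cell K, transportResidual (interior A) b c u w f x ^ 2 ≤
        C * (∑ K ∈ S, Metric.diam (R.cell K) ^ (1 + 2) * ballNorm (innerRadius ϱ / 2) (x₀ K)
          (Metric.diam (R.cell K)) (fun x => fderiv ℝ (p K) x b) ^ 2) +
        C * σ ^ 2 * etaSq (interior A) b c u w f (interior A) := by
  obtain ⟨C₁, hC₁, h1⟩ := exists_sum_sq_setIntegral_residual_le.{u} hb mu mw mf hmw (W := W) hγ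
  obtain ⟨C, hC, hbound⟩ := exists_ballNorm_bound 1 (max (max mu mw) mf)
    (half_pos (innerRadius_pos ϱ))
  have hμ := unitBallVolume_nonneg (n := 1)
  have hb' : 0 < ‖b‖ := norm_pos_iff.2 hb
  set C₂ := unitBallVolume 1 * (C / ‖b‖) ^ 2 with hC₂
  have hC₂0 : 0 ≤ C₂ := by positivity
  refine ⟨C₂ + C₁, by positivity, ?_⟩
  intro ι R A c T S u w f p x₀ σ hT hc hcγ hf hsol hW hσ hdiam hS hp hpg hx₀
  set g := transportResidual (interior A) b c u w f with hg
  set E := etaSq (interior A) b c u w f (interior A) with hE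
  have hE0 : 0 ≤ E := etaSq_nonneg _
  have hgL : MemLp g 2 (volume.restrict (interior A)) := hsol.1.memLp_residual hT hc hf
  have hcell : ∀ K ∈ S, ∫ x in R.cell K, g x ^ 2 ≤ C₂ * (Metric.diam (R.cell K) ^ (1 + 2) *
      ballNorm (innerRadius ϱ / 2) (x₀ K) (Metric.diam (R.cell K))
        (fun x => fderiv ℝ (p K) x b) ^ 2) +
      (∫ x in R.cell K, g x) ^ 2 / (volume (R.cell K)).toReal := by
    intro K hK
    set h := Metric.diam (R.cell K) with hh
    have hh0 : 0 < h := R.diam_cell_pos le_rfl K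
    set a := ballNorm (innerRadius ϱ / 2) (x₀ K) h (fun x => fderiv ℝ (p K) x b) with ha
    have ha0 : 0 ≤ a := ballNorm_nonneg _ _ _ _
    have hx₀K : x₀ K ∈ R.cell K :=
      hx₀ K hK (Metric.mem_closedBall_self (mul_nonneg (innerRadius_pos ϱ).le hh0.le))
    have hKball : R.cell K ⊆ Metric.closedBall (x₀ K) h := fun x hx =>
      Metric.mem_closedBall.2 (Metric.dist_le_diam_of_mem (R.isBounded_cell K) hx hx₀K)
    have hGb := (hbound _ (fderiv_apply_mem_polyFun (hp K hK) b) (x₀ K) h hh0).1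
    have hpd : Differentiable ℝ (p K) :=
      (contDiff_of_mem_polyFun (hp K hK)).differentiable (by simp)
    have hderiv : ∀ x ∈ R.cell K, ‖fderiv ℝ (p K) x‖ ≤ C * a / ‖b‖ := by
      intro x hx
      refine ContinuousLinearMap.opNorm_le_bound _ (by positivity) fun y => ?_
      have h2 : fderiv ℝ (p K) x y = lineCoord b y * fderiv ℝ (p K) x b := by
        conv_lhs => rw [← lineCoord_smul_self hb y, map_smul, smul_eq_mul]
      have h3 : ‖y‖ = |lineCoord b y| * ‖b‖ := by
        simpa using norm_sub_eq_lineCoord hb y 0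
      rw [h2, h3, Real.norm_eq_abs, abs_mul]
      have h4 := hGb x (hKball hx)
      calc |lineCoord b y| * |fderiv ℝ (p K) x b| ≤ |lineCoord b y| * (C * a) :=
            mul_le_mul_of_nonneg_left h4 (abs_nonneg _)
        _ = _ := by field_simp
    have hpt : ∀ x ∈ R.cell K, |p K x - p K (x₀ K)| ≤ h / ‖b‖ * (C * a) := by
      intro x hx
      have h2 := (R.convex_cell K).norm_image_sub_le_of_norm_fderiv_le (𝕜 := ℝ)
        (fun x _ => hpd x) hderiv hx₀K hx
      have h3 := Metric.dist_le_diam_of_mem (R.isBounded_cell K) hx hx₀K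
      rw [dist_eq_norm] at h3
      rw [← Real.norm_eq_abs]
      refine h2.trans ((mul_le_mul_of_nonneg_left h3 (by positivity)).trans_eq ?_)
      rw [← hh]
      ring
    have h2 := setIntegral_le_of_abs_le hh0.le hKball
      (f := fun x => (g x + (-p K (x₀ K)) * 1) ^ 2)
      (sq_nonneg (h / ‖b‖ * (C * a))) (by
        filter_upwards [ae_restrict_mem (R.measurableSet_cell K), hpg K hK] with x hx hx2
        rw [hx2, abs_pow, mul_one, ← sub_eq_add_neg]
        exact pow_le_pow_left₀ (abs_nonneg _) (hpt x hx) 2)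
    have h3 := (le_abs_self _).trans h2
    have hfin : IsFiniteMeasure (volume.restrict (R.cell K)) :=
      isFiniteMeasure_restrict.2 (R.volume_cell_lt_top K).ne
    rw [integral_add_const_mul_sq (hgL.mono_measure (hT.restrict_cell_le (hS hK)))
      (memLp_const (1 : ℝ))] at h3
    simp only [mul_one, one_pow, setIntegral_const, smul_eq_mul] at h3
    have hk0 : 0 < (volume (R.cell K)).toReal := by
      rw [volume_cell_eq hb]
      have hV : 0 < (volume (Metric.ball (0 : EuclideanSpace ℝ (Fin 1)) 1)).toReal :=
        ENNReal.toReal_pos (Metric.measure_ball_pos volume 0 one_pos).ne' measure_ball_lt_top.ne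
      have := sub_pos.2 (leftEnd_lt_rightEnd (R := R) hb K)
      positivity
    have hreal : volume.real (R.cell K) = (volume (R.cell K)).toReal := rfl
    rw [hreal] at h3
    set k := (volume (R.cell K)).toReal with hk
    set G := ∫ x in R.cell K, g x with hG
    -- Completing the square: subtracting the constant `p K (x₀ K)` lowers `∫ g²` by at most as much
    -- as subtracting the mean.
    have h4 : -(2 * -p K (x₀ K) * G + (-p K (x₀ K)) ^ 2 * k) ≤ G ^ 2 / k := by
      rw [le_div_iff₀ hk0]
      nlinarith [sq_nonneg (G - p K (x₀ K) * k)]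
    have h5 : unitBallVolume 1 * h ^ 1 * (h / ‖b‖ * (C * a)) ^ 2 =
        C₂ * (h ^ (1 + 2) * a ^ 2) := by
      rw [hC₂]; ring
    rw [h5, add_assoc] at h3
    exact (le_sub_iff_add_le.2 h3).trans (by rw [sub_eq_add_neg]; exact add_le_add_right h4 _)
  refine (Finset.sum_le_sum hcell).trans ?_
  rw [Finset.sum_add_distrib, ← Finset.mul_sum]
  have h2 := h1 ι R A c T u w f σ hT hc hcγ hf hsol hW hσ hdiam
  have h3 : ∑ K ∈ S, (∫ x in R.cell K, g x) ^ 2 / (volume (R.cell K)).toReal ≤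
      ∑ K ∈ T, (∫ x in R.cell K, g x) ^ 2 / (volume (R.cell K)).toReal :=
    Finset.sum_le_sum_of_subset_of_nonneg hS fun K _ _ =>
      div_nonneg (sq_nonneg _) ENNReal.toReal_nonneg
  refine add_le_add (mul_le_mul_of_nonneg_right (by linarith)
    (Finset.sum_nonneg fun K _ => ?_)) ((h3.trans h2).trans ?_)
  · exact mul_nonneg (pow_nonneg Metric.diam_nonneg _) (sq_nonneg _)
  · rw [mul_assoc, mul_assoc]
    exact mul_le_mul_of_nonneg_right (by linarith) (by positivity)

end RefinementRule

end OneDimensionalResidual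

/-! ### Combination of the cases -/

section Reduction

namespace RefinementRule

variable {n : ℕ}

/-- Excludes the case of small derivatives when `n = 1`. The bound `σ² = ξ₀² / (2 C)` lets the
mesh-size term consume only half of `ξ₀² E`. The premise `n = 1` stands behind the constants so that
they exist for every `n`. -/
theorem exists_gradient_bulk {b : EuclideanSpace ℝ (Fin n)} (hb : b ≠ 0) (mu mw mf : ℕ)
    (hmw : 1 ≤ mw) (ϱ : ℝ) {γ ξ₀ : ℝ} (W : ℝ) (hγ : 0 ≤ γ) (hξ₀ : 0 < ξ₀) :
    ∃ δ : ℝ, 0 < δ ∧ ∃ σ : ℝ, 0 < σ ∧ (n = 1 → ∀ (ι : Type u) (R : RefinementRule n ι)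
      (A : Set (EuclideanSpace ℝ (Fin n))) (c : EuclideanSpace ℝ (Fin n) → ℝ) (T S : Finset ι)
      (u w f : EuclideanSpace ℝ (Fin n) → ℝ) (p : ι → EuclideanSpace ℝ (Fin n) → ℝ)
      (x₀ : ι → EuclideanSpace ℝ (Fin n)), R.Tiles T A → R.PiecewisePolynomial T 0 c →
      (∀ᵐ x ∂(volume.restrict (interior A)), |c x| ≤ γ) → R.PiecewisePolynomial T mf f →
      R.IsLeastSquaresSol (interior A) b c mu mw T f u w →
      (volume (interior A)).toReal ≤ W → (∀ K ∈ T, Metric.diam (R.cell K) ≤ σ) →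
      S ⊆ T → (∀ K ∈ S, p K ∈ polyFun n (max (max mu mw) mf)) →
      (∀ K ∈ S, transportResidual (interior A) b c u w f =ᵐ[volume.restrict (R.cell K)] p K) →
      (∀ K ∈ S, Metric.closedBall (x₀ K) (innerRadius ϱ * Metric.diam (R.cell K)) ⊆ R.cell K) →
      ξ₀ ^ 2 * etaSq (interior A) b c u w f (interior A) ≤
        ∑ K ∈ S, ∫ x in R.cell K, transportResidual (interior A) b c u w f x ^ 2 →
      δ * etaSq (interior A) b c u w f (interior A) ≤
        ∑ K ∈ S, Metric.diam (R.cell K) ^ (n + 2) * ballNorm (innerRadius ϱ / 2) (x₀ K)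
          (Metric.diam (R.cell K)) (fun x => fderiv ℝ (p K) x b) ^ 2) := by
  by_cases hn : n = 1
  · subst hn
    obtain ⟨C, hC, h⟩ := exists_sum_setIntegral_residual_sq_le.{u} hb mu mw mf hmw ϱ (W := W) hγ
    refine ⟨ξ₀ ^ 2 / (2 * C), by positivity, √(ξ₀ ^ 2 / (2 * C)), Real.sqrt_pos.2 (by positivity),
      fun _ ι R A c T S u w f p x₀ hT hc hcγ hf hsol hW hdiam hS hp hpg hx₀ hbulk => ?_⟩
    have h1 := hbulk.trans (h ι R A c T S u w f p x₀ _ hT hc hcγ hf hsol hW (Real.sqrt_nonneg _)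
      hdiam hS hp hpg hx₀)
    rw [Real.sq_sqrt (by positivity)] at h1
    have h2 : C * (ξ₀ ^ 2 / (2 * C)) = ξ₀ ^ 2 / 2 := by field_simp
    rw [h2] at h1
    rw [div_mul_eq_mul_div, div_le_iff₀ (by positivity)]
    linarith
  · exact ⟨1, one_pos, 1, one_pos, fun h => absurd h hn⟩

theorem Tiles.inter_eq_convexHull_of_eq_one (hn : n = 1) {ι : Type u} {R : RefinementRule n ι}
    {T : Finset ι} {A : Set (EuclideanSpace ℝ (Fin n))} (h : R.Tiles T A) {K L : ι} (hK : K ∈ T)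
    (hL : L ∈ T) : R.cell K ∩ R.cell L = convexHull ℝ
      (Set.range (R.simplex K).points ∩ Set.range (R.simplex L).points) := by
  subst hn
  exact h.inter_eq_convexHull hK hL

variable {ι : Type u} {R : RefinementRule n ι} {A : Set (EuclideanSpace ℝ (Fin n))}
  {b : EuclideanSpace ℝ (Fin n)} {c u w f : EuclideanSpace ℝ (Fin n) → ℝ} {T M : Finset ι}
  {mu mw mf : ℕ}

theorem mem_cellsToRefine_of_mem (hM : M ⊆ T) {K : ι} (hK : K ∈ M) :
    K ∈ R.cellsToRefine b T M := by
  classical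
  rw [cellsToRefine, Finset.mem_filter]
  exact ⟨hM hK, Or.inl hK⟩

theorem typeTwo_subset {Ω : Set (EuclideanSpace ℝ (Fin n))} {β : ℝ} :
    R.typeTwo Ω b c β M u w f ⊆ M := Finset.filter_subset _ _

theorem mem_typeTwo {Ω : Set (EuclideanSpace ℝ (Fin n))} {β : ℝ} {K : ι} :
    K ∈ R.typeTwo Ω b c β M u w f ↔ K ∈ M ∧
      ∫ x in R.cell K, ((u x - w x) + c x * transportResidual Ω b c u w f x) ^ 2 <
        β * etaSq Ω b c u w f (R.cell K) := Finset.mem_filter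

theorem averagedResidual_eq_pieceFun {Ω : Set (EuclideanSpace ℝ (Fin n))} {β : ℝ} :
    R.averagedResidual Ω b c β M u w f = R.pieceFun (R.typeTwo Ω b c β M u w f)
      fun K => lineAverage b (R.cell K) (transportResidual Ω b c u w f) := rfl

/-- As `β < 1/4`, `‖e‖ ≤ ‖e + c g‖ + γ ‖g‖ ≤ (‖e‖ + ‖g‖) / 2 + γ ‖g‖`, and absorbing `‖e‖ / 2` gives
`‖e‖ ≤ (2 γ + 1) ‖g‖`. This is the origin of the constant in the bound on `ξ`. -/
theorem etaSq_le_of_mem_typeTwo (hT : R.Tiles T A) (hc : R.PiecewisePolynomial T 0 c) {γ : ℝ}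
    (hγ : 0 ≤ γ) (hcγ : ∀ᵐ x ∂(volume.restrict (interior A)), |c x| ≤ γ)
    (hf : R.PiecewisePolynomial T mf f) (htr : R.MemTrial (interior A) b mu mw T u w) (hM : M ⊆ T)
    {β : ℝ} (hβ : β < 1 / 4) {K : ι} (hK : K ∈ R.typeTwo (interior A) b c β M u w f) :
    etaSq (interior A) b c u w f (R.cell K) ≤ ((2 * γ + 1) ^ 2 + 1) *
      ∫ x in R.cell K, transportResidual (interior A) b c u w f x ^ 2 := by
  obtain ⟨hKM, hlt⟩ := mem_typeTwo.1 hK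
  have hle := hT.restrict_cell_le (hM hKM)
  have hgL := (htr.memLp_residual hT hc hf).mono_measure hle
  have heL := (htr.memLp_diff hT).mono_measure hle
  have hcL : MemLp c ⊤ (volume.restrict (R.cell K)) := (hc.memLp hT ⊤).mono_measure hle
  have hcγK : ∀ᵐ x ∂(volume.restrict (R.cell K)), |c x| ≤ γ :=
    Filter.Eventually.filter_mono (ae_mono hle) hcγ
  set g := transportResidual (interior A) b c u w f with hg
  have hcgL : MemLp (fun x => c x * g x) 2 (volume.restrict (R.cell K)) := hgL.mul hcL
  have h1 := sqrt_integral_sub_sq_le (heL.add hcgL) hcgL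
  simp only [Pi.add_apply, add_sub_cancel_right] at h1
  have h2 := sqrt_integral_mul_sq_le hγ hcγK hgL
  rw [etaSq] at hlt ⊢
  set Ie := ∫ x in R.cell K, (u x - w x) ^ 2 with hIe
  set Ig := ∫ x in R.cell K, g x ^ 2 with hIg
  have hIe0 : 0 ≤ Ie := integral_nonneg fun _ => sq_nonneg _
  have hIg0 : 0 ≤ Ig := integral_nonneg fun _ => sq_nonneg _
  have h3 : √(∫ x in R.cell K, (u x - w x + c x * g x) ^ 2) ≤ 1 / 2 * (√Ie + √Ig) := by
    refine Real.sqrt_le_iff.2 ⟨by positivity, hlt.le.trans ?_⟩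
    have h4 : β * (Ie + Ig) ≤ 1 / 4 * (Ie + Ig) :=
      mul_le_mul_of_nonneg_right hβ.le (add_nonneg hIe0 hIg0)
    nlinarith [Real.sq_sqrt hIe0, Real.sq_sqrt hIg0,
      mul_nonneg (Real.sqrt_nonneg Ie) (Real.sqrt_nonneg Ig)]
  have h4 : √Ie ≤ (2 * γ + 1) * √Ig := by linarith
  have h5 := pow_le_pow_left₀ (Real.sqrt_nonneg _) h4 2
  rw [mul_pow, Real.sq_sqrt hIe0, Real.sq_sqrt hIg0] at h5
  linarith

/-- The case distinction: first by which type of cell dominates, then by the size of the scaled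
streamline derivative of `g`, and last by dimension. -/
theorem exists_hasDescent (hn : 1 ≤ n) {b : EuclideanSpace ℝ (Fin n)} (hb : b ≠ 0)
    (mu mw mf : ℕ) (hmw : 1 ≤ mw) (ϱ : ℝ) {s : ℕ → ℝ} (hs : Tendsto s atTop (𝓝 0)) {ϑ : ℝ}
    (hϑ : 0 < ϑ) {β ξ : ℝ} (C : ℝ) (r₀ : ℕ) (hβ₀ : 0 < β) (hβ₁ : β < 1 / 4) {γ : ℝ} (hγ : 0 ≤ γ)
    (W : ℝ) (hξ : ξ < (√2 / ϑ * √((2 * γ + 1) ^ 2 + 1))⁻¹) :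
    ∃ σ₀ : ℝ, 0 < σ₀ ∧ ∃ (r : ℕ) (κ : ℝ), 0 < κ ∧ κ < 1 ∧
      ∀ (ι : Type u) (R : RefinementRule n ι) (A : Set (EuclideanSpace ℝ (Fin n)))
        (c : EuclideanSpace ℝ (Fin n) → ℝ) (T₀ : Finset ι),
        R.Tiles T₀ A → R.PiecewisePolynomial T₀ 0 c →
        (∀ᵐ x ∂(volume.restrict (interior A)), |c x| ≤ γ) → (volume (interior A)).toReal ≤ W →
        R.ShapeRegular T₀ ϱ → R.ShrinksBy T₀ s → R.MeshSizeLE T₀ σ₀ →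
        (1 < n → R.UniformlyConforming T₀ ∧
          R.StreamlineConjecture (interior A) b c mu mw mf T₀ ϑ β ξ C r₀) →
        ∀ T, R.IsMesh T₀ T → ∀ f, R.PiecewisePolynomial T mf f →
        ∀ u w, R.IsLeastSquaresSol (interior A) b c mu mw T f u w →
        ∀ M ⊆ T, ϑ * √(etaSq (interior A) b c u w f (interior A)) ≤
          R.etaCells (interior A) b c M u w f →
        0 < etaSq (interior A) b c u w f (interior A) →
        R.HasDescent (interior A) b c mu mw (R.refinement b T M r) u w f κ := by
  classical
  set Q := (2 * γ + 1) ^ 2 + 1 with hQ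
  have hQ0 : 0 < Q := by positivity
  set ξ₀ := (√2 / ϑ * √Q)⁻¹ with hξ₀
  have hξ₀0 : 0 < ξ₀ := by positivity
  have hξ₀sq : ξ₀ ^ 2 = ϑ ^ 2 / (2 * Q) := by
    rw [hξ₀, inv_pow, mul_pow, div_pow, Real.sq_sqrt zero_le_two, Real.sq_sqrt hQ0.le]
    field_simp
  obtain ⟨κ₁, hκ₁, θ₁, hθ₁, hone⟩ := exists_hasDescent_of_type_one.{u} hn mu mw mf ϱ hβ₀
    (by positivity : 0 < ϑ ^ 2 / 2) hγ
  obtain ⟨κ₃, hκ₃, τ, hτ, θ₃, hθ₃, htrans⟩ := exists_hasDescent_of_transport.{u} hn mu mw mf ϱ C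
    hξ₀0 hξ hγ
  obtain ⟨CL, hCL, hline⟩ := exists_lineAverage_bound.{u} hn hb (max (max mu mw) mf) ϱ
  obtain ⟨δ₁, hδ₁, σ₁, hσ₁, hgrad⟩ := exists_gradient_bulk.{u} hb mu mw mf hmw ϱ W hγ hξ₀0
  -- The first entry turns a small derivative into `‖g - F‖ ≤ τ √E`; the second makes a small
  -- derivative impossible for `n = 1`.
  set δ := min (τ ^ 2 / CL) δ₁ with hδ
  have hδ0 : 0 < δ := lt_min (by positivity) hδ₁
  obtain ⟨κ₂, hκ₂, θ₂, hθ₂, σ₂, hσ₂, hbub⟩ := exists_hasDescent_of_bubble.{u} hn b mu mw mf hmw ϱ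
    hδ0
  obtain ⟨k, ⟨hk1, hk2⟩, hk3⟩ : ∃ k, (s (k + r₀) ≤ θ₁ ∧ s (k + r₀) ≤ θ₂) ∧ s k ≤ θ₃ := by
    have h1 := (tendsto_add_atTop_iff_nat r₀).2 hs
    exact (((h1.eventually_le_const hθ₁).and (h1.eventually_le_const hθ₂)).and
      (hs.eventually_le_const hθ₃)).exists
  rw [add_comm k r₀] at hk1 hk2
  -- The conjecture provides its function after `r₀` refinements; `k` further ones make the sampling
  -- accurate. The entry `1 / 2` only ensures `κ < 1`.
  refine ⟨min σ₁ σ₂, lt_min hσ₁ hσ₂, r₀ + k, min (min κ₁ κ₂) (min κ₃ (1 / 2)),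
    lt_min (lt_min hκ₁ hκ₂) (lt_min hκ₃ (by norm_num)),
    ((min_le_right _ _).trans (min_le_right _ _)).trans_lt (by norm_num), ?_⟩
  intro ι R A c T₀ hT₀ hc₀ hcγ hW hshape hshr hsize hconj T hmesh f hf u w hsol M hM hbulk hE
  have hT := hT₀.isMesh hmesh
  have hc := hc₀.of_isFiner (isFiner_of_isMesh hmesh)
  have htr := hsol.1
  set g := transportResidual (interior A) b c u w f with hg
  set E := etaSq (interior A) b c u w f (interior A) with hEdef
  have hT' : R.Tiles (R.refinement b T M (r₀ + k)) A := hT.refinement b M (r₀ + k)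
  have hdesc : ∀ r, ∀ K ∈ T, ∀ L ∈ R.descendants r K, ∃ T', R.IsMesh T₀ T' ∧ L ∈ T' :=
    fun r K hK L hL => exists_isMesh_of_mem_descendants r ⟨T, hmesh, hK⟩ hL
  have hdescsub : ∀ r, ∀ K, ∀ L ∈ R.descendants r K, R.cell L ⊆ R.cell K :=
    fun r K L hL => (R.tiles_descendants r K).cell_subset hL
  set S₂ := R.typeTwo (interior A) b c β M u w f with hS₂
  have hS₂M : S₂ ⊆ M := typeTwo_subset
  have hS₂T : S₂ ⊆ T := hS₂M.trans hM
  have heta0 : ∀ K, 0 ≤ etaSq (interior A) b c u w f (R.cell K) := fun K => etaSq_nonneg _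
  have hbulk' : ϑ ^ 2 * E ≤ ∑ K ∈ M, etaSq (interior A) b c u w f (R.cell K) := by
    have h1 := pow_le_pow_left₀ (by positivity) hbulk 2
    rwa [mul_pow, Real.sq_sqrt hE.le, etaCells,
      Real.sq_sqrt (Finset.sum_nonneg fun K _ => heta0 K)] at h1
  rw [← Finset.sum_sdiff hS₂M] at hbulk'
  -- The dominating part carries at least half of the bulk, whence `ϑ ^ 2 / 2` and the `√2` in `ξ₀`.
  by_cases hcase : R.etaCells (interior A) b c (M \ S₂) u w f ≤
      R.etaCells (interior A) b c S₂ u w f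
  swap
  · refine (hone ι R A b c T _ (M \ S₂) u w f hT hT' (hshape T hmesh) hc hcγ hf htr
      (Finset.sdiff_subset.trans hM) ?_ ?_ ?_ hE).mono ((min_le_left _ _).trans (min_le_left _ _))
    · intro L hL
      obtain ⟨K, hK, ⟨-, hLK⟩ | ⟨hKM, rfl⟩⟩ := mem_refinement.1 hL
      · refine ⟨K, hK, hdescsub _ K L hLK, Or.inr ((hshr T hmesh K hK _ L hLK).trans ?_)⟩
        exact mul_le_mul_of_nonneg_right hk1 Metric.diam_nonneg
      · exact ⟨L, hK, subset_rfl, Or.inl fun h => hKM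
          (mem_cellsToRefine_of_mem hM (Finset.sdiff_subset h))⟩
    · intro K hK
      obtain ⟨hKM, hKS⟩ := Finset.mem_sdiff.1 hK
      by_contra! hcon
      exact hKS (mem_typeTwo.2 ⟨hKM, hcon⟩)
    · rw [not_le, etaCells, etaCells] at hcase
      have h1 := Real.lt_sqrt (Real.sqrt_nonneg _) |>.1 hcase
      rw [Real.sq_sqrt (Finset.sum_nonneg fun K _ => heta0 K)] at h1
      linarith
  have hS₂bulk : ϑ ^ 2 / 2 * E ≤ ∑ K ∈ S₂, etaSq (interior A) b c u w f (R.cell K) := by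
    rw [etaCells, etaCells, Real.sqrt_le_sqrt_iff (Finset.sum_nonneg fun K _ => heta0 K)] at hcase
    linarith
  have hgbulk : ξ₀ ^ 2 * E ≤ ∑ K ∈ S₂, ∫ x in R.cell K, g x ^ 2 := by
    have h1 := hS₂bulk.trans (Finset.sum_le_sum fun K hK =>
      etaSq_le_of_mem_typeTwo hT hc hγ hcγ hf htr hM hβ₁ hK)
    rw [← Finset.mul_sum] at h1
    rw [hξ₀sq, div_mul_eq_mul_div, div_le_iff₀ (by positivity)]
    linarith
  choose! p hp hpg using fun K (hK : K ∈ T) => htr.exists_residual_eq hT hc hf hK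
  choose! x₀ hx₀ using fun K (hK : K ∈ T) =>
    R.exists_closedBall_subset_cell K (hshape T hmesh K hK)
  have hx₀' : ∀ K ∈ T,
      Metric.closedBall (x₀ K) (innerRadius ϱ * Metric.diam (R.cell K)) ⊆ R.cell K := by
    intro K hK
    rw [innerRadius, one_div_mul_eq_div]
    exact hx₀ K hK
  by_cases hD : δ * E ≤ ∑ K ∈ S₂, Metric.diam (R.cell K) ^ (n + 2) *
      ballNorm (innerRadius ϱ / 2) (x₀ K) (Metric.diam (R.cell K))
        (fun x => fderiv ℝ (p K) x b) ^ 2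
  · refine (hbub ι R A c T _ S₂ u w f (R.descendants (r₀ + k)) p x₀ hT hT' hc hf htr hS₂T
      (fun K _ => R.tiles_descendants _ K) ?_ ?_ ?_ ?_ ?_ (fun K hK => hp K (hS₂T hK))
      (fun K hK => hpg K (hS₂T hK)) (fun K hK => hx₀' K (hS₂T hK)) hD hE).mono
      ((min_le_left _ _).trans (min_le_right _ _))
    · intro K hK L hL
      obtain ⟨T', hT'm, hLT'⟩ := hdesc _ K (hS₂T hK) L hL
      exact hshape T' hT'm L hLT'
    · intro K hK L hL L' hL'
      rcases hn.lt_or_eq with h1 | h1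
      · exact (hconj h1).1 T hmesh K (hS₂T hK) _ L hL L' hL'
      · exact (R.tiles_descendants _ K).inter_eq_convexHull_of_eq_one h1.symm hL hL'
    · intro K hK L hL
      exact (hshr T hmesh K (hS₂T hK) _ L hL).trans
        (mul_le_mul_of_nonneg_right hk2 Metric.diam_nonneg)
    · exact fun K hK => (hsize T hmesh K (hS₂T hK)).trans (min_le_right _ _)
    · intro L hL
      obtain ⟨K, hK, ⟨-, hLK⟩ | ⟨hKM, rfl⟩⟩ := mem_refinement.1 hL
      · exact ⟨K, hK, hdescsub _ K L hLK, Or.inr hLK⟩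
      · exact ⟨L, hK, subset_rfl, Or.inl fun h => hKM (mem_cellsToRefine_of_mem hM (hS₂M h))⟩
  rw [not_le] at hD
  rcases hn.lt_or_eq with hn1 | hn1
  swap
  · have h1 := hgrad hn1.symm ι R A c T S₂ u w f p x₀ hT hc hcγ hf hsol hW
      (fun K hK => (hsize T hmesh K hK).trans (min_le_left _ _)) hS₂T
      (fun K hK => hp K (hS₂T hK)) (fun K hK => hpg K (hS₂T hK)) (fun K hK => hx₀' K (hS₂T hK))
      hgbulk
    have h2 : δ * E ≤ δ₁ * E := mul_le_mul_of_nonneg_right (min_le_right _ _) hE.le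
    exact absurd (h2.trans h1) (not_le.2 hD)
  obtain ⟨z, hz, hz0, hres, hzC⟩ := (hconj hn1).2 T hmesh f hf u w hsol M hM hbulk hcase
  have hlineK := fun K (hK : K ∈ S₂) => hline ι R K (p K) (hp K (hS₂T hK)) (x₀ K)
    (hx₀' K (hS₂T hK)) g (hpg K (hS₂T hK))
  set F := R.averagedResidual (interior A) b c β M u w f with hF
  rw [averagedResidual_eq_pieceFun] at hF
  have hT₁ : R.Tiles (R.refinement b T M r₀) A := hT.refinement b M r₀
  -- Cells that are not refined do no harm, because `z` vanishes on them.
  have hsub₁ : ∀ L ∈ R.refinement b T M (r₀ + k), ∃ K ∈ R.refinement b T M r₀,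
      R.cell L ⊆ R.cell K ∧ ((∀ x ∈ interior (R.cell K), z x = 0) ∨
        Metric.diam (R.cell L) ≤ θ₃ * Metric.diam (R.cell K)) := by
    intro L hL
    obtain ⟨K, hK, ⟨hKM, hLK⟩ | ⟨hKM, rfl⟩⟩ := mem_refinement.1 hL
    · rw [descendants_add, Finset.mem_biUnion] at hLK
      obtain ⟨K₁, hK₁, hLK₁⟩ := hLK
      obtain ⟨T₁, hT₁m, hK₁T₁⟩ := hdesc _ K hK K₁ hK₁
      exact ⟨K₁, mem_refinement.2 ⟨K, hK, Or.inl ⟨hKM, hK₁⟩⟩, hdescsub _ K₁ L hLK₁,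
        Or.inr ((hshr T₁ hT₁m K₁ hK₁T₁ k L hLK₁).trans
          (mul_le_mul_of_nonneg_right hk3 Metric.diam_nonneg))⟩
    · exact ⟨L, mem_refinement.2 ⟨L, hK, Or.inr ⟨hKM, rfl⟩⟩, subset_rfl, Or.inl (hz0 L hK hKM)⟩
  refine (htrans ι R A b c T (R.refinement b T M r₀) _ S₂ u w f F z hT hT₁ hT' ?_ hc hcγ hf htr
    hS₂T ?_ ?_ ?_ ?_ hz (fun L hL => ?_) hres hzC hsub₁ hE).mono
    ((min_le_right _ _).trans (min_le_left _ _))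
  · intro L hL
    obtain ⟨K, hK, ⟨-, hLK⟩ | ⟨-, rfl⟩⟩ := mem_refinement.1 hL
    · obtain ⟨T₁, hT₁m, hLT₁⟩ := hdesc _ K hK L hLK
      exact hshape T₁ hT₁m L hLT₁
    · exact hshape T hmesh L hK
  · rw [hF]
    exact hT.memLp_pieceFun hS₂T fun K hK => (hlineK K hK).1
  · intro K hK hKS x hx
    rw [hF]
    exact hT.pieceFun_eq_zero hS₂T _ hK hKS hx
  · refine Real.sqrt_le_iff.2 ⟨by positivity, ?_⟩
    rw [mul_pow, Real.sq_sqrt hE.le]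
    have h1 : ∀ K ∈ S₂, ∫ x in R.cell K, (g x - F x) ^ 2 ≤
        CL * (Metric.diam (R.cell K) ^ (n + 2) *
      ballNorm (innerRadius ϱ / 2) (x₀ K) (Metric.diam (R.cell K))
        (fun x => fderiv ℝ (p K) x b) ^ 2) := fun K hK => by
      refine le_of_eq_of_le (integral_congr_ae (ae_restrict_cell_of_interior fun x hx => ?_))
        (hlineK K hK).2
      rw [hF, hT.pieceFun_eq hS₂T _ hK hx]
    refine (Finset.sum_le_sum h1).trans ?_
    rw [← Finset.mul_sum]
    refine (mul_le_mul_of_nonneg_left hD.le hCL.le).trans ?_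
    have h2 : δ * CL ≤ τ ^ 2 := (le_div_iff₀ hCL).1 (min_le_left _ _)
    have h3 := mul_le_mul_of_nonneg_right h2 hE.le
    linarith
  · refine Real.le_sqrt_of_sq_le ?_
    rwa [mul_pow, Real.sq_sqrt hE.le]
  · obtain ⟨K, hK, hLK, -⟩ := hsub₁ L hL
    exact ⟨K, hK, hLK⟩

end RefinementRule

end Reduction


end

theorem theorem5p9 {n : ℕ} (hn : 1 ≤ n)
    (Ω : Set (EuclideanSpace ℝ (Fin n)))
    (b : EuclideanSpace ℝ (Fin n)) (hb : b ≠ 0)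
    (c : EuclideanSpace ℝ (Fin n) → ℝ)
    (mu mw mf : ℕ) (hmw : 1 ≤ mw)
    (ϱ : ℝ) (s : ℕ → ℝ) (hs : Tendsto s atTop (𝓝 0))
    (ϑ : ℝ) (hϑ₀ : 0 < ϑ) (hϑ₁ : ϑ ≤ 1)
    -- the constants of the conjecture, which is used for `n > 1` only
    (β ξ C : ℝ) (r₀ : ℕ) (hβ₀ : 0 < β) (hβ₁ : β < 1 / 4)
    (hξ : ξ < (√2 / ϑ *
      √((2 * (eLpNorm c ⊤ (volume.restrict Ω)).toReal + 1) ^ 2 + 1))⁻¹) :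
    ∃ σ₀ : ℝ, 0 < σ₀ ∧ ∃ (r : ℕ) (ν : ℝ), 0 < ν ∧ ν < 1 ∧
      ∀ (ι : Type u) (R : RefinementRule n ι) (T₀ : Finset ι),
        R.IsPartition Ω T₀ → R.PiecewisePolynomial T₀ 0 c →
        R.ShapeRegular T₀ ϱ → R.ShrinksBy T₀ s → R.MeshSizeLE T₀ σ₀ →
        (1 < n → R.UniformlyConforming T₀ ∧
          R.StreamlineConjecture Ω b c mu mw mf T₀ ϑ β ξ C r₀) →
        ∀ T, R.IsMesh T₀ T → ∀ f, R.PiecewisePolynomial T mf f →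
        ∀ u w, R.IsLeastSquaresSol Ω b c mu mw T f u w →
        ∀ M ⊆ T, ϑ * √(etaSq Ω b c u w f Ω) ≤ R.etaCells Ω b c M u w f →
        ∀ u' w', R.IsLeastSquaresSol Ω b c mu mw (R.refinement b T M r) f u' w' →
          √(etaSq Ω b c u' w' f Ω) ≤ ν * √(etaSq Ω b c u w f Ω) := by
  classical
  set γ := (eLpNorm c ⊤ (volume.restrict Ω)).toReal with hγ
  obtain ⟨σ₀, hσ₀, r, κ, hκ₀, hκ₁, hred⟩ := RefinementRule.exists_hasDescent.{u} hn hb mu mw mf hmw ϱ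
    hs hϑ₀ C r₀ hβ₀ hβ₁ (ENNReal.toReal_nonneg : 0 ≤ γ) (volume Ω).toReal hξ
  have hκsq : 0 < κ ^ 2 ∧ κ ^ 2 < 1 := ⟨by positivity, by nlinarith⟩
  refine ⟨σ₀, hσ₀, r, √(1 - κ ^ 2), Real.sqrt_pos.2 (by linarith),
    (Real.sqrt_lt' one_pos).2 (by linarith), ?_⟩
  intro ι R T₀ hpart hc₀ hshape hshr hsize hconj T hmesh f hf u w hsol M hM hbulk u' w' hsol'
  obtain ⟨A, hA, hT₀⟩ := hpart.exists_tiles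
  have hcγ := hc₀.ae_abs_le hT₀
  have hred' := hred ι R A c T₀ hT₀ hc₀
  have hT := hT₀.isMesh hmesh
  have hc := hc₀.of_isFiner (RefinementRule.isFiner_of_isMesh hmesh)
  have hfine : R.IsFiner T (R.refinement b T M r) := RefinementRule.isFiner_refinement b T M r
  have hfinal := fun h1 h2 h3 h4 => RefinementRule.HasDescent.sqrt_etaSq_le (b := b) (mu := mu)
    (mw := mw) (u := u) (w := w) (κ := κ) (u' := u') (w' := w') (hT.refinement b M r)
    (hc.of_isFiner hfine) (hf.of_isFiner hfine) h1 h2 h3 h4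
  rw [← hA] at hcγ hred' hfinal
  -- If the coarse residual is zero there is no descent direction to look for, and the refined
  -- minimum is zero since the trial spaces are nested.
  rcases (RefinementRule.etaSq_nonneg (b := b) (c := c) (u := u) (w := w) (f := f)
    (Ω := Ω) Ω).eq_or_lt' with hE | hE
  · have h1 := hsol'.2 u w (hsol.1.of_isFiner hfine)
    rw [hE] at h1 ⊢
    rw [Real.sqrt_eq_zero_of_nonpos h1, Real.sqrt_zero, mul_zero]
  · exact hfinal (hsol.1.of_isFiner hfine) hκ₀.le
      (hred' hcγ le_rfl hshape hshr hsize hconj T hmesh f hf u w hsol M hM hbulk hE) hsol'
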